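/- **Setting.** Let $U\subset\mathbb R^5$ be open, with coordinates $(x,y,z,p,r)$, and let $F,H$ be smooth functions on $U$. Put $$D=\partial_x+p\,\partial_z+r\,\partial_p+H\partial_r,\qquad \Delta=\partial_y+F\partial_z+(DF)\,\partial_p+(D^2F)\,\partial_r ,$$ and assume $F_r=0$, $F_{pp}\neq0$ and $D^3F=\Delta H$ on $U$. (These are the data of the completely integrable PDE system $z_y=F(x,y,z,z_x,z_{xx})$, $z_{xxx}=H(x,y,z,z_x,z_{xx})$, with $p=z_x$, $r=z_{xx}$.) Subscripts $x,y,z,p,r$ denote partial derivatives, and $DF_p=D(F_p)$, $DH_r=D(H_r)$, etc. Consider the coframe on $U$ $$\omega^1=dz-p\,dx-F\,dy,\quad \omega^2=dp-r\,dx-DF\,dy,\quad \omega^3=dr-H\,dx-D^2F\,dy,\quad \omega^4=dx,\quad\omega^5=dy .$$ The *para-CR structure* of $(F,H)$ is the class of coframes $g\,\omega$, where $g$ is an invertible matrix of functions of the form $$g=\begin{pmatrix} *&0&0&0&0\\ *&*&*&0&0\\ *&*&*&0&0\\ *&0&0&*&*\\ *&0&0&*&*\end{pmatrix}.$$ Let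 $G_0$ be the set of invertible matrices $g$ of this form with $g_{22}=\rho e^{\phi}$, $g_{44}=\rho e^{-\phi}$, $\rho>0$, $\phi\in\mathbb R$. Let $N$ be an open subset of a real normed space and $m:N\to U$ a smooth map (for instance the projection of a bundle over $U$). For a smooth function $g:N\to G_0$ put $\theta=g\cdot m^*\omega$. One says that $\theta$, together with 1-forms $\Omega_1,\dots,\Omega_4$ and functions $t^3{}_{13},t^3{}_{14},t^3{}_{23},t^5{}_{12},t^5{}_{45}$ on $N$, *satisfies the normalized torsion equations* if on $N$ $$\begin{aligned} d\theta^1&=\theta^2\wedge\theta^4-\theta^1\wedge\Omega_1,\\ d\theta^2&=\theta^3\wedge\theta^4+\theta^2\wedge(\Omega_2-\tfrac12\Omega_1)-\theta^1\wedge\Omega_3,\\ d\theta^3&=2\theta^3\wedge\Omega_2-\theta^2\wedge\Omega_3+t^3{}_{13}\theta^1\wedge\theta^3+t^3{}_{14}\theta^1\wedge\theta^4+t^3{}_{23}\theta^2\wedge\theta^3,\\ d\theta^4&=-\theta^2\wedge\theta^5-\theta^4\wedge(\tfrac12\Omega_1+\Omega_2)-\theta^1\wedge\Omega_4,\\ d\theta^5&=-2\theta^5\wedge\Omega_2+\theta^4\wedge\Omega_4+t^5{}_{12}\theta^1\wedge\theta^2+t^3{}_{13}\theta^1\wedge\theta^5+t^5{}_{45}\theta^4\wedge\theta^5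 . \end{aligned}$$ Define on $U$ $$\begin{aligned} A&=-\tfrac12\left(9D^2H_r-27DH_p-18\,(DH_r)H_r+18H_pH_r+4H_r^3+54H_z\right),\\ B&=\frac{40F_{ppp}^3-45F_{pp}F_{ppp}F_{pppp}+9F_{pp}^2F_{ppppp}}{2F_{pp}^3},\\ C&=\frac{2F_{ppp}+F_{pp}H_{rr}}{F_{pp}},\qquad \tilde C=\frac{(DF_p+F_z)\,C-F_p\,DC+\Delta C}{2F_{pp}}, \end{aligned}$$ $$h=\tfrac{H_r}{3},\quad s=\tfrac{2H_r^2+9H_p-3DH_r}{18},\quad l=\tfrac{F_{ppp}}{3F_{pp}},\quad q=\tfrac{3F_{pp}F_{pppp}-5F_{ppp}^2}{18F_{pp}^2},\quad K=F_{pp},\quad \mathcal N f=\tfrac{\Delta f-F_pDf}{K},$$ $$M=\begin{pmatrix}-1&0&0&0&0\\0&1&0&0&0\\ s&h&-1&0&0\\0&0&0&1&F_p\\ q&0&0&l&lF_p-F_{pp}\end{pmatrix},\qquad S(\rho,\phi,a,b)=\begin{pmatrix}\rho^2&0&0&0&0\\ a&\rho e^{\phi}&0&0&0\\ \frac{a^2}{2\rho^2}&\frac{ae^{\phi}}{\rho}&e^{2\phi}&0&0\\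 b&0&0&\rho e^{-\phi}&0\\ -\frac{b^2}{2\rho^2}&0&0&-\frac{be^{-\phi}}{\rho}&e^{-2\phi}\end{pmatrix},$$ where $a,b$ are the fibre coordinates usually denoted $f^2,\bar f{}^2$. Let $w=M\omega$ and $$\begin{aligned} V&=\tfrac12\Big(-\mathcal Nq-s_r+\tfrac{lF_{pz}-F_{ppz}-2q(DF_p+F_z)}{K}\Big),\qquad \beta_1=\tfrac14\Big(-\mathcal Nq+s_r+\tfrac{2q\,DF_p+lF_{pz}-F_{ppz}}{K}\Big),\\ \gamma_1&=s_p+h\,s_r-h_z-s\,h_r+\tfrac{q\,DF_z}{K},\\ \delta_1&=-\Big(Dq+l\,\mathcal Nq-l_z-q\,\mathcal Nl+\tfrac{l(F_{ppz}-lF_{pz})+q(l\,DF_p-DF_{pp}+lF_z)}{K}\Big),\\ \varpi_1&=\tfrac{lF_z}{K}w^4-\tfrac{F_z}{K}w^5,\qquad \varpi_2=\beta_1w^1+l\,w^2-\Big(\tfrac{l(2DF_p+F_z)}{2K}+h\Big)w^4+\tfrac{2DF_p+F_z}{2K}w^5,\\ \varpi_3&=\gamma_1w^1+\Big(\tfrac{q(DF_p+F_z)}{K}-\beta_1\Big)w^2-\Big(\tfrac{l\,DF_z}{K}+s\Big)w^4+\tfrac{DF_z}{K}w^5,\\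 \varpi_4&=\delta_1w^1-q\,w^2+\Big(\beta_1-\tfrac{q\,DF_p-lF_{pz}}{K}\Big)w^4-\tfrac{F_{pz}}{K}w^5 . \end{aligned}$$ For functions $\rho>0,\phi,a,b,u_1$ on $N$, put $\theta=S(\rho,\phi,a,b)\,M\,\omega$ (forms and functions on $U$ being pulled back by $m$), $\alpha=-\frac{a e^{-\phi}C}{3\rho^3}$, $\beta=-\frac{b e^{\phi}\tilde C}{3\rho^3}$, $\mu=\tfrac14(\beta-\alpha)$ and $$\begin{aligned} \Omega_1&=\tfrac{2d\rho}{\rho}+\varpi_1-u_1\theta^1+\tfrac{ae^{-\phi}}{\rho}w^4-\tfrac{be^{\phi}}{\rho}w^2,\\ \Omega_2&=-d\phi+\varpi_2+\tfrac{ab}{2\rho^2}w^1+\tfrac{be^{\phi}}{2\rho}w^2+\tfrac{ae^{-\phi}}{2\rho}w^4+\mu\,\theta^1,\\ \Omega_3&=\tfrac{da}{\rho^2}-\tfrac{a}{\rho^2}\big(d\phi+\tfrac{d\rho}{\rho}\big)+\tfrac{e^{\phi}}{\rho}\varpi_3+\tfrac{a}{\rho^2}(\varpi_2+\tfrac12\varpi_1)-\tfrac{au_1}{2}w^1-\tfrac{e^{\phi}(ab+\rho^4u_1)}{2\rho^3}w^2-\tfrac{be^{2\phi}}{\rho^2}w^3+\tfrac{a^2e^{-\phi}}{2\rho^3}w^4\\&\quad-\mu\,\theta^2-\tfrac{a}{\rho^2}\big(\tfrac{V}{\rho^2}+\tfrac{\alpha}{2}\big)\theta^1,\\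 \Omega_4&=\tfrac{db}{\rho^2}+\tfrac{b}{\rho^2}\big(d\phi-\tfrac{d\rho}{\rho}\big)+\tfrac{e^{-\phi}}{\rho}\varpi_4+\tfrac{b}{\rho^2}(\tfrac12\varpi_1-\varpi_2)-\tfrac{bu_1}{2}w^1-\tfrac{b^2e^{\phi}}{2\rho^3}w^2+\tfrac{e^{-\phi}(ab-\rho^4u_1)}{2\rho^3}w^4-\tfrac{ae^{-2\phi}}{\rho^2}w^5\\&\quad+\mu\,\theta^4-\tfrac{b}{\rho^2}\big(\tfrac{V}{\rho^2}+\tfrac{\beta}{2}\big)\theta^1 . \end{aligned}\tag{1}$$ **Theorem.** (i) Let $N,m$ be as above, let $g:N\to G_0$ be smooth and suppose that the forms $\theta^1,\dots,\theta^5$ of $\theta=g\cdot m^*\omega$ are linearly independent at each point of $N$. If $\theta$ satisfies the normalized torsion equations with some smooth 1-forms $\Omega_1,\dots,\Omega_4$ and some functions $t^i{}_{jk}$, then, with $a=-g_{21}$ and $b=-g_{41}$, $$\theta=S(\rho,\phi,a,b)\cdot M\cdot\omega,$$ $$t^3{}_{14}=\frac{e^{3\phi}}{27\rho^3}A,\quad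 t^5{}_{12}=\frac{e^{-3\phi}}{27\rho^3}B,\quad t^3{}_{23}=\frac{e^{-\phi}}{3\rho}C,\quad t^5{}_{45}=\frac{e^{\phi}}{3\rho}\tilde C,\quad t^3{}_{13}=\frac{V}{\rho^2}-\frac{a e^{-\phi}C}{6\rho^3}-\frac{be^{\phi}\tilde C}{6\rho^3},$$ and there is a smooth function $u_1$ on $N$ such that $\Omega_1,\dots,\Omega_4$ are given by (1). (ii) Conversely, for all smooth functions $\rho>0,\phi,a,b,u_1$ on $N$ the matrix $S(\rho,\phi,a,b)M$ takes values in $G_0$ (with the parameters $\rho,\phi$), the forms (1) are smooth, and $\theta=S(\rho,\phi,a,b)M\omega$ with the forms (1) and the functions $t^i{}_{jk}$ of (i) satisfies the normalized torsion equations. At every point where $(m,\rho,\phi,a,b):N\to U\times\mathbb R^4$ is a submersion (for instance everywhere on the bundle with base $U$ and fibre coordinates $\rho,\phi,a,b$, with or without the additional coordinate $u_1$) the nine forms $\theta^1,\dots,\theta^5,\Omega_1,\dots,\Omega_4$ are linearly independent. (iii) The vanishing or not of each of $A,B,C,\tilde C$ is para-CR invariant: let $(U',F',H')$ be a second system as above,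 with coframe $\omega'$ and functions $A',B',C',\tilde C'$, let $W\subset U$ be open and $\Phi:W\to U'$ a smooth map such that at each point $\Phi^*\omega'=g\,\omega$ with an invertible matrix $g$ of the form displayed above. Then for each $m\in W$: $A'(\Phi(m))=0$ if and only if $A(m)=0$, and likewise for $B$, $C$ and $\tilde C$. -/

import Mathlib

open scoped ContDiff

noncomputable section

namespace ParaCR

/-! ### Second jets `(x, y, z, p, r)` and the PDE systems -/

/-- The space of second jets, with coordinates `(x, y, z, p, r) = (m 0, m 1, m 2, m 3, m 4)`,
where `p` stands for `z_x` and `r` for `z_xx`. -/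
abbrev Jet : Type := Fin 5 → ℝ

/-- The coordinate differentials `dx, dy, dz, dp, dr`. -/
def dcoord (i : Fin 5) : Jet →L[ℝ] ℝ :=
  ContinuousLinearMap.proj (R := ℝ) (φ := fun _ : Fin 5 => ℝ) i

/-- Partial derivative with respect to the `i`-th coordinate. -/
def pd (i : Fin 5) (f : Jet → ℝ) : Jet → ℝ := fun m => fderiv ℝ f m (Pi.single i 1)

/-- `D = ∂_x + p ∂_z + r ∂_p + H ∂_r`. -/
def totalD (H f : Jet → ℝ) : Jet → ℝ := fun m =>
  pd 0 f m + m 3 * pd 2 f m + m 4 * pd 3 f m + H m * pd 4 f m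

/-- `Δ = ∂_y + F ∂_z + DF ∂_p + D²F ∂_r`. -/
def totalDelta (F H f : Jet → ℝ) : Jet → ℝ := fun m =>
  pd 1 f m + F m * pd 2 f m + totalD H F m * pd 3 f m + totalD H (totalD H F) m * pd 4 f m

/-- A system `z_y = F(x,y,z,z_x,z_xx)`, `z_xxx = H(x,y,z,z_x,z_xx)` on an open set `U` of jets with
`F_r = 0`, `F_pp ≠ 0` and the integrability condition `D³F = ΔH`. -/
structure PDESystem where
  U : Set Jet
  F : Jet → ℝ
  H : Jet → ℝ
  isOpen_U : IsOpen U
  smooth_F : ContDiffOn ℝ ∞ F U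
  smooth_H : ContDiffOn ℝ ∞ H U
  F_r : ∀ m ∈ U, pd 4 F m = 0
  F_pp : ∀ m ∈ U, pd 3 (pd 3 F) m ≠ 0
  integrable : ∀ m ∈ U, totalD H (totalD H (totalD H F)) m = totalDelta F H H m

/-! ### Differential forms of degree 1 and 2 on a normed space -/

section Forms

variable {E : Type*} [NormedAddCommGroup E] [NormedSpace ℝ E]

/-- Exterior derivative of a 1-form, as a function of two tangent vectors. -/
def extD (α : E → E →L[ℝ] ℝ) (e : E) : E → E → ℝ := fun v w =>
  extDeriv (fun y => ContinuousAlternatingMap.ofSubsingleton ℝ E ℝ (0 : Fin 1) (α y)) e ![v, w]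

theorem extD_apply {α : E → E →L[ℝ] ℝ} {e : E} (h : DifferentiableAt ℝ α e) (v w : E) :
    extD α e v w = fderiv ℝ α e v w - fderiv ℝ α e w v := by
  have h2 : HasFDerivAt
      (fun y => ContinuousAlternatingMap.ofSubsingleton ℝ E ℝ (0 : Fin 1) (α y))
      ((ContinuousAlternatingMap.ofSubsingletonLIE (ι := Fin 1) (𝕜 := ℝ) (E := E) (F := ℝ)
        0).toContinuousLinearEquiv.toContinuousLinearMap.comp (fderiv ℝ α e)) e :=
    (ContinuousAlternatingMap.ofSubsingletonLIE (ι := Fin 1) (𝕜 := ℝ) (E := E) (F := ℝ)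
      0).toContinuousLinearEquiv.toContinuousLinearMap.hasFDerivAt.comp e h.hasFDerivAt
  unfold extD extDeriv
  rw [h2.fderiv]
  simp [ContinuousAlternatingMap.alternatizeUncurryFin_apply, Fin.sum_univ_two, Fin.removeNth,
    sub_eq_add_neg]

/-- Wedge product of two covectors, `(α ∧ β)(v, w) = α v β w - α w β v`. -/
def wedge (α β : E →L[ℝ] ℝ) : E → E → ℝ := fun v w => α v * β w - α w * β v

/-- The normalized structure equations for five 1-forms `θ¹,…,θ⁵` (`θ 0,…,θ 4`), four 1-forms
`Ω₁,…,Ω₄` (`Ω 0,…,Ω 3`) and torsion functions `t³₁₃, t³₁₄, t³₂₃, t⁵₁₂, t⁵₄₅` on the set `N`. The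
coefficient of `θ¹ ∧ θ⁵` in `dθ⁵` is required to equal that of `θ¹ ∧ θ³` in `dθ³`. -/
structure TorsionNormalized (N : Set E) (θ : Fin 5 → E → E →L[ℝ] ℝ) (Ω : Fin 4 → E → E →L[ℝ] ℝ)
    (t313 t314 t323 t512 t545 : E → ℝ) : Prop where
  eq1 : ∀ e ∈ N, extD (θ 0) e = wedge (θ 1 e) (θ 3 e) - wedge (θ 0 e) (Ω 0 e)
  eq2 : ∀ e ∈ N, extD (θ 1) e = wedge (θ 2 e) (θ 3 e)
    + wedge (θ 1 e) (Ω 1 e - (1 / 2 : ℝ) • Ω 0 e) - wedge (θ 0 e) (Ω 2 e)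
  eq3 : ∀ e ∈ N, extD (θ 2) e = (2 : ℝ) • wedge (θ 2 e) (Ω 1 e) - wedge (θ 1 e) (Ω 2 e)
    + t313 e • wedge (θ 0 e) (θ 2 e) + t314 e • wedge (θ 0 e) (θ 3 e)
    + t323 e • wedge (θ 1 e) (θ 2 e)
  eq4 : ∀ e ∈ N, extD (θ 3) e = -wedge (θ 1 e) (θ 4 e)
    - wedge (θ 3 e) ((1 / 2 : ℝ) • Ω 0 e + Ω 1 e) - wedge (θ 0 e) (Ω 3 e)
  eq5 : ∀ e ∈ N, extD (θ 4) e = (-2 : ℝ) • wedge (θ 4 e) (Ω 1 e) + wedge (θ 3 e) (Ω 3 e)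
    + t512 e • wedge (θ 0 e) (θ 1 e) + t313 e • wedge (θ 0 e) (θ 4 e)
    + t545 e • wedge (θ 3 e) (θ 4 e)

end Forms

/-! ### Structure matrices -/

/-- The pattern of the matrices relating two representatives of one para-CR structure
of type `(1,2,2)`. -/
def IsStructureMatrix (g : Matrix (Fin 5) (Fin 5) ℝ) : Prop :=
  g = !![g 0 0, 0, 0, 0, 0;
         g 1 0, g 1 1, g 1 2, 0, 0;
         g 2 0, g 2 1, g 2 2, 0, 0;
         g 3 0, 0, 0, g 3 3, g 3 4;
         g 4 0, 0, 0, g 4 3, g 4 4] ∧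
  g 0 0 * (g 1 1 * g 2 2 - g 1 2 * g 2 1) * (g 3 3 * g 4 4 - g 3 4 * g 4 3) ≠ 0

/-- The matrices of the group `G₀` of the lifted coframe: structure matrices with diagonal entries
`ρ e^φ` and `ρ e^{-φ}`, `ρ > 0`, in the second and fourth place. The fibre coordinates `f²` and
`f̄²` are the entries `g 1 0` and `g 3 0`. -/
def IsG0 (ρ φ : ℝ) (g : Matrix (Fin 5) (Fin 5) ℝ) : Prop :=
  IsStructureMatrix g ∧ 0 < ρ ∧ g 1 1 = ρ * Real.exp φ ∧ g 3 3 = ρ * Real.exp (-φ)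

/-- The matrix `S` of the reduced structure group; `a` and `b` are the fibre coordinates `f²`
and `f̄²`. -/
def Smat (ρ φ a b : ℝ) : Matrix (Fin 5) (Fin 5) ℝ :=
  !![ρ ^ 2, 0, 0, 0, 0;
     a, ρ * Real.exp φ, 0, 0, 0;
     a ^ 2 / (2 * ρ ^ 2), a * Real.exp φ / ρ, Real.exp (2 * φ), 0, 0;
     b, 0, 0, ρ * Real.exp (-φ), 0;
     -b ^ 2 / (2 * ρ ^ 2), 0, 0, -b * Real.exp (-φ) / ρ, Real.exp (-2 * φ)]

namespace PDESystem

variable (s : PDESystem)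

/-! ### Derivatives of `F` and `H` -/

/-- `D` of the system. -/
def D (f : Jet → ℝ) : Jet → ℝ := totalD s.H f
/-- `Δ` of the system. -/
def Delta (f : Jet → ℝ) : Jet → ℝ := totalDelta s.F s.H f

def Fz : Jet → ℝ := pd 2 s.F
def Fp : Jet → ℝ := pd 3 s.F
def Fpz : Jet → ℝ := pd 2 s.Fp
def Fpp : Jet → ℝ := pd 3 s.Fp
def Fppz : Jet → ℝ := pd 2 s.Fpp
def Fppp : Jet → ℝ := pd 3 s.Fpp
def Fpppp : Jet → ℝ := pd 3 s.Fppp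
def Fppppp : Jet → ℝ := pd 3 s.Fpppp
def Hz : Jet → ℝ := pd 2 s.H
def Hp : Jet → ℝ := pd 3 s.H
def Hr : Jet → ℝ := pd 4 s.H
def Hrr : Jet → ℝ := pd 4 s.Hr

/-! ### The four basic quantities -/

def A : Jet → ℝ := fun m =>
  -(1 / 2) * (9 * s.D (s.D s.Hr) m - 27 * s.D s.Hp m - 18 * s.D s.Hr m * s.Hr m
    + 18 * s.Hp m * s.Hr m + 4 * s.Hr m ^ 3 + 54 * s.Hz m)

def B : Jet → ℝ := fun m =>
  (40 * s.Fppp m ^ 3 - 45 * s.Fpp m * s.Fppp m * s.Fpppp m + 9 * s.Fpp m ^ 2 * s.Fppppp m)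
    / (2 * s.Fpp m ^ 3)

def C : Jet → ℝ := fun m => (2 * s.Fppp m + s.Fpp m * s.Hrr m) / s.Fpp m

/-- The coframe derivatives `C_4` and `C_5` are `DC` and `ΔC`. -/
def Ctilde : Jet → ℝ := fun m =>
  ((s.D s.Fp m + s.Fz m) * s.C m - s.Fp m * s.D s.C m + s.Delta s.C m) / (2 * s.Fpp m)

/-! ### The initial coframe, its lifts, and local equivalences -/

/-- The initial coframe `ω¹ = dz - p dx - F dy`, `ω² = dp - r dx - DF dy`,
`ω³ = dr - H dx - D²F dy`, `ω⁴ = dx`, `ω⁵ = dy`. -/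
def coframe (j : Fin 5) (m : Jet) : Jet →L[ℝ] ℝ :=
  (![dcoord 2 - m 3 • dcoord 0 - s.F m • dcoord 1,
     dcoord 3 - m 4 • dcoord 0 - s.D s.F m • dcoord 1,
     dcoord 4 - s.H m • dcoord 0 - s.D (s.D s.F) m • dcoord 1,
     dcoord 0,
     dcoord 1] : Fin 5 → Jet →L[ℝ] ℝ) j

/-- The matrix of the normalized change of the initial coframe. -/
def normMat (m : Jet) : Matrix (Fin 5) (Fin 5) ℝ :=
  !![-1, 0, 0, 0, 0;
     0, 1, 0, 0, 0;
     (2 * s.Hr m ^ 2 + 9 * s.Hp m - 3 * s.D s.Hr m) / 18, s.Hr m / 3, -1, 0, 0;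
     0, 0, 0, 1, s.Fp m;
     (3 * s.Fpp m * s.Fpppp m - 5 * s.Fppp m ^ 2) / (18 * s.Fpp m ^ 2), 0, 0,
       s.Fppp m / (3 * s.Fpp m), (s.Fppp m * s.Fp m - 3 * s.Fpp m ^ 2) / (3 * s.Fpp m)]

/-- The normalized coframe `w = normMat · ω` on the jet space. -/
def normCoframe (i : Fin 5) (m : Jet) : Jet →L[ℝ] ℝ := ∑ j, s.normMat m i j • s.coframe j m

/-- A smooth map of an open set `W ⊆ s.U` to `s'.U` that pulls the class of coframes of `s'` back to
that of `s` (it is then automatically a local diffeomorphism). -/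
structure IsLocalEquiv (s s' : PDESystem) (W : Set Jet) (Φ : Jet → Jet) : Prop where
  isOpen : IsOpen W
  subset : W ⊆ s.U
  mapsTo : Set.MapsTo Φ W s'.U
  smooth : ContDiffOn ℝ ∞ Φ W
  pullback : ∀ m ∈ W, ∃ g : Matrix (Fin 5) (Fin 5) ℝ, IsStructureMatrix g ∧
    ∀ i, (s'.coframe i (Φ m)).comp (fderiv ℝ Φ m) = ∑ j, g i j • s.coframe j m

/-! ### Auxiliary functions and 1-forms on the jet space for the explicit connection forms -/

/-- `N f = (Δf - F_p Df) / F_pp`. -/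
def Nop (f : Jet → ℝ) : Jet → ℝ := fun m => (s.Delta f m - s.Fp m * s.D f m) / s.Fpp m

def hh : Jet → ℝ := fun m => s.Hr m / 3
def ss : Jet → ℝ := fun m => (2 * s.Hr m ^ 2 + 9 * s.Hp m - 3 * s.D s.Hr m) / 18
def ll : Jet → ℝ := fun m => s.Fppp m / (3 * s.Fpp m)
def qq : Jet → ℝ := fun m =>
  (3 * s.Fpp m * s.Fpppp m - 5 * s.Fppp m ^ 2) / (18 * s.Fpp m ^ 2)

/-- The base function of `t³₁₃`: its value where `ρ = 1` and `f² = f̄² = 0`. -/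
def V : Jet → ℝ := fun m =>
  (1 / 2) * (-s.Nop s.qq m - pd 4 s.ss m
    + (s.ll m * s.Fpz m - s.Fppz m - 2 * s.qq m * (s.D s.Fp m + s.Fz m)) / s.Fpp m)

def b1 : Jet → ℝ := fun m =>
  (1 / 4) * (-s.Nop s.qq m + pd 4 s.ss m
    + (2 * s.qq m * s.D s.Fp m + s.ll m * s.Fpz m - s.Fppz m) / s.Fpp m)

def c1 : Jet → ℝ := fun m =>
  pd 3 s.ss m + s.hh m * pd 4 s.ss m - pd 2 s.hh m - s.ss m * pd 4 s.hh m
    + s.qq m * s.D s.Fz m / s.Fpp m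

def d1 : Jet → ℝ := fun m =>
  -(s.D s.qq m + s.ll m * s.Nop s.qq m - pd 2 s.ll m - s.qq m * s.Nop s.ll m
    + (s.ll m * (s.Fppz m - s.ll m * s.Fpz m)
      + s.qq m * (s.ll m * s.D s.Fp m - s.D s.Fpp m + s.ll m * s.Fz m)) / s.Fpp m)

/-- Coefficients of the base forms `ϖ₁,…,ϖ₄` in the normalized coframe `w¹,…,w⁵`. -/
def varpiCoeff (m : Jet) : Matrix (Fin 4) (Fin 5) ℝ :=
  !![0, 0, 0, s.ll m * s.Fz m / s.Fpp m, -s.Fz m / s.Fpp m;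
     s.b1 m, s.ll m, 0,
       -(s.ll m * (2 * s.D s.Fp m + s.Fz m) / (2 * s.Fpp m)) - s.hh m,
       (2 * s.D s.Fp m + s.Fz m) / (2 * s.Fpp m);
     s.c1 m, s.qq m * (s.D s.Fp m + s.Fz m) / s.Fpp m - s.b1 m, 0,
       -(s.ll m * s.D s.Fz m / s.Fpp m) - s.ss m, s.D s.Fz m / s.Fpp m;
     s.d1 m, -s.qq m, 0,
       s.b1 m - (s.qq m * s.D s.Fp m - s.ll m * s.Fpz m) / s.Fpp m, -s.Fpz m / s.Fpp m]

def varpi (k : Fin 4) (m : Jet) : Jet →L[ℝ] ℝ := ∑ j, s.varpiCoeff m k j • s.normCoframe j m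

/-! ### Lifts along a map `m : E → Jet` -/

section Lift

variable {E : Type*} [NormedAddCommGroup E] [NormedSpace ℝ E]

/-- The 1-forms `θ^i = ∑ⱼ g^i_j m^*ω^j` on `E` obtained from a map `m` to the jet space and a
matrix-valued function `g`. For `m` the projection of a bundle over `U`, and the entries of `g`
functions on the bundle, this is a lifted coframe. -/
def lift (m : E → Jet) (g : E → Matrix (Fin 5) (Fin 5) ℝ) (i : Fin 5) (e : E) : E →L[ℝ] ℝ :=
  ∑ j, g e i j • (s.coframe j (m e)).comp (fderiv ℝ m e)

/-- The matrix `S(ρ,φ,a,b) · normMat`, along `m`. -/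
def redMat (m : E → Jet) (ρ φ a b : E → ℝ) (e : E) : Matrix (Fin 5) (Fin 5) ℝ :=
  Smat (ρ e) (φ e) (a e) (b e) * s.normMat (m e)

/-- The reduced lifted coframe `θ = S · normMat · m^*ω`. -/
def theta (m : E → Jet) (ρ φ a b : E → ℝ) : Fin 5 → E → E →L[ℝ] ℝ :=
  s.lift m (s.redMat m ρ φ a b)

def alpha (m : E → Jet) (ρ φ a : E → ℝ) (e : E) : ℝ :=
  -(a e * Real.exp (-φ e) * s.C (m e) / (3 * ρ e ^ 3))

def beta (m : E → Jet) (ρ φ b : E → ℝ) (e : E) : ℝ :=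
  -(b e * Real.exp (φ e) * s.Ctilde (m e) / (3 * ρ e ^ 3))

/-- The torsion `t³₁₃`. -/
def Q (m : E → Jet) (ρ φ a b : E → ℝ) (e : E) : ℝ :=
  s.V (m e) / ρ e ^ 2 + (s.alpha m ρ φ a e + s.beta m ρ φ b e) / 2

/-- The pullback of `ϖ_k`. -/
def varpiPull (m : E → Jet) (k : Fin 4) (e : E) : E →L[ℝ] ℝ :=
  (s.varpi k (m e)).comp (fderiv ℝ m e)

/-- The pullback of the normalized coframe. -/
def wPull (m : E → Jet) (i : Fin 5) (e : E) : E →L[ℝ] ℝ :=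
  (s.normCoframe i (m e)).comp (fderiv ℝ m e)

def Omega1 (m : E → Jet) (ρ φ a b u : E → ℝ) (e : E) : E →L[ℝ] ℝ :=
  (2 / ρ e) • fderiv ℝ ρ e + s.varpiPull m 0 e - u e • s.theta m ρ φ a b 0 e
    + (a e * Real.exp (-φ e) / ρ e) • s.wPull m 3 e - (b e * Real.exp (φ e) / ρ e) • s.wPull m 1 e

def Omega2 (m : E → Jet) (ρ φ a b : E → ℝ) (e : E) : E →L[ℝ] ℝ :=
  -fderiv ℝ φ e + s.varpiPull m 1 e + (a e * b e / (2 * ρ e ^ 2)) • s.wPull m 0 e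
    + (b e * Real.exp (φ e) / (2 * ρ e)) • s.wPull m 1 e
    + (a e * Real.exp (-φ e) / (2 * ρ e)) • s.wPull m 3 e
    + ((s.beta m ρ φ b e - s.alpha m ρ φ a e) / 4) • s.theta m ρ φ a b 0 e

def Omega3 (m : E → Jet) (ρ φ a b u : E → ℝ) (e : E) : E →L[ℝ] ℝ :=
  (1 / ρ e ^ 2) • fderiv ℝ a e
    - (a e / ρ e ^ 2) • (fderiv ℝ φ e + (1 / ρ e) • fderiv ℝ ρ e)
    + (Real.exp (φ e) / ρ e) • s.varpiPull m 2 e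
    + (a e / ρ e ^ 2) • (s.varpiPull m 1 e + (1 / 2 : ℝ) • s.varpiPull m 0 e)
    - (a e * u e / 2) • s.wPull m 0 e
    - (Real.exp (φ e) * (a e * b e + ρ e ^ 4 * u e) / (2 * ρ e ^ 3)) • s.wPull m 1 e
    - (b e * Real.exp (2 * φ e) / ρ e ^ 2) • s.wPull m 2 e
    + (a e ^ 2 * Real.exp (-φ e) / (2 * ρ e ^ 3)) • s.wPull m 3 e
    - ((s.beta m ρ φ b e - s.alpha m ρ φ a e) / 4) • s.theta m ρ φ a b 1 e
    - (a e / ρ e ^ 2 * (s.V (m e) / ρ e ^ 2 + s.alpha m ρ φ a e / 2)) • s.theta m ρ φ a b 0 e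

def Omega4 (m : E → Jet) (ρ φ a b u : E → ℝ) (e : E) : E →L[ℝ] ℝ :=
  (1 / ρ e ^ 2) • fderiv ℝ b e
    + (b e / ρ e ^ 2) • (fderiv ℝ φ e - (1 / ρ e) • fderiv ℝ ρ e)
    + (Real.exp (-φ e) / ρ e) • s.varpiPull m 3 e
    + (b e / ρ e ^ 2) • ((1 / 2 : ℝ) • s.varpiPull m 0 e - s.varpiPull m 1 e)
    - (b e * u e / 2) • s.wPull m 0 e
    - (b e ^ 2 * Real.exp (φ e) / (2 * ρ e ^ 3)) • s.wPull m 1 e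
    + (Real.exp (-φ e) * (a e * b e - ρ e ^ 4 * u e) / (2 * ρ e ^ 3)) • s.wPull m 3 e
    - (a e * Real.exp (-2 * φ e) / ρ e ^ 2) • s.wPull m 4 e
    + ((s.beta m ρ φ b e - s.alpha m ρ φ a e) / 4) • s.theta m ρ φ a b 3 e
    - (b e / ρ e ^ 2 * (s.V (m e) / ρ e ^ 2 + s.beta m ρ φ b e / 2)) • s.theta m ρ φ a b 0 e

/-- The explicit connection forms `Ω₁,…,Ω₄`, with the extra variable `u = u₁`. -/
def Omega (m : E → Jet) (ρ φ a b u : E → ℝ) (k : Fin 4) : E → E →L[ℝ] ℝ :=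
  (![s.Omega1 m ρ φ a b u, s.Omega2 m ρ φ a b, s.Omega3 m ρ φ a b u, s.Omega4 m ρ φ a b u] :
    Fin 4 → E → E →L[ℝ] ℝ) k

/-- The torsion `t³₁₄`. -/
def t314 (m : E → Jet) (ρ φ : E → ℝ) (e : E) : ℝ :=
  Real.exp (3 * φ e) / (27 * ρ e ^ 3) * s.A (m e)

/-- The torsion `t⁵₁₂`. -/
def t512 (m : E → Jet) (ρ φ : E → ℝ) (e : E) : ℝ :=
  Real.exp (-3 * φ e) / (27 * ρ e ^ 3) * s.B (m e)

/-- The torsion `t³₂₃`. -/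
def t323 (m : E → Jet) (ρ φ : E → ℝ) (e : E) : ℝ :=
  Real.exp (-φ e) / (3 * ρ e) * s.C (m e)

/-- The torsion `t⁵₄₅`. -/
def t545 (m : E → Jet) (ρ φ : E → ℝ) (e : E) : ℝ :=
  Real.exp (φ e) / (3 * ρ e) * s.Ctilde (m e)

end Lift

end PDESystem

end ParaCR

end

/-!
# The normalized coframe of a para-CR structure

The torsion-free part of a lifted coframe is normalized in two steps. The coframe `w = normMat · ω`
satisfies the normalized torsion equations on the jet space (`torsionNormalized_normCoframe`), and
so does its transform by a fibre matrix `redS x y a b` (`TorsionNormalized.redForm`). Conversely, a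
coframe that is related to a normalized one by structure matrices and is itself normalized arises
from it by the matrices `redS` (`normalized_lift_unique`), and its connection forms are determined
up to one function (`connection_unique`). Applied to `w` and to its pullback along an equivalence,
the second statement yields the uniqueness of the normal form and the invariance of its torsions.
-/

noncomputable section

namespace ParaCR

/-! ### Exterior derivatives of 1-forms and dual vectors -/

section FormCalculus

variable {E E' : Type*} [NormedAddCommGroup E] [NormedSpace ℝ E]
  [NormedAddCommGroup E'] [NormedSpace ℝ E']

/-! Three facts about solutions of the normalized equations carry all parts of the theorem.

Existence. The coframe `w = M ω` solves the equations on the jet space, with connection forms `ϖ`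
and torsions `V`, `A/27`, `C/3`, `B/27`, `C̃/3` (`torsionNormalized_normCoframe`). This is a
calculation in which the integrability condition enters as the commutation of the vector fields `D`
and `Δ` (`Delta_D`) and through its derivatives in `p` and `r`, which turn `Δ` of `H_p`, `H_r`,
`H_rr` into expressions in `D`-derivatives.

Symmetry. The matrices `redS x y a b`, which are the matrices `S` in the coordinates `x = ρ e^φ`, `y
= ρ e^(-φ)`, carry solutions to solutions. Four torsions are only rescaled, by `y⁻³`, `x⁻¹`, `x⁻³`,
`y⁻¹` (`TorsionNormalized.redForm`). Since the equations also pull back along maps, part (ii)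
follows.

Rigidity. Let `w` and `θ = P w` both be solutions, with structure matrices `P`. Evaluating the
equations on vectors dual to `w` gives algebraic conditions: `dθ¹`, `dθ²`, `dθ⁴` force `P₂₃ = P₄₅ =
0` and fix the diagonal in terms of `x = P₂₂` and `y = P₄₄`. Removing the factor `redS x y a b` with
the same `x, y, a, b` leaves a unipotent change, which adds multiples of `θ¹, θ²` to `θ³` and of
`θ¹, θ⁴` to `θ⁵`. Each such multiple enters two equations with incompatible coefficients, hence
vanishes (`corrections_eq_zero`). So `P` is a `redS` (`normalized_lift_unique`). For a fixed
coframe, the difference of two connections is governed by one function `u` (`connection_unique`).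

Part (i) is rigidity applied to the pullback of `w` and `θ`. Part (iii) is rigidity applied to `w`
and the pullback of the normalized coframe of the second system: corresponding torsions differ by
nonzero factors. -/

theorem extD_congr {α β : E → E →L[ℝ] ℝ} {e : E} (h : α =ᶠ[nhds e] β) : extD α e = extD β e := by
  unfold extD
  rw [Filter.EventuallyEq.extDeriv_eq]
  exact h.mono fun y hy => by simp only [hy]

theorem extD_sum_smul {ι : Type*} [Fintype ι] {c : ι → E → ℝ} {w : ι → E → E →L[ℝ] ℝ} {e : E}
    (hc : ∀ j, DifferentiableAt ℝ (c j) e) (hw : ∀ j, DifferentiableAt ℝ (w j) e) (v v' : E) :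
    extD (fun y => ∑ j, c j y • w j y) e v v' =
      ∑ j, (fderiv ℝ (c j) e v * w j e v' - fderiv ℝ (c j) e v' * w j e v
        + c j e * extD (w j) e v v') := by
  have h : HasFDerivAt (fun y => ∑ j, c j y • w j y)
      (∑ j, (c j e • fderiv ℝ (w j) e + (fderiv ℝ (c j) e).smulRight (w j e))) e :=
    HasFDerivAt.fun_sum fun j _ => (hc j).hasFDerivAt.smul (hw j).hasFDerivAt
  rw [extD_apply h.differentiableAt, h.fderiv]
  simp only [sum_apply, add_apply,
    smul_apply, ContinuousLinearMap.smulRight_apply, smul_eq_mul,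
    ← Finset.sum_sub_distrib]
  refine Finset.sum_congr rfl fun j _ => ?_
  rw [extD_apply (hw j)]
  ring

/-- The second derivative of `m` contributes a symmetric term to the derivative of the pulled back
form, so it cancels on antisymmetrization; this is why `m` must be `C²`. -/
theorem extD_pullback {α : E' → E' →L[ℝ] ℝ} {m : E → E'} {e : E}
    (hα : DifferentiableAt ℝ α (m e)) (hm : ContDiffAt ℝ 2 m e) (v v' : E) :
    extD (fun y => (α (m y)).comp (fderiv ℝ m y)) e v v' =
      extD α (m e) (fderiv ℝ m e v) (fderiv ℝ m e v') := by
  have hm1 : DifferentiableAt ℝ m e := hm.differentiableAt (by norm_num)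
  have hm2 : DifferentiableAt ℝ (fderiv ℝ m) e :=
    (hm.fderiv_right (m := 1) (by norm_num)).differentiableAt (by norm_num)
  have h1 : HasFDerivAt (fun y => α (m y)) ((fderiv ℝ α (m e)).comp (fderiv ℝ m e)) e :=
    hα.hasFDerivAt.comp e hm1.hasFDerivAt
  have h := h1.clm_comp hm2.hasFDerivAt
  have hs : IsSymmSndFDerivAt ℝ m e := hm.isSymmSndFDerivAt (by simp)
  rw [extD_apply h.differentiableAt, h.fderiv, extD_apply hα]
  simp [hs.eq v v']

/-- Independent covectors have dual vectors. -/
theorem exists_dual_vectors {ι : Type*} [Finite ι] [DecidableEq ι] {w : ι → E →L[ℝ] ℝ}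
    (hw : LinearIndependent ℝ w) : ∃ f : ι → E, ∀ i j, w i (f j) = if i = j then 1 else 0 := by
  have key : ∀ j, ∃ v : E, w j v = 1 ∧ ∀ i, i ≠ j → w i v = 0 := by
    intro j
    have hw' : LinearIndependent ℝ (fun i => (w i : E →ₗ[ℝ] ℝ)) :=
      hw.map' (ContinuousLinearMap.coeLM ℝ) (LinearMap.ker_eq_bot.2
        ContinuousLinearMap.coe_injective)
    -- If the common kernel of the other covectors lay in the kernel of `w j`, then `w j` would be a
    -- combination of them. This needs no finite-dimensionality of `E`.
    have h1 : ¬ (⨅ i : {i // i ≠ j}, LinearMap.ker (w i.1 : E →ₗ[ℝ] ℝ)) ≤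
        LinearMap.ker (w j : E →ₗ[ℝ] ℝ) := by
      intro hle
      have h2 := mem_span_of_iInf_ker_le_ker (L := fun i : {i // i ≠ j} => (w i.1 : E →ₗ[ℝ] ℝ)) hle
      refine linearIndependent_iff_notMem_span.1 hw' j (Submodule.span_mono ?_ h2)
      rintro _ ⟨i, rfl⟩
      exact ⟨i.1, ⟨Set.mem_univ _, i.2⟩, rfl⟩
    obtain ⟨v, hv, hv'⟩ := Set.not_subset.1 h1
    simp only [SetLike.mem_coe, Submodule.mem_iInf, LinearMap.mem_ker, Subtype.forall,
      ContinuousLinearMap.coe_coe] at hv hv'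
    exact ⟨(w j v)⁻¹ • v, by simp [hv'], fun i hi => by simp [hv i hi]⟩
  choose f hf hf' using key
  refine ⟨f, fun i j => ?_⟩
  split_ifs with h
  · rw [h, hf]
  · exact hf' j i h

end FormCalculus

/-! ### Locality and pullback of the normalized equations -/

section Torsion

variable {E E' : Type*} [NormedAddCommGroup E] [NormedSpace ℝ E]
  [NormedAddCommGroup E'] [NormedSpace ℝ E']

theorem TorsionNormalized.congr {N : Set E} (hN : IsOpen N) {θ θ' : Fin 5 → E → E →L[ℝ] ℝ}
    {Ω Ω' : Fin 4 → E → E →L[ℝ] ℝ}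
    {t313 t314 t323 t512 t545 t313' t314' t323' t512' t545' : E → ℝ}
    (h : TorsionNormalized N θ Ω t313 t314 t323 t512 t545)
    (hθ : ∀ i, ∀ e ∈ N, θ' i e = θ i e) (hΩ : ∀ k, ∀ e ∈ N, Ω' k e = Ω k e)
    (h1 : ∀ e ∈ N, t313' e = t313 e) (h2 : ∀ e ∈ N, t314' e = t314 e)
    (h3 : ∀ e ∈ N, t323' e = t323 e) (h4 : ∀ e ∈ N, t512' e = t512 e)
    (h5 : ∀ e ∈ N, t545' e = t545 e) :
    TorsionNormalized N θ' Ω' t313' t314' t323' t512' t545' := by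
  have key : ∀ i, ∀ e ∈ N, extD (θ' i) e = extD (θ i) e := fun i e he =>
    extD_congr (Filter.eventuallyEq_of_mem (hN.mem_nhds he) (hθ i))
  constructor <;> intro e he <;> simp only [key _ e he, hθ _ e he, hΩ _ e he, h1 e he, h2 e he,
    h3 e he, h4 e he, h5 e he]
  exacts [h.eq1 e he, h.eq2 e he, h.eq3 e he, h.eq4 e he, h.eq5 e he]

theorem TorsionNormalized.pullback {N : Set E} {U : Set E'} {m : E → E'}
    (hm : ∀ e ∈ N, ContDiffAt ℝ 2 m e) (hmU : Set.MapsTo m N U)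
    {θ : Fin 5 → E' → E' →L[ℝ] ℝ} {Ω : Fin 4 → E' → E' →L[ℝ] ℝ}
    {t313 t314 t323 t512 t545 : E' → ℝ} (hθ : ∀ i, ∀ p ∈ U, DifferentiableAt ℝ (θ i) p)
    (h : TorsionNormalized U θ Ω t313 t314 t323 t512 t545) :
    TorsionNormalized N (fun i e => (θ i (m e)).comp (fderiv ℝ m e))
      (fun k e => (Ω k (m e)).comp (fderiv ℝ m e)) (t313 ∘ m) (t314 ∘ m) (t323 ∘ m) (t512 ∘ m)
      (t545 ∘ m) := by
  constructor <;> intro e he <;> funext v v' <;>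
    rw [extD_pullback (hθ _ _ (hmU he)) (hm e he)]
  · rw [h.eq1 _ (hmU he)]; rfl
  · rw [h.eq2 _ (hmU he)]; rfl
  · rw [h.eq3 _ (hmU he)]; rfl
  · rw [h.eq4 _ (hmU he)]; rfl
  · rw [h.eq5 _ (hmU he)]; rfl

end Torsion

/-! ### The action of the reduced structure group -/

section Fibre

variable {E : Type*} [NormedAddCommGroup E] [NormedSpace ℝ E]

/-- The matrices of the reduced structure group, with diagonal `(xy, x, x/y, y, y/x)`. -/
def redS (x y a b : ℝ) : Matrix (Fin 5) (Fin 5) ℝ :=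
  !![x * y, 0, 0, 0, 0;
     a, x, 0, 0, 0;
     a ^ 2 / (2 * (x * y)), a / y, x / y, 0, 0;
     b, 0, 0, y, 0;
     -(b ^ 2 / (2 * (x * y))), 0, 0, -(b / x), y / x]

/-- The coframe obtained from `w` by the matrices `redS x y a b`. -/
def redForm (w : Fin 5 → E → E →L[ℝ] ℝ) (x y a b : E → ℝ) (i : Fin 5) (e : E) : E →L[ℝ] ℝ :=
  ∑ j, redS (x e) (y e) (a e) (b e) i j • w j e

/-- The connection forms of `redForm w x y a b`, in terms of those of `w`. The arguments `V`, `c`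
and `k` stand for the torsions `t³₁₃`, `t³₂₃` and `t⁵₄₅` of `w`. -/
def redOmega (w : Fin 5 → E → E →L[ℝ] ℝ) (π : Fin 4 → E → E →L[ℝ] ℝ) (V c k x y a b u : E → ℝ) :
    Fin 4 → E → E →L[ℝ] ℝ :=
  ![fun e => (1 / x e) • fderiv ℝ x e + (1 / y e) • fderiv ℝ y e + π 0 e
      - (u e * (x e * y e)) • w 0 e + (a e / x e) • w 3 e - (b e / y e) • w 1 e,
    fun e => (1 / (2 * y e)) • fderiv ℝ y e - (1 / (2 * x e)) • fderiv ℝ x e + π 1 e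
      + (a e * b e / (2 * (x e * y e))) • w 0 e + (b e / (2 * y e)) • w 1 e
      + (a e / (2 * x e)) • w 3 e
      + ((a e * c e / x e - b e * k e / y e) / 4) • w 0 e,
    fun e => (1 / (x e * y e)) • fderiv ℝ a e - (a e / (x e ^ 2 * y e)) • fderiv ℝ x e
      + (1 / y e) • π 2 e + (a e / (x e * y e)) • (π 1 e + (1 / 2 : ℝ) • π 0 e)
      - (a e * u e / 2) • w 0 e
      - ((a e * b e / (x e * y e) + x e * y e * u e) / (2 * y e)) • w 1 e
      - (b e / y e ^ 2) • w 2 e + (a e ^ 2 / (2 * x e ^ 2 * y e)) • w 3 e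
      - ((a e * c e / x e - b e * k e / y e) / (4 * (x e * y e))) • (a e • w 0 e + x e • w 1 e)
      - (a e / (x e * y e) * (V e - a e * c e / (2 * x e))) • w 0 e,
    fun e => (1 / (x e * y e)) • fderiv ℝ b e - (b e / (x e * y e ^ 2)) • fderiv ℝ y e
      + (1 / x e) • π 3 e + (b e / (x e * y e)) • ((1 / 2 : ℝ) • π 0 e - π 1 e)
      - (b e * u e / 2) • w 0 e - (b e ^ 2 / (2 * x e * y e ^ 2)) • w 1 e
      + ((a e * b e / (x e * y e) - x e * y e * u e) / (2 * x e)) • w 3 e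
      - (a e / x e ^ 2) • w 4 e
      + ((a e * c e / x e - b e * k e / y e) / (4 * (x e * y e))) • (b e • w 0 e + y e • w 3 e)
      - (b e / (x e * y e) * (V e - b e * k e / (2 * y e))) • w 0 e]

variable {N : Set E} {w : Fin 5 → E → E →L[ℝ] ℝ} {π : Fin 4 → E → E →L[ℝ] ℝ}
  {V t c l k : E → ℝ} {x y a b u : E → ℝ}

theorem differentiableAt_redS {e : E} (hx : DifferentiableAt ℝ x e) (hy : DifferentiableAt ℝ y e)
    (ha : DifferentiableAt ℝ a e) (hb : DifferentiableAt ℝ b e)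
    (hx0 : x e ≠ 0) (hy0 : y e ≠ 0) (i j : Fin 5) :
    DifferentiableAt ℝ (fun e => redS (x e) (y e) (a e) (b e) i j) e := by
  have hdd : ∀ {f g : E → ℝ}, DifferentiableAt ℝ f e → DifferentiableAt ℝ g e → g e ≠ 0 →
      DifferentiableAt ℝ (fun e => f e / g e) e := by
    intro f g hf hg hg0
    simp only [div_eq_mul_inv]
    exact hf.fun_mul (hg.fun_inv hg0)
  have hxy : DifferentiableAt ℝ (fun e => x e * y e) e := hx.mul hy
  have h2 : DifferentiableAt ℝ (fun e => 2 * (x e * y e)) e := hxy.const_mul 2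
  have h20 : 2 * (x e * y e) ≠ 0 := by simp [hx0, hy0]
  have h0 : DifferentiableAt ℝ (fun _ : E => (0 : ℝ)) e := differentiableAt_const 0
  have h3 : DifferentiableAt ℝ (fun e => a e ^ 2 / (2 * (x e * y e))) e :=
    hdd (ha.fun_pow 2) h2 h20
  have h4 : DifferentiableAt ℝ (fun e => -(b e ^ 2 / (2 * (x e * y e)))) e :=
    (hdd (hb.fun_pow 2) h2 h20).fun_neg
  fin_cases i <;> fin_cases j
  exacts [hxy, h0, h0, h0, h0, ha, hx, h0, h0, h0, h3,
    hdd ha hy hy0, hdd hx hy hy0, h0, h0, hb, h0, h0, hy, h0,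
    h4, h0, h0, (hdd hb hx hx0).fun_neg,
    hdd hy hx hx0]

theorem extD_redForm {e : E} (hw : ∀ j, DifferentiableAt ℝ (w j) e)
    (hx : DifferentiableAt ℝ x e) (hy : DifferentiableAt ℝ y e)
    (ha : DifferentiableAt ℝ a e) (hb : DifferentiableAt ℝ b e)
    (hx0 : x e ≠ 0) (hy0 : y e ≠ 0) (v v' : E) :
    extD (redForm w x y a b 0) e v v' =
      ((x e * fderiv ℝ y e v + y e * fderiv ℝ x e v) * w 0 e v'
        - (x e * fderiv ℝ y e v' + y e * fderiv ℝ x e v') * w 0 e v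
        + x e * y e * extD (w 0) e v v') ∧
    extD (redForm w x y a b 1) e v v' =
      fderiv ℝ a e v * w 0 e v' - fderiv ℝ a e v' * w 0 e v + a e * extD (w 0) e v v'
      + (fderiv ℝ x e v * w 1 e v' - fderiv ℝ x e v' * w 1 e v + x e * extD (w 1) e v v') ∧
    extD (redForm w x y a b 2) e v v' =
      (a e / (x e * y e) * fderiv ℝ a e v - a e ^ 2 / (2 * (x e * y e)) *
        (fderiv ℝ x e v / x e + fderiv ℝ y e v / y e)) * w 0 e v'
      - (a e / (x e * y e) * fderiv ℝ a e v' - a e ^ 2 / (2 * (x e * y e)) *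
        (fderiv ℝ x e v' / x e + fderiv ℝ y e v' / y e)) * w 0 e v
      + a e ^ 2 / (2 * (x e * y e)) * extD (w 0) e v v'
      + ((fderiv ℝ a e v / y e - a e * fderiv ℝ y e v / y e ^ 2) * w 1 e v'
      - (fderiv ℝ a e v' / y e - a e * fderiv ℝ y e v' / y e ^ 2) * w 1 e v
      + a e / y e * extD (w 1) e v v')
      + ((fderiv ℝ x e v / y e - x e * fderiv ℝ y e v / y e ^ 2) * w 2 e v'
      - (fderiv ℝ x e v' / y e - x e * fderiv ℝ y e v' / y e ^ 2) * w 2 e v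
      + x e / y e * extD (w 2) e v v') ∧
    extD (redForm w x y a b 3) e v v' =
      fderiv ℝ b e v * w 0 e v' - fderiv ℝ b e v' * w 0 e v + b e * extD (w 0) e v v'
      + (fderiv ℝ y e v * w 3 e v' - fderiv ℝ y e v' * w 3 e v + y e * extD (w 3) e v v') ∧
    extD (redForm w x y a b 4) e v v' =
      -((b e / (x e * y e) * fderiv ℝ b e v - b e ^ 2 / (2 * (x e * y e)) *
        (fderiv ℝ x e v / x e + fderiv ℝ y e v / y e)) * w 0 e v'
      - (b e / (x e * y e) * fderiv ℝ b e v' - b e ^ 2 / (2 * (x e * y e)) *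
        (fderiv ℝ x e v' / x e + fderiv ℝ y e v' / y e)) * w 0 e v
      + b e ^ 2 / (2 * (x e * y e)) * extD (w 0) e v v')
      - ((fderiv ℝ b e v / x e - b e * fderiv ℝ x e v / x e ^ 2) * w 3 e v'
      - (fderiv ℝ b e v' / x e - b e * fderiv ℝ x e v' / x e ^ 2) * w 3 e v
      + b e / x e * extD (w 3) e v v')
      + ((fderiv ℝ y e v / x e - y e * fderiv ℝ x e v / x e ^ 2) * w 4 e v'
      - (fderiv ℝ y e v' / x e - y e * fderiv ℝ x e v' / x e ^ 2) * w 4 e v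
      + y e / x e * extD (w 4) e v v') := by
  have hdiv : ∀ {f g : E → ℝ}, DifferentiableAt ℝ f e → DifferentiableAt ℝ g e → g e ≠ 0 → ∀ v,
      fderiv ℝ (fun e => f e / g e) e v
        = fderiv ℝ f e v / g e - f e * fderiv ℝ g e v / g e ^ 2 := by
    intro f g hf hg hg0 v
    have h := hf.hasFDerivAt.fun_mul ((hasDerivAt_inv hg0).comp_hasFDerivAt e hg.hasFDerivAt)
    have h2 : (fun e => f e / g e) = fun e => f e * (Inv.inv ∘ g) e := by
      ext e; simp [div_eq_mul_inv]
    rw [h2, h.fderiv]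
    simp
    field_simp
    ring
  have hxy : DifferentiableAt ℝ (fun e => x e * y e) e := hx.mul hy
  have hmul : ∀ v, fderiv ℝ (fun e => x e * y e) e v = x e * fderiv ℝ y e v + y e * fderiv ℝ x e v :=
    fun v => by
      rw [(hx.hasFDerivAt.fun_mul hy.hasFDerivAt).fderiv]; simp
  have hsq : ∀ {f : E → ℝ}, DifferentiableAt ℝ f e → ∀ v,
      fderiv ℝ (fun e => f e ^ 2 / (2 * (x e * y e))) e v =
        f e / (x e * y e) * fderiv ℝ f e v - f e ^ 2 / (2 * (x e * y e)) *
        (fderiv ℝ x e v / x e + fderiv ℝ y e v / y e) := by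
    intro f hf v
    rw [hdiv (hf.fun_pow 2) (hxy.const_mul 2) (by simp [hx0, hy0]), fderiv_const_mul hxy,
      show fderiv ℝ (fun e => f e ^ 2) e = _ from (hf.hasFDerivAt.pow 2).fderiv]
    simp [hmul]
    field_simp
    ring
  have hd := differentiableAt_redS hx hy ha hb hx0 hy0
  refine ⟨?_, ?_, ?_, ?_, ?_⟩ <;> unfold redForm <;> rw [extD_sum_smul (hd _) hw] <;>
    simp [Fin.sum_univ_five, redS, hmul, hsq ha, hsq hb, hdiv ha hy hy0, hdiv hx hy hy0,
      hdiv hb hx hx0, hdiv hy hx hx0] <;> ring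

/-- The differentials of `x, y, a, b` in `extD_redForm` are absorbed by the leading terms of
`redOmega`. The term `a w¹` in the new `θ²` and the term `b w¹` in the new `θ⁴` let `c` and `k`
contribute differently to the `θ¹ ∧ θ³` and `θ¹ ∧ θ⁵` coefficients; the multiple of `w 0` with
factor `1/4` in the second connection form splits the difference, so that one function serves as
`t³₁₃` in both equations. The coordinates `x, y` make every coefficient rational, so that
`field_simp` and `ring` decide the identities. -/
theorem TorsionNormalized.redForm (hw : ∀ j, ∀ e ∈ N, DifferentiableAt ℝ (w j) e)
    (hx : ∀ e ∈ N, DifferentiableAt ℝ x e) (hy : ∀ e ∈ N, DifferentiableAt ℝ y e)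
    (ha : ∀ e ∈ N, DifferentiableAt ℝ a e) (hb : ∀ e ∈ N, DifferentiableAt ℝ b e)
    (hx0 : ∀ e ∈ N, x e ≠ 0) (hy0 : ∀ e ∈ N, y e ≠ 0)
    (h : TorsionNormalized N w π V t c l k) :
    TorsionNormalized N (redForm w x y a b) (redOmega w π V c k x y a b u)
      (fun e => V e / (x e * y e) - (a e * c e / x e + b e * k e / y e) / (2 * (x e * y e)))
      (fun e => t e / y e ^ 3) (fun e => c e / x e) (fun e => l e / x e ^ 3)
      (fun e => k e / y e) := by
  have E0 : ∀ e, ParaCR.redForm w x y a b 0 e = (x e * y e) • w 0 e := fun e => by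
    simp [ParaCR.redForm, Fin.sum_univ_five, redS]
  have E1 : ∀ e, ParaCR.redForm w x y a b 1 e = a e • w 0 e + x e • w 1 e := fun e => by
    simp [ParaCR.redForm, Fin.sum_univ_five, redS]
  have E2 : ∀ e, ParaCR.redForm w x y a b 2 e =
      (a e ^ 2 / (2 * (x e * y e))) • w 0 e + (a e / y e) • w 1 e + (x e / y e) • w 2 e :=
    fun e => by simp [ParaCR.redForm, Fin.sum_univ_five, redS]
  have E3 : ∀ e, ParaCR.redForm w x y a b 3 e = b e • w 0 e + y e • w 3 e := fun e => by
    simp [ParaCR.redForm, Fin.sum_univ_five, redS]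
  have E4 : ∀ e, ParaCR.redForm w x y a b 4 e =
      (y e / x e) • w 4 e - (b e ^ 2 / (2 * (x e * y e))) • w 0 e - (b e / x e) • w 3 e :=
    fun e => by
      simp [ParaCR.redForm, Fin.sum_univ_five, redS]
      module
  have W0 : ∀ e ∈ N, ∀ v v', _ := fun e he v v' => congrFun₂ (h.eq1 e he) v v'
  have W1 : ∀ e ∈ N, ∀ v v', _ := fun e he v v' => congrFun₂ (h.eq2 e he) v v'
  have W2 : ∀ e ∈ N, ∀ v v', _ := fun e he v v' => congrFun₂ (h.eq3 e he) v v'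
  have W3 : ∀ e ∈ N, ∀ v v', _ := fun e he v v' => congrFun₂ (h.eq4 e he) v v'
  have W4 : ∀ e ∈ N, ∀ v v', _ := fun e he v v' => congrFun₂ (h.eq5 e he) v v'
  have key := fun e (he : e ∈ N) => extD_redForm (fun j => hw j e he) (hx e he) (hy e he)
    (ha e he) (hb e he) (hx0 e he) (hy0 e he)
  constructor <;> intro e he <;> have hx1 := hx0 e he <;> have hy1 := hy0 e he <;> funext v v'
  · rw [(key e he v v').1, W0 e he]
    simp [E0, E1, E3, redOmega, wedge]
    field_simp
    ring
  · rw [(key e he v v').2.1, W0 e he, W1 e he]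
    simp [E0, E1, E2, E3, redOmega, wedge]
    field_simp
    ring
  · rw [(key e he v v').2.2.1, W0 e he, W1 e he, W2 e he]
    simp [E0, E1, E2, E3, redOmega, wedge]
    field_simp
    ring
  · rw [(key e he v v').2.2.2.1, W0 e he, W3 e he]
    simp [E0, E1, E3, E4, redOmega, wedge]
    field_simp
    ring
  · rw [(key e he v v').2.2.2.2, W0 e he, W3 e he, W4 e he]
    simp [E0, E1, E3, E4, redOmega, wedge]
    field_simp
    ring

end Fibre

/-! ### Differentiation along `D` and `Δ` on the jet space -/

theorem clm_apply_eq_sum (L : Jet →L[ℝ] ℝ) (v : Jet) :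
    L v = v 0 * L (Pi.single 0 1) + v 1 * L (Pi.single 1 1) + v 2 * L (Pi.single 2 1)
      + v 3 * L (Pi.single 3 1) + v 4 * L (Pi.single 4 1) := by
  have hv : v = v 0 • Pi.single 0 1 + v 1 • Pi.single 1 1 + v 2 • Pi.single 2 1
      + v 3 • Pi.single 3 1 + v 4 • Pi.single 4 1 := by
    funext i
    fin_cases i <;> simp
  conv_lhs => rw [hv]
  simp only [map_add, map_smul, smul_eq_mul]

/-- The Lie derivative of `g` along a vector field `Y`, differentiated in the direction `v`. -/
theorem fderiv_fderiv_apply {g : Jet → ℝ} {Y : Jet → Jet} {m : Jet} (hg : ContDiffAt ℝ 2 g m)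
    (hY : DifferentiableAt ℝ Y m) (v : Jet) :
    fderiv ℝ (fun m => fderiv ℝ g m (Y m)) m v =
      fderiv ℝ (fderiv ℝ g) m v (Y m) + fderiv ℝ g m (fderiv ℝ Y m v) := by
  have h2 : DifferentiableAt ℝ (fderiv ℝ g) m :=
    (hg.fderiv_right (m := 1) (by norm_num)).differentiableAt (by norm_num)
  rw [(h2.hasFDerivAt.clm_apply hY.hasFDerivAt).fderiv]
  simp [add_comm]

theorem pd_comm {g : Jet → ℝ} {m : Jet} (hg : ContDiffAt ℝ 2 g m) (i j : Fin 5) :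
    pd i (pd j g) m = pd j (pd i g) m := by
  unfold pd
  rw [fderiv_fderiv_apply hg (differentiableAt_const _),
    fderiv_fderiv_apply hg (differentiableAt_const _)]
  have hs : IsSymmSndFDerivAt ℝ g m := hg.isSymmSndFDerivAt (by simp)
  simp [hs.eq (Pi.single i 1) (Pi.single j 1)]

namespace PDESystem

variable (s : PDESystem)

/-- The vector field `D`. -/
def dirD (m : Jet) : Jet := ![1, 0, m 3, m 4, s.H m]

/-- The vector field `Δ`. -/
def dirDelta (m : Jet) : Jet := ![0, 1, s.F m, s.D s.F m, s.D (s.D s.F) m]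

theorem D_eq (f : Jet → ℝ) : s.D f = fun m => fderiv ℝ f m (s.dirD m) := by
  funext m
  rw [clm_apply_eq_sum]
  simp [D, totalD, dirD, pd]

theorem Delta_eq (f : Jet → ℝ) : s.Delta f = fun m => fderiv ℝ f m (s.dirDelta m) := by
  funext m
  rw [clm_apply_eq_sum]
  simp [Delta, totalDelta, dirDelta, pd, D]

/-- Functions that are smooth on the domain of the system. -/
def Sm (f : Jet → ℝ) : Prop := ContDiffOn ℝ ∞ f s.U

variable {s} {f g : Jet → ℝ} {m : Jet}

theorem Sm.contDiffAt (hf : s.Sm f) (hm : m ∈ s.U) : ContDiffAt ℝ ∞ f m :=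
  ContDiffOn.contDiffAt hf (s.isOpen_U.mem_nhds hm)

theorem Sm.contDiffAt_two (hf : s.Sm f) (hm : m ∈ s.U) : ContDiffAt ℝ 2 f m :=
  (hf.contDiffAt hm).of_le (WithTop.coe_le_coe.2 le_top)

theorem Sm.differentiableAt (hf : s.Sm f) (hm : m ∈ s.U) : DifferentiableAt ℝ f m :=
  (hf.contDiffAt hm).differentiableAt (by simp)

theorem Sm.fderiv (hf : s.Sm f) : ContDiffOn ℝ ∞ (fderiv ℝ f) s.U :=
  ContDiffOn.fderiv_of_isOpen hf s.isOpen_U (by simp)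

theorem Sm.pd (hf : s.Sm f) (i : Fin 5) : s.Sm (pd i f) :=
  hf.fderiv.clm_apply contDiffOn_const

theorem Sm.mul (hf : s.Sm f) (hg : s.Sm g) : s.Sm (fun m => f m * g m) := ContDiffOn.mul hf hg
theorem Sm.add (hf : s.Sm f) (hg : s.Sm g) : s.Sm (fun m => f m + g m) := ContDiffOn.add hf hg
theorem Sm.sub (hf : s.Sm f) (hg : s.Sm g) : s.Sm (fun m => f m - g m) := ContDiffOn.sub hf hg
theorem Sm.neg (hf : s.Sm f) : s.Sm (fun m => -f m) := ContDiffOn.neg hf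
theorem Sm.pow (hf : s.Sm f) (n : ℕ) : s.Sm (fun m => f m ^ n) := ContDiffOn.pow hf n
theorem sm_const (c : ℝ) : s.Sm (fun _ => c) := contDiffOn_const
theorem Sm.div (hf : s.Sm f) (hg : s.Sm g) (h0 : ∀ m ∈ s.U, g m ≠ 0) :
    s.Sm (fun m => f m / g m) := ContDiffOn.div hf hg h0

theorem sm_coord (i : Fin 5) : s.Sm (fun m => m i) := (contDiff_apply ℝ ℝ i).contDiffOn

theorem sm_F : s.Sm s.F := s.smooth_F
theorem sm_H : s.Sm s.H := s.smooth_H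

theorem Sm.D (hf : s.Sm f) : s.Sm (s.D f) :=
  ((((hf.pd 0).add ((sm_coord 3).mul (hf.pd 2))).add ((sm_coord 4).mul (hf.pd 3))).add
    (sm_H.mul (hf.pd 4)))

theorem Sm.Delta (hf : s.Sm f) : s.Sm (s.Delta f) :=
  ((((hf.pd 1).add (sm_F.mul (hf.pd 2))).add (sm_F.D.mul (hf.pd 3))).add
    (sm_F.D.D.mul (hf.pd 4)))

theorem fderiv_congr_on (h : ∀ m ∈ s.U, f m = g m) (hm : m ∈ s.U) : fderiv ℝ f m = fderiv ℝ g m :=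
  Filter.EventuallyEq.fderiv_eq (Filter.eventuallyEq_of_mem (s.isOpen_U.mem_nhds hm) h)

theorem pd_congr (h : ∀ m ∈ s.U, f m = g m) (i : Fin 5) (hm : m ∈ s.U) : pd i f m = pd i g m := by
  rw [ParaCR.pd, ParaCR.pd, fderiv_congr_on h hm]

theorem D_congr (h : ∀ m ∈ s.U, f m = g m) (hm : m ∈ s.U) : s.D f m = s.D g m := by
  simp only [D_eq, fderiv_congr_on h hm]

theorem hasFDerivAt_dirD (hm : m ∈ s.U) : HasFDerivAt s.dirD
    (ContinuousLinearMap.pi ![0, 0, dcoord 3, dcoord 4, fderiv ℝ s.H m]) m := by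
  rw [hasFDerivAt_pi']
  intro i
  fin_cases i
  · exact hasFDerivAt_const (1 : ℝ) m
  · exact hasFDerivAt_const (0 : ℝ) m
  · exact (dcoord 3).hasFDerivAt
  · exact (dcoord 4).hasFDerivAt
  · exact (sm_H.differentiableAt hm).hasFDerivAt

theorem hasFDerivAt_dirDelta (hm : m ∈ s.U) : HasFDerivAt s.dirDelta
    (ContinuousLinearMap.pi ![0, 0, fderiv ℝ s.F m, fderiv ℝ (s.D s.F) m,
      fderiv ℝ (s.D (s.D s.F)) m]) m := by
  rw [hasFDerivAt_pi']
  intro i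
  fin_cases i
  · exact hasFDerivAt_const (0 : ℝ) m
  · exact hasFDerivAt_const (1 : ℝ) m
  · exact (sm_F.differentiableAt hm).hasFDerivAt
  · exact (sm_F.D.differentiableAt hm).hasFDerivAt
  · exact (sm_F.D.D.differentiableAt hm).hasFDerivAt

/-- This is the commutator of `∂_i` with `D`: second derivatives of `f` are symmetric, so only the
derivatives of the coefficients `p, r, H` of `D` remain. -/
theorem pd_D (hf : s.Sm f) (hm : m ∈ s.U) (i : Fin 5) :
    pd i (s.D f) m = s.D (pd i f) m + (Pi.single i 1 : Jet) 3 * pd 2 f m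
      + (Pi.single i 1 : Jet) 4 * pd 3 f m + pd i s.H m * pd 4 f m := by
  have hs : IsSymmSndFDerivAt ℝ f m := (hf.contDiffAt_two hm).isSymmSndFDerivAt (by simp)
  simp only [D_eq]
  unfold pd
  rw [fderiv_fderiv_apply (hf.contDiffAt_two hm) (hasFDerivAt_dirD hm).differentiableAt,
    fderiv_fderiv_apply (hf.contDiffAt_two hm) (differentiableAt_const _),
    (hasFDerivAt_dirD hm).fderiv, hs.eq, 
    clm_apply_eq_sum (fderiv ℝ f m) (ContinuousLinearMap.pi _ _)]
  simp [dcoord]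
  ring

theorem pd_Delta (hf : s.Sm f) (hm : m ∈ s.U) (i : Fin 5) :
    pd i (s.Delta f) m = s.Delta (pd i f) m + pd i s.F m * pd 2 f m
      + pd i (s.D s.F) m * pd 3 f m + pd i (s.D (s.D s.F)) m * pd 4 f m := by
  have hs : IsSymmSndFDerivAt ℝ f m := (hf.contDiffAt_two hm).isSymmSndFDerivAt (by simp)
  simp only [Delta_eq]
  unfold pd
  rw [fderiv_fderiv_apply (hf.contDiffAt_two hm) (hasFDerivAt_dirDelta hm).differentiableAt,
    fderiv_fderiv_apply (hf.contDiffAt_two hm) (differentiableAt_const _),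
    (hasFDerivAt_dirDelta hm).fderiv, hs.eq,
    clm_apply_eq_sum (fderiv ℝ f m) (ContinuousLinearMap.pi _ _)]
  simp
  ring

/-- The `∂_z` and `∂_p` components of `[Δ, D]` vanish by the choice of the coefficients of `Δ`, and
the `∂_r` component is `ΔH - D³F`. Commutation of the two fields is thus the integrability
condition. -/
theorem Delta_D (hf : s.Sm f) (hm : m ∈ s.U) : s.Delta (s.D f) m = s.D (s.Delta f) m := by
  have hs : IsSymmSndFDerivAt ℝ f m := (hf.contDiffAt_two hm).isSymmSndFDerivAt (by simp)
  have hI : s.D (s.D (s.D s.F)) m = s.Delta s.H m := s.integrable m hm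
  rw [Delta_eq s (s.D f), D_eq s (s.Delta f), D_eq s f, Delta_eq s f]
  simp only
  rw [fderiv_fderiv_apply (hf.contDiffAt_two hm) (hasFDerivAt_dirDelta hm).differentiableAt,
    fderiv_fderiv_apply (hf.contDiffAt_two hm) (hasFDerivAt_dirD hm).differentiableAt, hs.eq,
    (hasFDerivAt_dirD hm).fderiv, (hasFDerivAt_dirDelta hm).fderiv]
  -- By symmetry of the second derivative, what remains is equality of the derivative of the field
  -- `D` along `Δ` with that of `Δ` along `D`.
  congr 2
  funext i
  fin_cases i
  · rfl
  · rfl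
  · simp [dcoord, dirDelta, D_eq]
  · simp [dcoord, dirDelta, D_eq]
  · simp only [ContinuousLinearMap.coe_pi', Fin.reduceFinMk, Matrix.cons_val]
    simpa only [D_eq, Delta_eq] using hI.symm

theorem pd_mul (hf : s.Sm f) (hg : s.Sm g) (hm : m ∈ s.U) (i : Fin 5) :
    pd i (fun m => f m * g m) m = f m * pd i g m + g m * pd i f m := by
  unfold pd
  rw [fderiv_fun_mul (hf.differentiableAt hm) (hg.differentiableAt hm)]
  simp

theorem pd_add (hf : s.Sm f) (hg : s.Sm g) (hm : m ∈ s.U) (i : Fin 5) :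
    pd i (fun m => f m + g m) m = pd i f m + pd i g m := by
  unfold pd
  rw [fderiv_fun_add (hf.differentiableAt hm) (hg.differentiableAt hm)]
  simp

theorem D_mul (hf : s.Sm f) (hg : s.Sm g) (hm : m ∈ s.U) :
    s.D (fun m => f m * g m) m = f m * s.D g m + g m * s.D f m := by
  simp only [D_eq]
  rw [fderiv_fun_mul (hf.differentiableAt hm) (hg.differentiableAt hm)]
  simp

theorem D_add (hf : s.Sm f) (hg : s.Sm g) (hm : m ∈ s.U) :
    s.D (fun m => f m + g m) m = s.D f m + s.D g m := by
  simp only [D_eq]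
  rw [fderiv_fun_add (hf.differentiableAt hm) (hg.differentiableAt hm)]
  simp

theorem D_const_mul (hf : s.Sm f) (c : ℝ) (hm : m ∈ s.U) :
    s.D (fun m => c * f m) m = c * s.D f m := by
  simp only [D_eq]
  rw [fderiv_const_mul (hf.differentiableAt hm)]
  simp

theorem pd_const_mul (hf : s.Sm f) (c : ℝ) (hm : m ∈ s.U) (i : Fin 5) :
    pd i (fun m => c * f m) m = c * pd i f m := by
  unfold pd
  rw [fderiv_const_mul (hf.differentiableAt hm)]
  simp

theorem pd_four_pd (hf : s.Sm f) (h : ∀ m ∈ s.U, pd 4 f m = 0) (i : Fin 5) :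
    ∀ m ∈ s.U, pd 4 (pd i f) m = 0 := by
  intro m hm
  rw [pd_comm (hf.contDiffAt_two hm), pd_congr (g := fun _ => 0) h i hm]
  simp [pd]

theorem pd_four_D (hf : s.Sm f) (h : ∀ m ∈ s.U, pd 4 f m = 0) :
    ∀ m ∈ s.U, pd 4 (s.D f) m = pd 3 f m := by
  intro m hm
  rw [pd_D hf hm, D_congr (g := fun _ => 0) h hm, h m hm]
  simp [D_eq]

theorem pd_three_D (hf : s.Sm f) (hm : m ∈ s.U) :
    pd 3 (s.D f) m = s.D (pd 3 f) m + pd 2 f m + s.Hp m * pd 4 f m := by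
  rw [pd_D hf hm]; simp [Hp]

theorem pd_two_D (hf : s.Sm f) (hm : m ∈ s.U) :
    pd 2 (s.D f) m = s.D (pd 2 f) m + s.Hz m * pd 4 f m := by
  rw [pd_D hf hm]; simp [Hz]

theorem pd_four_D' (hf : s.Sm f) (hm : m ∈ s.U) :
    pd 4 (s.D f) m = s.D (pd 4 f) m + pd 3 f m + s.Hr m * pd 4 f m := by
  rw [pd_D hf hm]; simp [Hr]

end PDESystem

/-! ### Differential consequences of the integrability condition -/

namespace PDESystem

variable {s : PDESystem} {m : Jet}

theorem sm_Fp : s.Sm s.Fp := sm_F.pd 3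
theorem sm_Fz : s.Sm s.Fz := sm_F.pd 2
theorem sm_Fpz : s.Sm s.Fpz := sm_Fp.pd 2
theorem sm_Fpp : s.Sm s.Fpp := sm_Fp.pd 3
theorem sm_Fppz : s.Sm s.Fppz := sm_Fpp.pd 2
theorem sm_Fppp : s.Sm s.Fppp := sm_Fpp.pd 3
theorem sm_Fpppp : s.Sm s.Fpppp := sm_Fppp.pd 3
theorem sm_Hp : s.Sm s.Hp := sm_H.pd 3
theorem sm_Hr : s.Sm s.Hr := sm_H.pd 4
theorem sm_Hrr : s.Sm s.Hrr := sm_Hr.pd 4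

theorem Fpp_ne (hm : m ∈ s.U) : s.Fpp m ≠ 0 := s.F_pp m hm

theorem pd_four_Fp : ∀ m ∈ s.U, pd 4 s.Fp m = 0 := pd_four_pd sm_F s.F_r 3
theorem pd_four_Fz : ∀ m ∈ s.U, pd 4 s.Fz m = 0 := pd_four_pd sm_F s.F_r 2
theorem pd_four_Fpp : ∀ m ∈ s.U, pd 4 s.Fpp m = 0 := pd_four_pd sm_Fp pd_four_Fp 3
theorem pd_four_Fppp : ∀ m ∈ s.U, pd 4 s.Fppp m = 0 := pd_four_pd sm_Fpp pd_four_Fpp 3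
theorem pd_four_Fpppp : ∀ m ∈ s.U, pd 4 s.Fpppp m = 0 := pd_four_pd sm_Fppp pd_four_Fppp 3

theorem pd_three_Fz (hm : m ∈ s.U) : pd 3 s.Fz m = s.Fpz m :=
  pd_comm (sm_F.contDiffAt_two hm) 3 2

theorem pd_four_DF : ∀ m ∈ s.U, pd 4 (s.D s.F) m = s.Fp m := pd_four_D sm_F s.F_r

theorem pd_three_DF : ∀ m ∈ s.U, pd 3 (s.D s.F) m = s.D s.Fp m + s.Fz m := by
  intro m hm
  rw [pd_three_D sm_F hm, s.F_r m hm, mul_zero, add_zero]; rfl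

theorem pd_two_DF : ∀ m ∈ s.U, pd 2 (s.D s.F) m = s.D s.Fz m := by
  intro m hm
  rw [pd_two_D sm_F hm, s.F_r m hm, mul_zero, add_zero]; rfl

theorem pd_four_DDF : ∀ m ∈ s.U,
    pd 4 (s.D (s.D s.F)) m = 2 * s.D s.Fp m + s.Fz m + s.Hr m * s.Fp m := by
  intro m hm
  rw [pd_four_D' sm_F.D hm, D_congr pd_four_DF hm, pd_three_DF m hm, pd_four_DF m hm]; ring

theorem pd_three_DDF : ∀ m ∈ s.U,
    pd 3 (s.D (s.D s.F)) m = s.D (s.D s.Fp) m + 2 * s.D s.Fz m + s.Hp m * s.Fp m := by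
  intro m hm
  rw [pd_three_D sm_F.D hm, D_congr pd_three_DF hm, pd_two_DF m hm, pd_four_DF m hm,
    D_add sm_Fp.D sm_Fz hm]
  ring

theorem pd_two_DDF : ∀ m ∈ s.U,
    pd 2 (s.D (s.D s.F)) m = s.D (s.D s.Fz) m + s.Hz m * s.Fp m := by
  intro m hm
  rw [pd_two_D sm_F.D hm, D_congr pd_two_DF hm, pd_four_DF m hm]

/-- The `r`-derivative of `D³F = ΔH`, with the commutators of `∂_r` with `D` and `Δ` worked out. The
terms with `H_z` and with undifferentiated `H_p` cancel. -/
theorem Delta_Hr : ∀ m ∈ s.U, s.Delta s.Hr m =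
    3 * s.D (s.D s.Fp) m + 3 * s.D s.Fz m + s.D s.Hr m * s.Fp m + s.Hr m * s.D s.Fp m := by
  intro m hm
  have h := pd_congr (s := s) s.integrable 4 hm
  have h1 := pd_four_D' sm_F.D.D hm
  have h2 := pd_Delta sm_H hm 4
  have h3 := D_congr pd_four_DDF hm
  rw [D_add ((sm_const 2).mul sm_Fp.D |>.add sm_Fz) (sm_Hr.mul sm_Fp) hm,
    D_add ((sm_const 2).mul sm_Fp.D) sm_Fz hm, D_const_mul sm_Fp.D 2 hm,
    D_mul sm_Hr sm_Fp hm] at h3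
  change pd 4 (s.D (s.D (s.D s.F))) m = pd 4 (s.Delta s.H) m at h
  rw [h1, h2, h3, pd_three_DDF m hm, pd_four_DDF m hm, pd_four_DF m hm, s.F_r m hm] at h
  change _ = s.Delta s.Hr m + _ * s.Hz m + _ * s.Hp m + _ * s.Hr m at h
  linarith

/-- The `p`-derivative of `D³F = ΔH`, obtained in the same way as `Delta_Hr`. -/
theorem Delta_Hp : ∀ m ∈ s.U, s.Delta s.Hp m =
    s.D (s.D (s.D s.Fp)) m + 3 * s.D (s.D s.Fz) m + s.D s.Hp m * s.Fp m
      + 2 * s.Hp m * s.D s.Fp m - s.Hr m * s.D (s.D s.Fp) m - 2 * s.Hr m * s.D s.Fz m := by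
  intro m hm
  have h := pd_congr (s := s) s.integrable 3 hm
  have h1 := pd_three_D sm_F.D.D hm
  have h2 := pd_Delta sm_H hm 3
  have h3 := D_congr pd_three_DDF hm
  rw [D_add (sm_Fp.D.D.add ((sm_const 2).mul sm_Fz.D)) (sm_Hp.mul sm_Fp) hm,
    D_add sm_Fp.D.D ((sm_const 2).mul sm_Fz.D) hm, D_const_mul sm_Fz.D 2 hm,
    D_mul sm_Hp sm_Fp hm] at h3
  change pd 3 (s.D (s.D (s.D s.F))) m = pd 3 (s.Delta s.H) m at h
  rw [h1, h2, h3, pd_two_DDF m hm, pd_four_DDF m hm, pd_three_DF m hm, pd_three_DDF m hm] at h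
  change _ = s.Delta s.Hp m + s.Fp m * s.Hz m + _ * s.Hp m + _ * s.Hr m at h
  linarith

/-- Since `Δ` and `D` commute, this is `D` applied to `Delta_Hr`. Together with `Delta_Hr` and
`Delta_Hp` it determines `Δ` of the matrix entry `s`. -/
theorem Delta_DHr (hm : m ∈ s.U) : s.Delta (s.D s.Hr) m =
    3 * s.D (s.D (s.D s.Fp)) m + 3 * s.D (s.D s.Fz) m + s.D (s.D s.Hr) m * s.Fp m
      + 2 * s.D s.Hr m * s.D s.Fp m + s.Hr m * s.D (s.D s.Fp) m := by
  have e1 := (sm_const 3).mul (sm_Fp (s := s)).D.D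
  have e2 := (sm_const 3).mul (sm_Fz (s := s)).D
  rw [Delta_D sm_Hr hm, D_congr Delta_Hr hm,
    D_add ((e1.add e2).add (sm_Hr.D.mul sm_Fp)) (sm_Hr.mul sm_Fp.D) hm,
    D_add (e1.add e2) (sm_Hr.D.mul sm_Fp) hm, D_add e1 e2 hm, D_const_mul sm_Fp.D.D 3 hm,
    D_const_mul sm_Fz.D 3 hm, D_mul sm_Hr.D sm_Fp hm, D_mul sm_Hr sm_Fp.D hm]
  ring

/-- A second `r`-derivative of the integrability condition, taken in `Delta_Hr`. It serves to
eliminate `H_rr` from `C̃`. -/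
theorem Delta_Hrr (hm : m ∈ s.U) : s.Delta s.Hrr m =
    6 * s.D s.Fpp m + 6 * s.Fpz m + 4 * s.Hr m * s.Fpp m + s.Fp m * s.D s.Hrr m
      - (s.D s.Fp m + s.Fz m) * s.Hrr m := by
  have h := pd_congr Delta_Hr 4 hm
  have e1 := (sm_const 3).mul (sm_Fp (s := s)).D.D
  have e2 := (sm_const 3).mul (sm_Fz (s := s)).D
  have a1 : pd 4 (s.D s.Fp) m = s.Fpp m := pd_four_D sm_Fp pd_four_Fp m hm
  have a2 : pd 4 (s.D (s.D s.Fp)) m = 2 * s.D s.Fpp m + s.Fpz m + s.Hr m * s.Fpp m := by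
    rw [pd_four_D' sm_Fp.D hm, D_congr (pd_four_D sm_Fp pd_four_Fp) hm, pd_three_D sm_Fp hm, a1,
      pd_four_Fp m hm]
    change s.D s.Fpp m + (s.D s.Fpp m + s.Fpz m + _) + _ = _
    ring
  have a3 : pd 4 (s.D s.Fz) m = s.Fpz m := by
    rw [pd_four_D sm_Fz pd_four_Fz m hm, pd_three_Fz hm]
  have a4 : pd 4 (s.D s.Hr) m = s.D s.Hrr m + pd 3 s.Hr m + s.Hr m * s.Hrr m :=
    pd_four_D' sm_Hr hm
  rw [pd_Delta sm_Hr hm, pd_add ((e1.add e2).add (sm_Hr.D.mul sm_Fp)) (sm_Hr.mul sm_Fp.D) hm,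
    pd_add (e1.add e2) (sm_Hr.D.mul sm_Fp) hm, pd_add e1 e2 hm, pd_const_mul sm_Fp.D.D 3 hm,
    pd_const_mul sm_Fz.D 3 hm, pd_mul sm_Hr.D sm_Fp hm, pd_mul sm_Hr sm_Fp.D hm, a1, a2, a3, a4,
    pd_four_Fp m hm, s.F_r m hm, pd_four_DF m hm, pd_four_DDF m hm] at h
  change s.Delta s.Hrr m + _ + _ * pd 3 s.Hr m + _ * s.Hrr m = _ + (_ * s.Fpp m + _ * s.Hrr m) at h
  linarith

/-! ### Differentials of the auxiliary functions -/

theorem fderiv_hh (hm : m ∈ s.U) (v : Jet) :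
    fderiv ℝ s.hh m v = fderiv ℝ s.Hr m v / 3 := by
  have h : HasFDerivAt s.hh _ m :=
    (sm_Hr.differentiableAt hm).hasFDerivAt.mul_const (3 : ℝ)⁻¹
  rw [h.fderiv]
  simp [div_eq_inv_mul]

theorem fderiv_ss (hm : m ∈ s.U) (v : Jet) :
    fderiv ℝ s.ss m v = (4 * s.Hr m * fderiv ℝ s.Hr m v + 9 * fderiv ℝ s.Hp m v
      - 3 * fderiv ℝ (s.D s.Hr) m v) / 18 := by
  have h1 := (sm_Hr.differentiableAt hm).hasFDerivAt
  have h2 := (sm_Hp.differentiableAt hm).hasFDerivAt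
  have h3 := (sm_Hr.D.differentiableAt hm).hasFDerivAt
  have h : HasFDerivAt s.ss _ m :=
    ((((h1.pow 2).const_mul 2).add (h2.const_mul 9)).sub (h3.const_mul 3)).mul_const (18 : ℝ)⁻¹
  rw [h.fderiv]
  simp
  ring

theorem hasFDerivAt_inv_Fpp (hm : m ∈ s.U) : HasFDerivAt (fun m => (s.Fpp m)⁻¹)
    (-(s.Fpp m ^ 2)⁻¹ • fderiv ℝ s.Fpp m) m :=
  (hasDerivAt_inv (Fpp_ne hm)).comp_hasFDerivAt m (sm_Fpp.differentiableAt hm).hasFDerivAt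

theorem fderiv_ll (hm : m ∈ s.U) (v : Jet) :
    fderiv ℝ s.ll m v = fderiv ℝ s.Fppp m v / (3 * s.Fpp m)
      - s.ll m * fderiv ℝ s.Fpp m v / s.Fpp m := by
  have h1 := (sm_Fppp.differentiableAt hm).hasFDerivAt
  have h := (h1.mul (hasFDerivAt_inv_Fpp hm)).mul_const (3 : ℝ)⁻¹
  have e : s.ll = fun m => s.Fppp m * (s.Fpp m)⁻¹ * 3⁻¹ := by
    funext m; simp only [ll, div_eq_mul_inv, mul_inv]; ring
  have h0 := Fpp_ne hm
  rw [show fderiv ℝ s.ll m = _ from (congrArg (fun f => fderiv ℝ f m) e).trans h.fderiv]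
  simp [ll]
  field_simp
  ring

theorem fderiv_qq (hm : m ∈ s.U) (v : Jet) :
    fderiv ℝ s.qq m v = (3 * s.Fpp m * fderiv ℝ s.Fpppp m v
      + 3 * s.Fpppp m * fderiv ℝ s.Fpp m v - 10 * s.Fppp m * fderiv ℝ s.Fppp m v)
        / (18 * s.Fpp m ^ 2) - 2 * s.qq m * fderiv ℝ s.Fpp m v / s.Fpp m := by
  have h1 := (sm_Fppp.differentiableAt hm).hasFDerivAt
  have h2 := (sm_Fpppp.differentiableAt hm).hasFDerivAt
  have h3 := hasFDerivAt_inv_Fpp hm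
  have h4 := (sm_Fpp.differentiableAt hm).hasFDerivAt
  have h := ((((h4.mul h2).const_mul 3).sub ((h1.pow 2).const_mul 5)).mul
    (h3.pow 2)).mul_const (18 : ℝ)⁻¹
  have e : s.qq = fun m => (3 * (s.Fpp m * s.Fpppp m) - 5 * s.Fppp m ^ 2) * (s.Fpp m)⁻¹ ^ 2 * 18⁻¹ := by
    funext m; simp only [qq, div_eq_mul_inv, mul_inv]; ring
  have h0 := Fpp_ne hm
  rw [show fderiv ℝ s.qq m = _ from (congrArg (fun f => fderiv ℝ f m) e).trans h.fderiv]
  simp [qq]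
  field_simp
  ring

theorem fderiv_C (hm : m ∈ s.U) (v : Jet) :
    fderiv ℝ s.C m v = 6 * fderiv ℝ s.ll m v + fderiv ℝ s.Hrr m v := by
  have e : ∀ m ∈ s.U, s.C m = 6 * s.ll m + s.Hrr m := fun m hm => by
    have h0 := Fpp_ne hm
    simp only [C, ll]
    field_simp
    ring
  have hl : s.Sm s.ll := sm_Fppp.div ((sm_const 3).mul sm_Fpp) fun m hm => by simp [Fpp_ne hm]
  rw [fderiv_congr_on e hm, fderiv_fun_add ((hl.differentiableAt hm).const_mul 6)
    (sm_Hrr.differentiableAt hm), fderiv_const_mul (hl.differentiableAt hm)]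
  simp

end PDESystem

/-! ### Structure equations of `ω` and exterior derivatives of `w` -/

namespace PDESystem

variable {s : PDESystem} {m : Jet}

theorem coframe_zero (v : Jet) : s.coframe 0 m v = v 2 - m 3 * v 0 - s.F m * v 1 := rfl
theorem coframe_one (v : Jet) : s.coframe 1 m v = v 3 - m 4 * v 0 - s.D s.F m * v 1 := rfl
theorem coframe_two (v : Jet) :
    s.coframe 2 m v = v 4 - s.H m * v 0 - s.D (s.D s.F) m * v 1 := rfl
theorem coframe_three (v : Jet) : s.coframe 3 m v = v 0 := rfl
theorem coframe_four (v : Jet) : s.coframe 4 m v = v 1 := rfl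

/-- The fields `∂_z, ∂_p, ∂_r, D, Δ` form the frame dual to `ω`, so these derivatives are the
coefficients of `df` in the coframe. -/
theorem fderiv_apply_coframe (f : Jet → ℝ) (v : Jet) : fderiv ℝ f m v =
    pd 2 f m * s.coframe 0 m v + pd 3 f m * s.coframe 1 m v + pd 4 f m * s.coframe 2 m v
      + s.D f m * s.coframe 3 m v + s.Delta f m * s.coframe 4 m v := by
  rw [clm_apply_eq_sum, coframe_zero, coframe_one, coframe_two, coframe_three, coframe_four]
  simp only [Delta, totalDelta, D, totalD, pd]
  ring

theorem hasFDerivAt_dcoord_sub {f : Jet → ℝ} (hf : DifferentiableAt ℝ f m) (i j : Fin 5) :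
    HasFDerivAt (fun m : Jet => dcoord i - m j • dcoord 0 - f m • dcoord 1)
      (-((dcoord j).smulRight (dcoord 0)) - (fderiv ℝ f m).smulRight (dcoord 1)) m := by
  have h1 : HasFDerivAt (fun m : Jet => m j • dcoord 0) ((dcoord j).smulRight (dcoord 0)) m :=
    ((dcoord j).hasFDerivAt (x := m)).smul_const (dcoord 0)
  have h := (h1.const_sub (dcoord i)).fun_sub (hf.hasFDerivAt.smul_const (dcoord 1))
  exact h

theorem hasFDerivAt_coframe_two (hm : m ∈ s.U) : HasFDerivAt (s.coframe 2)
      (-((fderiv ℝ s.H m).smulRight (dcoord 0))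
        - (fderiv ℝ (s.D (s.D s.F)) m).smulRight (dcoord 1)) m := by
  have h1 := ((sm_H (s := s)).differentiableAt hm).hasFDerivAt.smul_const (dcoord 0)
  exact (h1.const_sub (dcoord 4)).fun_sub
    (((sm_F (s := s)).D.D.differentiableAt hm).hasFDerivAt.smul_const (dcoord 1))

theorem differentiableAt_coframe (hm : m ∈ s.U) (j : Fin 5) :
    DifferentiableAt ℝ (s.coframe j) m := by
  fin_cases j
  · exact (hasFDerivAt_dcoord_sub (sm_F.differentiableAt hm) 2 3).differentiableAt
  · exact (hasFDerivAt_dcoord_sub (sm_F.D.differentiableAt hm) 3 4).differentiableAt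
  · exact (hasFDerivAt_coframe_two hm).differentiableAt
  · exact differentiableAt_const (dcoord 0)
  · exact differentiableAt_const (dcoord 1)

theorem extD_coframe_zero (hm : m ∈ s.U) : extD (s.coframe 0) m =
    -wedge (s.coframe 1 m) (s.coframe 3 m) - s.Fz m • wedge (s.coframe 0 m) (s.coframe 4 m)
      - s.Fp m • wedge (s.coframe 1 m) (s.coframe 4 m) := by
  have h := hasFDerivAt_dcoord_sub ((sm_F (s := s)).differentiableAt hm) 2 3
  funext v v'
  rw [extD_apply (differentiableAt_coframe hm 0),
    show fderiv ℝ (s.coframe 0) m = _ from h.fderiv]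
  simp only [sub_apply, neg_apply, smul_apply, ContinuousLinearMap.smulRight_apply,
    fderiv_apply_coframe (s := s) s.F, s.F_r m hm, Pi.sub_apply, Pi.neg_apply, Pi.smul_apply,
    wedge, smul_eq_mul]
  simp only [coframe_zero, coframe_one, coframe_two, coframe_three, coframe_four, dcoord,
    ContinuousLinearMap.proj_apply, Fz, Fp]
  ring

theorem extD_coframe_one (hm : m ∈ s.U) : extD (s.coframe 1) m =
    -wedge (s.coframe 2 m) (s.coframe 3 m) - s.D s.Fz m • wedge (s.coframe 0 m) (s.coframe 4 m)
      - (s.D s.Fp m + s.Fz m) • wedge (s.coframe 1 m) (s.coframe 4 m)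
      - s.Fp m • wedge (s.coframe 2 m) (s.coframe 4 m) := by
  have h := hasFDerivAt_dcoord_sub ((sm_F (s := s)).D.differentiableAt hm) 3 4
  funext v v'
  rw [extD_apply (differentiableAt_coframe hm 1),
    show fderiv ℝ (s.coframe 1) m = _ from h.fderiv]
  simp only [sub_apply, neg_apply, smul_apply, ContinuousLinearMap.smulRight_apply,
    fderiv_apply_coframe (s := s) (s.D s.F), pd_two_DF m hm, pd_three_DF m hm, pd_four_DF m hm,
    Pi.sub_apply, Pi.neg_apply, Pi.smul_apply, wedge, smul_eq_mul]
  simp only [coframe_zero, coframe_one, coframe_two, coframe_three, coframe_four, dcoord,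
    ContinuousLinearMap.proj_apply]
  ring

theorem extD_coframe_two (hm : m ∈ s.U) : extD (s.coframe 2) m =
    -s.Hz m • wedge (s.coframe 0 m) (s.coframe 3 m)
      - s.Hp m • wedge (s.coframe 1 m) (s.coframe 3 m)
      - s.Hr m • wedge (s.coframe 2 m) (s.coframe 3 m)
      - (s.D (s.D s.Fz) m + s.Hz m * s.Fp m) • wedge (s.coframe 0 m) (s.coframe 4 m)
      - (s.D (s.D s.Fp) m + 2 * s.D s.Fz m + s.Hp m * s.Fp m) •
        wedge (s.coframe 1 m) (s.coframe 4 m)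
      - (2 * s.D s.Fp m + s.Fz m + s.Hr m * s.Fp m) •
        wedge (s.coframe 2 m) (s.coframe 4 m) := by
  have hI : s.D (s.D (s.D s.F)) m = s.Delta s.H m := s.integrable m hm
  funext v v'
  rw [extD_apply (differentiableAt_coframe hm 2), (hasFDerivAt_coframe_two hm).fderiv]
  simp only [sub_apply, neg_apply, smul_apply, ContinuousLinearMap.smulRight_apply,
    fderiv_apply_coframe (s := s) (s.D (s.D s.F)), fderiv_apply_coframe (s := s) s.H, hI,
    pd_two_DDF m hm, pd_three_DDF m hm, pd_four_DDF m hm,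
    Pi.sub_apply, Pi.smul_apply, wedge, smul_eq_mul]
  simp only [coframe_zero, coframe_one, coframe_two, coframe_three, coframe_four, dcoord,
    ContinuousLinearMap.proj_apply, Hz, Hp, Hr]
  ring

theorem extD_coframe_three : extD (s.coframe 3) m = 0 := by
  funext v v'
  have h : DifferentiableAt ℝ (s.coframe 3) m := differentiableAt_const (dcoord 0)
  rw [extD_apply h,
    show fderiv ℝ (s.coframe 3) m = _ from fderiv_const_apply (dcoord 0)]
  simp

theorem extD_coframe_four : extD (s.coframe 4) m = 0 := by
  funext v v'
  have h : DifferentiableAt ℝ (s.coframe 4) m := differentiableAt_const (dcoord 1)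
  rw [extD_apply h,
    show fderiv ℝ (s.coframe 4) m = _ from fderiv_const_apply (dcoord 1)]
  simp

theorem sm_hh : s.Sm s.hh := sm_Hr.div (sm_const 3) fun _ _ => by norm_num
theorem sm_ss : s.Sm s.ss :=
  (((sm_const 2).mul (sm_Hr.pow 2)).add ((sm_const 9).mul sm_Hp) |>.sub
    ((sm_const 3).mul sm_Hr.D)).div (sm_const 18) fun _ _ => by norm_num
theorem sm_ll : s.Sm s.ll :=
  sm_Fppp.div ((sm_const 3).mul sm_Fpp) fun m hm => by simp [Fpp_ne hm]
theorem sm_qq : s.Sm s.qq :=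
  (((sm_const 3).mul sm_Fpp).mul sm_Fpppp |>.sub ((sm_const 5).mul (sm_Fppp.pow 2))).div
    ((sm_const 18).mul (sm_Fpp.pow 2)) fun m hm => by simp [Fpp_ne hm]

theorem normMat_four_four (hm : m ∈ s.U) : s.normMat m 4 4 = s.ll m * s.Fp m - s.Fpp m := by
  have h0 := Fpp_ne hm
  simp [normMat, ll]
  field_simp

theorem sm_normMat (i j : Fin 5) : s.Sm fun m => s.normMat m i j := by
  have h := (sm_Fppp (s := s)).mul sm_Fp |>.sub ((sm_const 3).mul (sm_Fpp.pow 2)) |>.div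
    ((sm_const 3).mul sm_Fpp) fun m hm => by simp [Fpp_ne hm]
  fin_cases i <;> fin_cases j
  exacts [sm_const _, sm_const _, sm_const _, sm_const _, sm_const _, sm_const _, sm_const _,
    sm_const _, sm_const _, sm_const _, sm_ss, sm_hh, sm_const _, sm_const _, sm_const _,
    sm_const _, sm_const _, sm_const _, sm_const _, sm_Fp, sm_qq, sm_const _, sm_const _, sm_ll, h]

theorem normCoframe_zero : s.normCoframe 0 m = -s.coframe 0 m := by
  simp [normCoframe, Fin.sum_univ_five, normMat]
  ext v
  simp
theorem normCoframe_one : s.normCoframe 1 m = s.coframe 1 m := by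
  simp [normCoframe, Fin.sum_univ_five, normMat]
theorem normCoframe_two :
    s.normCoframe 2 m = s.ss m • s.coframe 0 m + s.hh m • s.coframe 1 m - s.coframe 2 m := by
  simp [normCoframe, Fin.sum_univ_five, normMat, ss, hh, sub_eq_add_neg]
  ext v
  simp
theorem normCoframe_three :
    s.normCoframe 3 m = s.coframe 3 m + s.Fp m • s.coframe 4 m := by
  simp [normCoframe, Fin.sum_univ_five, normMat]
theorem normCoframe_four (hm : m ∈ s.U) :
    s.normCoframe 4 m = s.qq m • s.coframe 0 m + s.ll m • s.coframe 3 m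
      + (s.ll m * s.Fp m - s.Fpp m) • s.coframe 4 m := by
  have h := normMat_four_four hm
  simp only [normCoframe, Fin.sum_univ_five, h]
  simp [normMat, qq, ll]

theorem extD_normCoframe (hm : m ∈ s.U) (i : Fin 5) (v v' : Jet) :
    extD (s.normCoframe i) m v v' =
      ∑ j, (fderiv ℝ (fun m => s.normMat m i j) m v * s.coframe j m v'
        - fderiv ℝ (fun m => s.normMat m i j) m v' * s.coframe j m v
        + s.normMat m i j * extD (s.coframe j) m v v') :=
  extD_sum_smul (fun j => (sm_normMat i j).differentiableAt hm) (differentiableAt_coframe hm) v v'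

theorem extD_normCoframe_zero (hm : m ∈ s.U) (v v' : Jet) :
    extD (s.normCoframe 0) m v v' = -extD (s.coframe 0) m v v' := by
  rw [extD_normCoframe hm]
  simp [Fin.sum_univ_five, normMat]

theorem extD_normCoframe_one (hm : m ∈ s.U) (v v' : Jet) :
    extD (s.normCoframe 1) m v v' = extD (s.coframe 1) m v v' := by
  rw [extD_normCoframe hm]
  simp [Fin.sum_univ_five, normMat]

theorem extD_normCoframe_two (hm : m ∈ s.U) (v v' : Jet) :
    extD (s.normCoframe 2) m v v' =
      fderiv ℝ s.ss m v * s.coframe 0 m v' - fderiv ℝ s.ss m v' * s.coframe 0 m v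
      + s.ss m * extD (s.coframe 0) m v v'
      + (fderiv ℝ s.hh m v * s.coframe 1 m v' - fderiv ℝ s.hh m v' * s.coframe 1 m v
      + s.hh m * extD (s.coframe 1) m v v') - extD (s.coframe 2) m v v' := by
  have e1 : (fun m => s.normMat m 2 0) = s.ss := rfl
  have e2 : (fun m => s.normMat m 2 1) = s.hh := rfl
  rw [extD_normCoframe hm, Fin.sum_univ_five, e1, e2]
  simp [normMat, ss, hh]
  ring

theorem extD_normCoframe_three (hm : m ∈ s.U) (v v' : Jet) :
    extD (s.normCoframe 3) m v v' =
      fderiv ℝ s.Fp m v * s.coframe 4 m v' - fderiv ℝ s.Fp m v' * s.coframe 4 m v := by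
  have e1 : (fun m => s.normMat m 3 4) = s.Fp := rfl
  rw [extD_normCoframe hm, Fin.sum_univ_five, e1]
  simp [normMat, extD_coframe_three, extD_coframe_four]

theorem extD_normCoframe_four (hm : m ∈ s.U) (v v' : Jet) :
    extD (s.normCoframe 4) m v v' =
      fderiv ℝ s.qq m v * s.coframe 0 m v' - fderiv ℝ s.qq m v' * s.coframe 0 m v
      + s.qq m * extD (s.coframe 0) m v v'
      + (fderiv ℝ s.ll m v * s.coframe 3 m v' - fderiv ℝ s.ll m v' * s.coframe 3 m v)
      + ((s.Fp m * fderiv ℝ s.ll m v + s.ll m * fderiv ℝ s.Fp m v - fderiv ℝ s.Fpp m v)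
          * s.coframe 4 m v'
        - (s.Fp m * fderiv ℝ s.ll m v' + s.ll m * fderiv ℝ s.Fp m v' - fderiv ℝ s.Fpp m v')
          * s.coframe 4 m v) := by
  have e1 : (fun m => s.normMat m 4 0) = s.qq := rfl
  have e2 : (fun m => s.normMat m 4 3) = s.ll := rfl
  have e3 : fderiv ℝ (fun m => s.normMat m 4 4) m
      = s.ll m • fderiv ℝ s.Fp m + s.Fp m • fderiv ℝ s.ll m - fderiv ℝ s.Fpp m := by
    have d1 := (sm_ll (s := s)).differentiableAt hm
    have d2 := (sm_Fp (s := s)).differentiableAt hm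
    rw [fderiv_congr_on (fun m hm => normMat_four_four hm) hm,
      fderiv_fun_sub (d1.fun_mul d2) (sm_Fpp.differentiableAt hm), fderiv_fun_mul d1 d2]
  rw [extD_normCoframe hm, Fin.sum_univ_five, e1, e2, e3]
  simp [normMat, extD_coframe_three, extD_coframe_four, qq]
  ring

theorem differentiableAt_normCoframe (hm : m ∈ s.U) (i : Fin 5) :
    DifferentiableAt ℝ (s.normCoframe i) m :=
  DifferentiableAt.fun_sum fun j _ =>
    ((sm_normMat i j).differentiableAt hm).smul (differentiableAt_coframe hm j)

/-- One has `C = 6 l + H_rr`, and by `Delta_Hrr` all derivatives of `H_rr`, and `H_rr` itself,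
cancel. The result is the form in which `C̃` arises in `dw⁵`, whose entries involve `l, q` and `F`
but not `H`. -/
theorem Ctilde_eq (hm : m ∈ s.U) : s.Ctilde m =
    ((s.D s.Fp m + s.Fz m) * (6 * s.ll m) + 6 * (s.Delta s.ll m - s.Fp m * s.D s.ll m)
      + 6 * s.D s.Fpp m + 6 * s.Fpz m + 4 * s.Hr m * s.Fpp m) / (2 * s.Fpp m) := by
  have h0 := Fpp_ne hm
  have e : s.C m = 6 * s.ll m + s.Hrr m := by
    simp only [C, ll]
    field_simp
    ring
  have e1 : s.D s.C m = 6 * s.D s.ll m + s.D s.Hrr m := by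
    simp only [D_eq, fderiv_C hm]
  have e2 : s.Delta s.C m = 6 * s.Delta s.ll m + s.Delta s.Hrr m := by
    simp only [Delta_eq, fderiv_C hm]
  rw [Ctilde, e1, e2, e, Delta_Hrr hm]
  congr 1
  ring

theorem Fppp_eq (hm : m ∈ s.U) : s.Fppp m = 3 * s.ll m * s.Fpp m := by
  have h0 := Fpp_ne hm
  simp only [ll]
  field_simp

theorem Fpppp_eq (hm : m ∈ s.U) : s.Fpppp m = (6 * s.qq m + 15 * s.ll m ^ 2) * s.Fpp m := by
  have h0 := Fpp_ne hm
  simp only [ll, qq]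
  field_simp
  ring

/-- This explains the entry `q = l_p / 2 - l²` of the normalizing matrix, and removes the
`p`-derivative of `l` from `dw⁵`. -/
theorem pd_three_ll (hm : m ∈ s.U) : pd 3 s.ll m = 2 * s.qq m + 2 * s.ll m ^ 2 := by
  have h0 := Fpp_ne hm
  rw [pd, fderiv_ll hm]
  change s.Fpppp m / _ - s.ll m * s.Fppp m / _ = _
  rw [Fpppp_eq hm, Fppp_eq hm]
  field_simp
  ring

theorem pd_four_ll (hm : m ∈ s.U) : pd 4 s.ll m = 0 := by
  have h1 := pd_four_Fppp m hm
  have h2 := pd_four_Fpp m hm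
  unfold pd at h1 h2
  rw [pd, fderiv_ll hm, h1, h2]
  simp

theorem pd_four_qq (hm : m ∈ s.U) : pd 4 s.qq m = 0 := by
  have h1 := pd_four_Fppp m hm
  have h2 := pd_four_Fpp m hm
  have h3 := pd_four_Fpppp m hm
  unfold pd at h1 h2 h3
  rw [pd, fderiv_qq hm, h1, h2, h3]
  simp

theorem B_eq (hm : m ∈ s.U) : s.B m = 27 * (pd 3 s.qq m - 2 * s.ll m * s.qq m) := by
  have h0 := Fpp_ne hm
  have h : pd 3 s.qq m = (3 * s.Fpp m * s.Fppppp m + 3 * s.Fpppp m * s.Fppp m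
      - 10 * s.Fppp m * s.Fpppp m) / (18 * s.Fpp m ^ 2) - 2 * s.qq m * s.Fppp m / s.Fpp m := by
    rw [pd, fderiv_qq hm]; rfl
  rw [h, B, Fpppp_eq hm, Fppp_eq hm]
  field_simp
  ring

end PDESystem

/-! ### The normalized equations for the coframe `w` -/

namespace PDESystem

variable {s : PDESystem} {m : Jet}

/-- Only the `D` and `Δ` coefficients are expanded, since those must be compared with `A` and with
the integrability identities. The partial derivatives of `s` stay as they are because `V`, `β₁` and
`γ₁` are expressed through them. -/
theorem fderiv_ss_coframe (hm : m ∈ s.U) (v : Jet) : fderiv ℝ s.ss m v =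
    pd 2 s.ss m * s.coframe 0 m v + pd 3 s.ss m * s.coframe 1 m v + pd 4 s.ss m * s.coframe 2 m v
      + (4 * s.Hr m * s.D s.Hr m + 9 * s.D s.Hp m - 3 * s.D (s.D s.Hr) m) / 18
        * s.coframe 3 m v
      + (4 * s.Hr m * s.Delta s.Hr m + 9 * s.Delta s.Hp m - 3 * s.Delta (s.D s.Hr) m) / 18
        * s.coframe 4 m v := by
  have e1 : s.D s.ss m = (4 * s.Hr m * s.D s.Hr m + 9 * s.D s.Hp m - 3 * s.D (s.D s.Hr) m) / 18 := by
    rw [D_eq s s.ss]; simp only [fderiv_ss hm, D_eq]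
  have e2 : s.Delta s.ss m =
      (4 * s.Hr m * s.Delta s.Hr m + 9 * s.Delta s.Hp m - 3 * s.Delta (s.D s.Hr) m) / 18 := by
    rw [Delta_eq s s.ss]; simp only [fderiv_ss hm, Delta_eq]
  rw [fderiv_apply_coframe (s := s), e1, e2]

theorem fderiv_hh_coframe (hm : m ∈ s.U) (v : Jet) : fderiv ℝ s.hh m v =
    pd 2 s.hh m * s.coframe 0 m v + pd 3 s.hh m * s.coframe 1 m v + pd 4 s.hh m * s.coframe 2 m v
      + s.D s.Hr m / 3 * s.coframe 3 m v + s.Delta s.Hr m / 3 * s.coframe 4 m v := by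
  have e1 : s.D s.hh m = s.D s.Hr m / 3 := by simp only [D_eq, fderiv_hh hm]
  have e2 : s.Delta s.hh m = s.Delta s.Hr m / 3 := by simp only [Delta_eq, fderiv_hh hm]
  rw [fderiv_apply_coframe (s := s), e1, e2]

theorem varpi_zero : s.varpi 0 m =
    (s.ll m * s.Fz m / s.Fpp m) • s.normCoframe 3 m - (s.Fz m / s.Fpp m) • s.normCoframe 4 m := by
  ext v
  simp [varpi, Fin.sum_univ_five, varpiCoeff]
  ring

theorem varpi_one : s.varpi 1 m =
    s.b1 m • s.normCoframe 0 m + s.ll m • s.normCoframe 1 m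
      + (-(s.ll m * (2 * s.D s.Fp m + s.Fz m) / (2 * s.Fpp m)) - s.hh m) • s.normCoframe 3 m
      + ((2 * s.D s.Fp m + s.Fz m) / (2 * s.Fpp m)) • s.normCoframe 4 m := by
  simp [varpi, Fin.sum_univ_five, varpiCoeff]

theorem varpi_two : s.varpi 2 m =
    s.c1 m • s.normCoframe 0 m
      + (s.qq m * (s.D s.Fp m + s.Fz m) / s.Fpp m - s.b1 m) • s.normCoframe 1 m
      + (-(s.ll m * s.D s.Fz m / s.Fpp m) - s.ss m) • s.normCoframe 3 m
      + (s.D s.Fz m / s.Fpp m) • s.normCoframe 4 m := by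
  simp [varpi, Fin.sum_univ_five, varpiCoeff]

theorem varpi_three : s.varpi 3 m =
    s.d1 m • s.normCoframe 0 m - s.qq m • s.normCoframe 1 m
      + (s.b1 m - (s.qq m * s.D s.Fp m - s.ll m * s.Fpz m) / s.Fpp m) • s.normCoframe 3 m
      - (s.Fpz m / s.Fpp m) • s.normCoframe 4 m := by
  ext v
  simp [varpi, Fin.sum_univ_five, varpiCoeff]
  ring

theorem C_eq (hm : m ∈ s.U) : s.C m = 6 * s.ll m + 3 * pd 4 s.hh m := by
  have h0 := Fpp_ne hm
  rw [pd, fderiv_hh hm]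
  change _ = _ + 3 * (s.Hrr m / 3)
  simp only [C, ll]
  field_simp
  ring

/-- The normalized coframe satisfies the normalized equations on the jet space. -/
theorem torsionNormalized_normCoframe : TorsionNormalized s.U s.normCoframe s.varpi s.V
    (fun m => s.A m / 27) (fun m => s.C m / 3) (fun m => s.B m / 27) (fun m => s.Ctilde m / 3) := by
  -- On a pair `v, v'` each equation becomes a rational identity in the values of `ω` and the
  -- derivatives of `F` and `H`. Integrability is needed for the third equation, through `Δ` of
  -- `H_r`, `H_p`, `DH_r`, and for the fifth, through `Ctilde_eq`.
  constructor <;> intro m hm <;> funext v v' <;> have h0 := Fpp_ne hm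
  · rw [extD_normCoframe_zero hm, extD_coframe_zero hm]
    simp only [wedge, Pi.sub_apply, Pi.neg_apply, Pi.smul_apply, smul_eq_mul,
      add_apply, sub_apply, neg_apply, smul_apply, normCoframe_zero, normCoframe_one,
      normCoframe_three, normCoframe_four hm, varpi_zero]
    field_simp
    ring
  · rw [extD_normCoframe_one hm, extD_coframe_one hm]
    simp only [wedge, Pi.add_apply, Pi.sub_apply, Pi.neg_apply, Pi.smul_apply, smul_eq_mul,
      add_apply, sub_apply, neg_apply, smul_apply, normCoframe_zero, normCoframe_one,
      normCoframe_two, normCoframe_three, normCoframe_four hm, varpi_zero, varpi_one, varpi_two]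
    field_simp
    ring
  · rw [extD_normCoframe_two hm, extD_coframe_zero hm, extD_coframe_one hm, extD_coframe_two hm]
    simp only [wedge, Pi.add_apply, Pi.sub_apply, Pi.neg_apply, Pi.smul_apply, smul_eq_mul,
      add_apply, sub_apply, neg_apply, smul_apply, normCoframe_zero, normCoframe_one,
      normCoframe_two, normCoframe_three, normCoframe_four hm, varpi_one, varpi_two,
      fderiv_ss_coframe hm, fderiv_hh_coframe hm, Delta_Hr m hm, Delta_Hp m hm, Delta_DHr hm,
      C_eq hm, A, V, b1, c1, Nop]
    rw [show s.ss m = (2 * s.Hr m ^ 2 + 9 * s.Hp m - 3 * s.D s.Hr m) / 18 from rfl,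
      show s.hh m = s.Hr m / 3 from rfl]
    field_simp
    ring
  · rw [extD_normCoframe_three hm]
    simp only [wedge, Pi.sub_apply, Pi.neg_apply, smul_eq_mul,
      add_apply, sub_apply, neg_apply, smul_apply, normCoframe_zero, normCoframe_one,
      normCoframe_three, normCoframe_four hm, varpi_zero, varpi_one, varpi_three,
      fderiv_apply_coframe (s := s) s.Fp, pd_four_Fp m hm]
    rw [show pd 2 s.Fp m = s.Fpz m from rfl, show pd 3 s.Fp m = s.Fpp m from rfl]
    field_simp
    ring
  · rw [extD_normCoframe_four hm, extD_coframe_zero hm]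
    simp only [wedge, Pi.add_apply, Pi.sub_apply, Pi.neg_apply, Pi.smul_apply, smul_eq_mul,
      add_apply, sub_apply, neg_apply, smul_apply, normCoframe_zero, normCoframe_one,
      normCoframe_three, normCoframe_four hm, varpi_one, varpi_three,
      fderiv_apply_coframe (s := s) s.Fp, fderiv_apply_coframe (s := s) s.Fpp,
      fderiv_apply_coframe (s := s) s.ll, fderiv_apply_coframe (s := s) s.qq, pd_four_Fp m hm,
      pd_four_Fpp m hm, pd_four_ll hm, pd_four_qq hm, pd_three_ll hm, B_eq hm, Ctilde_eq hm, V, b1,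
      d1, Nop]
    rw [show pd 2 s.Fp m = s.Fpz m from rfl, show pd 3 s.Fp m = s.Fpp m from rfl,
      show pd 2 s.Fpp m = s.Fppz m from rfl, show pd 3 s.Fpp m = s.Fppp m from rfl, Fppp_eq hm,
      show s.hh m = s.Hr m / 3 from rfl]
    field_simp
    ring

end PDESystem

/-! ### Rigidity of the normalized equations -/

section Uniqueness

variable {E : Type*} [NormedAddCommGroup E] [NormedSpace ℝ E] {N : Set E}

theorem fderiv_eq_zero_of_const_on (hN : IsOpen N) {f : E → ℝ} {c : ℝ} (h : ∀ e ∈ N, f e = c)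
    {e : E} (he : e ∈ N) : fderiv ℝ f e = 0 := by
  have h1 : f =ᶠ[nhds e] fun _ => c := Filter.eventuallyEq_of_mem (hN.mem_nhds he) h
  rw [h1.fderiv_eq]
  exact fderiv_const_apply c

/-- Evaluation on dual vectors extracts the coefficient of `w^k ∧ w^l`. The differential of `P`
enters only through its entries in columns `k` and `l`, hence drops out where these are constant;
the coefficients used below are chosen for this. -/
theorem extD_dual_vectors (hN : IsOpen N) {w θ : Fin 5 → E → E →L[ℝ] ℝ}
    {P : E → Matrix (Fin 5) (Fin 5) ℝ} {i : Fin 5} (hθ : ∀ e ∈ N, θ i e = ∑ j, P e i j • w j e)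
    {e : E} (he : e ∈ N) (hP : ∀ j, DifferentiableAt ℝ (fun e => P e i j) e)
    (hw : ∀ j, DifferentiableAt ℝ (w j) e) {f : Fin 5 → E}
    (hf : ∀ i j, w i e (f j) = if i = j then 1 else 0) (k l : Fin 5) :
    extD (θ i) e (f k) (f l) = fderiv ℝ (fun e => P e i l) e (f k)
      - fderiv ℝ (fun e => P e i k) e (f l) + ∑ j, P e i j * extD (w j) e (f k) (f l) := by
  rw [extD_congr (Filter.eventuallyEq_of_mem (hN.mem_nhds he) hθ), extD_sum_smul hP hw]
  simp [hf, Finset.sum_add_distrib, Finset.sum_sub_distrib]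

variable {w θ : Fin 5 → E → E →L[ℝ] ℝ} {ϖ Ω : Fin 4 → E → E →L[ℝ] ℝ}
  {V A C B C' t313 t314 t323 t512 t545 : E → ℝ}

/-- With forms numbered from 1, the coefficients of `w²∧w⁴`, `w²∧w⁵`, `w³∧w⁴` in `dθ¹` give the
value of `P₁₁` and the vanishing of `P₄₅` and `P₂₃`. The coefficient of `w³∧w⁴` in `dθ²` and that of
`w²∧w⁵` in `dθ⁴` then relate the remaining diagonal entries. -/
theorem matrix_entries_of_torsionNormalized (hN : IsOpen N) {P : E → Matrix (Fin 5) (Fin 5) ℝ}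
    (hP : ∀ i j, ∀ e ∈ N, DifferentiableAt ℝ (fun e => P e i j) e)
    (hPs : ∀ e ∈ N, IsStructureMatrix (P e))
    (hθ : ∀ i, ∀ e ∈ N, θ i e = ∑ j, P e i j • w j e)
    (hw : ∀ j, ∀ e ∈ N, DifferentiableAt ℝ (w j) e)
    (hli : ∀ e ∈ N, LinearIndependent ℝ (fun i => w i e))
    (h : TorsionNormalized N w ϖ V A C B C')
    (h' : TorsionNormalized N θ Ω t313 t314 t323 t512 t545) :
    ∀ e ∈ N, P e 1 1 ≠ 0 ∧ P e 3 3 ≠ 0 ∧ P e 1 2 = 0 ∧ P e 3 4 = 0 ∧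
      P e 0 0 = P e 1 1 * P e 3 3 ∧ P e 1 1 = P e 2 2 * P e 3 3 ∧
      P e 3 3 = P e 1 1 * P e 4 4 := by
  have z : ∀ e ∈ N, P e 0 1 = 0 ∧ P e 0 2 = 0 ∧ P e 0 3 = 0 ∧ P e 0 4 = 0 ∧ P e 1 3 = 0 ∧
      P e 1 4 = 0 ∧ P e 2 3 = 0 ∧ P e 2 4 = 0 ∧ P e 3 1 = 0 ∧ P e 3 2 = 0 ∧ P e 4 1 = 0 ∧
      P e 4 2 = 0 := by
    intro e he
    have h1 := (hPs e he).1
    refine ⟨?_, ?_, ?_, ?_, ?_, ?_, ?_, ?_, ?_, ?_, ?_, ?_⟩ <;> rw [h1] <;> simp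
  have key : ∀ e ∈ N, P e 1 1 ≠ 0 ∧ P e 3 3 ≠ 0 ∧ P e 1 2 = 0 ∧ P e 3 4 = 0 ∧
      P e 0 0 = P e 1 1 * P e 3 3 := by
    intro e he
    obtain ⟨f, hf⟩ := exists_dual_vectors (hli e he)
    obtain ⟨z01, z02, z03, z04, z13, z14, z23, z24, z31, z32, z41, z42⟩ := z e he
    have d1 := fderiv_eq_zero_of_const_on hN (fun e he => (z e he).1) he
    have d2 := fderiv_eq_zero_of_const_on hN (fun e he => (z e he).2.1) he
    have d3 := fderiv_eq_zero_of_const_on hN (fun e he => (z e he).2.2.1) he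
    have d4 := fderiv_eq_zero_of_const_on hN (fun e he => (z e he).2.2.2.1) he
    have E0 := fun k l => (extD_dual_vectors hN (hθ 0) he (fun j => hP 0 j e he)
      (fun j => hw j e he) hf k l).symm.trans (congrFun₂ (h'.eq1 e he) (f k) (f l))
    have e13 := E0 1 3
    have e14 := E0 1 4
    have e23 := E0 2 3
    simp [Fin.sum_univ_five, h.eq1 e he, z01, z02, z03, z04, z13, z14, z31, z32, d1, d2, d3, d4,
      wedge, hθ _ e he, hf] at e13 e14 e23
    have hdet := (hPs e he).2
    have h00 : P e 0 0 ≠ 0 := fun h0 => hdet (by simp [h0])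
    have h11 : P e 1 1 ≠ 0 := fun h0 => h00 (by rw [e13, h0, zero_mul])
    have h33 : P e 3 3 ≠ 0 := fun h0 => h00 (by rw [e13, h0, mul_zero])
    exact ⟨h11, h33, e23.resolve_right h33, e14.resolve_left h11, e13⟩
  intro e he
  obtain ⟨h11, h33, h12, h34, h00⟩ := key e he
  refine ⟨h11, h33, h12, h34, h00, ?_⟩
  obtain ⟨f, hf⟩ := exists_dual_vectors (hli e he)
  obtain ⟨z01, z02, z03, z04, z13, z14, z23, z24, z31, z32, z41, z42⟩ := z e he
  -- The two entries vanish on all of the open set `N`, so their differentials vanish too; this is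
  -- why `key` is established at every point first.
  have d12 := fderiv_eq_zero_of_const_on hN (fun e he => (key e he).2.2.1) he
  have d34 := fderiv_eq_zero_of_const_on hN (fun e he => (key e he).2.2.2.1) he
  have d13 := fderiv_eq_zero_of_const_on hN (fun e he => (z e he).2.2.2.2.1) he
  have d31 := fderiv_eq_zero_of_const_on hN (fun e he => (z e he).2.2.2.2.2.2.2.2.1) he
  have e23 := (extD_dual_vectors hN (hθ 1) he (fun j => hP 1 j e he)
    (fun j => hw j e he) hf 2 3).symm.trans (congrFun₂ (h'.eq2 e he) (f 2) (f 3))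
  have e14 := (extD_dual_vectors hN (hθ 3) he (fun j => hP 3 j e he)
    (fun j => hw j e he) hf 1 4).symm.trans (congrFun₂ (h'.eq4 e he) (f 1) (f 4))
  simp [Fin.sum_univ_five, h.eq1 e he, h.eq2 e he, h.eq4 e he, z01, z02, z03, z04, z13, z14, z31,
    z32, z23, z24, z41, h12, h34, d12, d34, d13, d31, wedge, hθ _ e he, hf] at e23 e14
  exact ⟨e23, e14⟩

/-- A coframe that differs from a normalized one by combinations added to `θ³` and `θ⁵` is
normalized only if it is equal to it. -/
theorem corrections_eq_zero (hN : IsOpen N) {c₁ c₂ d₁ d₂ : E → ℝ}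
    (hc₁ : ∀ e ∈ N, DifferentiableAt ℝ c₁ e) (hc₂ : ∀ e ∈ N, DifferentiableAt ℝ c₂ e)
    (hd₁ : ∀ e ∈ N, DifferentiableAt ℝ d₁ e) (hd₂ : ∀ e ∈ N, DifferentiableAt ℝ d₂ e)
    (h0 : ∀ e ∈ N, θ 0 e = w 0 e) (h1 : ∀ e ∈ N, θ 1 e = w 1 e)
    (h2 : ∀ e ∈ N, θ 2 e = c₁ e • w 0 e + c₂ e • w 1 e + w 2 e)
    (h3 : ∀ e ∈ N, θ 3 e = w 3 e)
    (h4 : ∀ e ∈ N, θ 4 e = d₁ e • w 0 e + d₂ e • w 3 e + w 4 e)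
    (hw : ∀ j, ∀ e ∈ N, DifferentiableAt ℝ (w j) e)
    (hli : ∀ e ∈ N, LinearIndependent ℝ (fun i => w i e))
    (h : TorsionNormalized N w ϖ V A C B C')
    (h' : TorsionNormalized N θ Ω t313 t314 t323 t512 t545) :
    ∀ e ∈ N, c₁ e = 0 ∧ c₂ e = 0 ∧ d₁ e = 0 ∧ d₂ e = 0 := by
  let P : E → Matrix (Fin 5) (Fin 5) ℝ := fun e =>
    !![1, 0, 0, 0, 0; 0, 1, 0, 0, 0; c₁ e, c₂ e, 1, 0, 0; 0, 0, 0, 1, 0; d₁ e, 0, 0, d₂ e, 1]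
  have hθ2 : ∀ e ∈ N, θ 2 e = ∑ j, P e 2 j • w j e := fun e he => by
    simp [h2 e he, P, Fin.sum_univ_five]
  have hθ4 : ∀ e ∈ N, θ 4 e = ∑ j, P e 4 j • w j e := fun e he => by
    simp [h4 e he, P, Fin.sum_univ_five]
  have X0 : ∀ e ∈ N, extD (θ 0) e = extD (w 0) e := fun e he =>
    extD_congr (Filter.eventuallyEq_of_mem (hN.mem_nhds he) h0)
  have X1 : ∀ e ∈ N, extD (θ 1) e = extD (w 1) e := fun e he =>
    extD_congr (Filter.eventuallyEq_of_mem (hN.mem_nhds he) h1)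
  have X3 : ∀ e ∈ N, extD (θ 3) e = extD (w 3) e := fun e he =>
    extD_congr (Filter.eventuallyEq_of_mem (hN.mem_nhds he) h3)
  have hP2 : ∀ e ∈ N, ∀ j, DifferentiableAt ℝ (fun e => P e 2 j) e := by
    intro e he j
    fin_cases j
    exacts [hc₁ e he, hc₂ e he, differentiableAt_const _, differentiableAt_const _,
      differentiableAt_const _]
  have hP4 : ∀ e ∈ N, ∀ j, DifferentiableAt ℝ (fun e => P e 4 j) e := by
    intro e he j
    fin_cases j
    exacts [hd₁ e he, differentiableAt_const _, differentiableAt_const _, hd₂ e he,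
      differentiableAt_const _]
  -- The equation for `dθ²` shows that `c₂` shifts the `w⁴` component of `Ω₂` by `-c₂`, while the
  -- `w³∧w⁴` coefficient of `dθ³` demands that `c₂` be twice this shift; so `3 c₂ = 0`. The same
  -- argument with `dθ⁴` and `dθ⁵` gives `3 d₂ = 0`.
  have key : ∀ e ∈ N, c₂ e = 0 ∧ d₂ e = 0 := by
    intro e he
    obtain ⟨f, hf⟩ := exists_dual_vectors (hli e he)
    have E0 := fun k l => congrFun₂ ((h.eq1 e he).symm.trans ((X0 e he).symm.trans (h'.eq1 e he)))
      (f k) (f l)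
    have E1 := fun k l => congrFun₂ ((h.eq2 e he).symm.trans ((X1 e he).symm.trans (h'.eq2 e he)))
      (f k) (f l)
    have E3 := fun k l => congrFun₂ ((h.eq4 e he).symm.trans ((X3 e he).symm.trans (h'.eq4 e he)))
      (f k) (f l)
    have E2 := (extD_dual_vectors hN hθ2 he (hP2 e he) (fun j => hw j e he) hf 2 3).symm.trans
      (congrFun₂ (h'.eq3 e he) (f 2) (f 3))
    have E4 := (extD_dual_vectors hN hθ4 he (hP4 e he) (fun j => hw j e he) hf 1 4).symm.trans
      (congrFun₂ (h'.eq5 e he) (f 1) (f 4))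
    have a1 := E0 0 1
    have a3 := E0 0 3
    have b := E1 1 3
    have c := E3 1 3
    simp [Fin.sum_univ_five, h.eq1 e he, h.eq2 e he, h.eq3 e he, h.eq4 e he, h.eq5 e he, P, wedge,
      h0 e he, h1 e he, h2 e he, h3 e he, h4 e he, hf] at a1 a3 b c E2 E4
    constructor <;> linarith
  intro e he
  obtain ⟨f, hf⟩ := exists_dual_vectors (hli e he)
  -- Now `c₁` is the change of the `w⁴` component of `Ω₃` according to `dθ²`, and minus that change
  -- according to `dθ³`, so `2 c₁ = 0`. Likewise for `d₁` with the `w²` component of `Ω₄`.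
  have E1 := fun k l => congrFun₂ ((h.eq2 e he).symm.trans ((X1 e he).symm.trans (h'.eq2 e he)))
    (f k) (f l)
  have E3 := fun k l => congrFun₂ ((h.eq4 e he).symm.trans ((X3 e he).symm.trans (h'.eq4 e he)))
    (f k) (f l)
  have E2 := (extD_dual_vectors hN hθ2 he (hP2 e he) (fun j => hw j e he) hf 1 3).symm.trans
    (congrFun₂ (h'.eq3 e he) (f 1) (f 3))
  have E4 := (extD_dual_vectors hN hθ4 he (hP4 e he) (fun j => hw j e he) hf 1 3).symm.trans
    (congrFun₂ (h'.eq5 e he) (f 1) (f 3))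
  have dc := fderiv_eq_zero_of_const_on hN (fun e he => (key e he).1) he
  have dd := fderiv_eq_zero_of_const_on hN (fun e he => (key e he).2) he
  obtain ⟨hc, hd⟩ := key e he
  have b := E1 0 3
  have c := E3 0 1
  simp [Fin.sum_univ_five, h.eq1 e he, h.eq2 e he, h.eq3 e he, h.eq4 e he, h.eq5 e he, P, wedge,
    h0 e he, h1 e he, h2 e he, h3 e he, h4 e he, hf, hc, hd, dc, dd] at b c E2 E4
  refine ⟨?_, hc, ?_, hd⟩ <;> linarith

/-- The torsions of a normalized coframe are unique, and the connection forms are unique up to one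
function. -/
theorem connection_unique (hli : ∀ e ∈ N, LinearIndependent ℝ (fun i => θ i e))
    (h : TorsionNormalized N θ ϖ V A C B C')
    (h' : TorsionNormalized N θ Ω t313 t314 t323 t512 t545) :
    ∀ e ∈ N, t313 e = V e ∧ t314 e = A e ∧ t323 e = C e ∧ t512 e = B e ∧ t545 e = C' e ∧
      ∃ u : ℝ, Ω 0 e = ϖ 0 e - u • θ 0 e ∧ Ω 1 e = ϖ 1 e ∧ Ω 2 e = ϖ 2 e - (u / 2) • θ 1 e ∧
        Ω 3 e = ϖ 3 e - (u / 2) • θ 3 e := by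
  intro e he
  obtain ⟨f, hf⟩ := exists_dual_vectors (hli e he)
  have E0 := fun v v' => congrFun₂ ((h.eq1 e he).symm.trans (h'.eq1 e he)) v v'
  have E1 := fun v v' => congrFun₂ ((h.eq2 e he).symm.trans (h'.eq2 e he)) v v'
  have E2 := fun v v' => congrFun₂ ((h.eq3 e he).symm.trans (h'.eq3 e he)) v v'
  have E3 := fun v v' => congrFun₂ ((h.eq4 e he).symm.trans (h'.eq4 e he)) v v'
  have E4 := fun v v' => congrFun₂ ((h.eq5 e he).symm.trans (h'.eq5 e he)) v v'
  simp [wedge] at E0 E1 E2 E3 E4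
  -- The first equation says that `θ¹ ∧ (Ω₁ - ϖ₁) = 0`, so the difference is a multiple of `θ¹`; its
  -- coefficient is `-u`.
  have hδ0 : ∀ v, Ω 0 e v = ϖ 0 e v - (ϖ 0 e (f 0) - Ω 0 e (f 0)) * θ 0 e v := fun v => by
    have := E0 (f 0) v
    simp [hf] at this
    linarith
  have hδ01 : Ω 0 e (f 1) = ϖ 0 e (f 1) := by simpa [hf] using hδ0 (f 1)
  have a1 := E3 (f 3) (f 1)
  -- A change of `Ω₂` by a multiple of `θ¹` would alter the `θ¹∧θ³` coefficient of `dθ³` and the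
  -- `θ¹∧θ⁵` coefficient of `dθ⁵` in opposite directions. As both are the same function `t³₁₃`,
  -- neither `Ω₂` nor `t³₁₃` can change.
  have a2 := E2 (f 2) (f 0)
  have a3 := E4 (f 4) (f 0)
  have a4 := E1 (f 1) (f 0)
  simp [hf, hδ01] at a1 a2 a3 a4
  have hδ1 : ∀ v, Ω 1 e v = ϖ 1 e v := fun v => by
    have b1 := E1 (f 1) v
    have b2 := hδ0 v
    simp [hf, hδ01] at b1
    have b3 : Ω 1 e (f 1) = ϖ 1 e (f 1) := by linarith
    have b4 : Ω 1 e (f 0) = ϖ 1 e (f 0) := by linarith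
    rw [b3] at b1
    rw [b4] at a4
    linear_combination -b1 + θ 0 e v * a4 + 1 / 2 * b2
  have hV : t313 e = V e := by linarith [hδ1 (f 0), hδ1 (f 2)]
  simp only [hδ1, hV] at E1 E2 E3 E4
  have c01 := E2 (f 0) (f 1)
  have c03 := E2 (f 0) (f 3)
  have c12 := E2 (f 1) (f 2)
  have d03 := E4 (f 0) (f 3)
  have d01 := E4 (f 0) (f 1)
  have d34 := E4 (f 3) (f 4)
  have g2 := E1 (f 0) (f 2)
  have g4 := E3 (f 0) (f 4)
  have g3 := E1 (f 0) (f 3)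
  have g1 := E3 (f 0) (f 1)
  simp [hf] at c01 c03 c12 d03 d01 d34 g1 g2 g3 g4
  refine ⟨hV, by linarith, by linarith, by linarith, by linarith,
    ϖ 0 e (f 0) - Ω 0 e (f 0), ?_, ?_, ?_, ?_⟩ <;> ext v
  · simpa using hδ0 v
  · exact hδ1 v
  · have := E1 (f 0) v
    simp [hf] at this
    simp
    linear_combination this - θ 0 e v * c01
  · have := E3 (f 0) v
    simp [hf] at this
    simp
    linear_combination this - θ 0 e v * d03

end Uniqueness

/-! ### Algebra of structure matrices -/

section StructureMatrices

theorem isStructureMatrix_iff (g : Matrix (Fin 5) (Fin 5) ℝ) : IsStructureMatrix g ↔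
    (g 0 1 = 0 ∧ g 0 2 = 0 ∧ g 0 3 = 0 ∧ g 0 4 = 0 ∧ g 1 3 = 0 ∧ g 1 4 = 0 ∧ g 2 3 = 0 ∧
      g 2 4 = 0 ∧ g 3 1 = 0 ∧ g 3 2 = 0 ∧ g 4 1 = 0 ∧ g 4 2 = 0) ∧
    g 0 0 * (g 1 1 * g 2 2 - g 1 2 * g 2 1) * (g 3 3 * g 4 4 - g 3 4 * g 4 3) ≠ 0 := by
  unfold IsStructureMatrix
  refine and_congr_left fun _ => ⟨fun h => ?_, fun h => ?_⟩
  · refine ⟨?_, ?_, ?_, ?_, ?_, ?_, ?_, ?_, ?_, ?_, ?_, ?_⟩ <;> rw [h] <;> simp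
  · obtain ⟨h1, h2, h3, h4, h5, h6, h7, h8, h9, h10, h11, h12⟩ := h
    ext i j
    fin_cases i <;> fin_cases j <;> simp_all

theorem IsStructureMatrix.mul {g h : Matrix (Fin 5) (Fin 5) ℝ} (hg : IsStructureMatrix g)
    (hh : IsStructureMatrix h) : IsStructureMatrix (g * h) := by
  rw [isStructureMatrix_iff] at *
  obtain ⟨⟨a1, a2, a3, a4, a5, a6, a7, a8, a9, a10, a11, a12⟩, a⟩ := hg
  obtain ⟨⟨b1, b2, b3, b4, b5, b6, b7, b8, b9, b10, b11, b12⟩, b⟩ := hh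
  refine ⟨?_, ?_⟩
  · simp [Matrix.mul_apply, Fin.sum_univ_five, *]
  · convert mul_ne_zero a b using 1
    simp [Matrix.mul_apply, Fin.sum_univ_five, *]
    ring

/-- Apart from the first column the matrix is block diagonal, so Cramer's rule in the two `2 × 2`
blocks kills four coefficients, and the first column then kills the remaining one. -/
theorem IsStructureMatrix.eq_zero_of_sum {g : Matrix (Fin 5) (Fin 5) ℝ} (hg : IsStructureMatrix g)
    {c : Fin 5 → ℝ} (hc : ∀ j, ∑ i, c i * g i j = 0) : ∀ i, c i = 0 := by
  rw [isStructureMatrix_iff] at hg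
  obtain ⟨⟨a1, a2, a3, a4, a5, a6, a7, a8, a9, a10, a11, a12⟩, a⟩ := hg
  have e0 := hc 0
  have e1 := hc 1
  have e2 := hc 2
  have e3 := hc 3
  have e4 := hc 4
  simp only [Fin.sum_univ_five, a1, a2, a3, a4, a5, a6, a7, a8, a9, a10, a11, a12] at e0 e1 e2 e3 e4
  have n0 : g 0 0 ≠ 0 := fun h => a (by simp [h])
  have n1 : g 1 1 * g 2 2 - g 1 2 * g 2 1 ≠ 0 := fun h => a (by simp [h])
  have n2 : g 3 3 * g 4 4 - g 3 4 * g 4 3 ≠ 0 := fun h => a (by simp [h])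
  have c1 : c 1 = 0 := (mul_eq_zero.1 (show (g 1 1 * g 2 2 - g 1 2 * g 2 1) * c 1 = 0 by
    linear_combination g 2 2 * e1 - g 2 1 * e2)).resolve_left n1
  have c2 : c 2 = 0 := (mul_eq_zero.1 (show (g 1 1 * g 2 2 - g 1 2 * g 2 1) * c 2 = 0 by
    linear_combination g 1 1 * e2 - g 1 2 * e1)).resolve_left n1
  have c3 : c 3 = 0 := (mul_eq_zero.1 (show (g 3 3 * g 4 4 - g 3 4 * g 4 3) * c 3 = 0 by
    linear_combination g 4 4 * e3 - g 4 3 * e4)).resolve_left n2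
  have c4 : c 4 = 0 := (mul_eq_zero.1 (show (g 3 3 * g 4 4 - g 3 4 * g 4 3) * c 4 = 0 by
    linear_combination g 3 3 * e4 - g 3 4 * e3)).resolve_left n2
  have c0 : c 0 = 0 := (mul_eq_zero.1 (show (g 0 0) * c 0 = 0 by
    rw [c1, c2, c3, c4] at e0; linear_combination e0)).resolve_left n0
  intro i
  fin_cases i <;> assumption

theorem isStructureMatrix_redS {x y : ℝ} (hx : x ≠ 0) (hy : y ≠ 0) (a b : ℝ) :
    IsStructureMatrix (redS x y a b) := by
  rw [isStructureMatrix_iff]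
  refine ⟨by simp [redS], ?_⟩
  simp [redS, hx, hy]

theorem eq_redS {P : Matrix (Fin 5) (Fin 5) ℝ} (hP : IsStructureMatrix P)
    (p00 : P 0 0 = P 1 1 * P 3 3) (p12 : P 1 2 = 0)
    (p20 : P 2 0 = P 1 0 ^ 2 / (2 * (P 1 1 * P 3 3))) (p21 : P 2 1 = P 1 0 / P 3 3)
    (p22 : P 2 2 = P 1 1 / P 3 3) (p34 : P 3 4 = 0)
    (p40 : P 4 0 = -(P 3 0 ^ 2 / (2 * (P 1 1 * P 3 3)))) (p43 : P 4 3 = -(P 3 0 / P 1 1))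
    (p44 : P 4 4 = P 3 3 / P 1 1) : P = redS (P 1 1) (P 3 3) (P 1 0) (P 3 0) := by
  obtain ⟨z01, z02, z03, z04, z13, z14, z23, z24, z31, z32, z41, z42⟩ :=
    ((isStructureMatrix_iff _).1 hP).1
  ext i j
  fin_cases i <;> fin_cases j <;> simp [redS, *]

end StructureMatrices

/-! ### Linear independence of families related by matrices -/

section Independence

variable {V : Type*} [AddCommGroup V] [Module ℝ V]

/-- Invertibility of `P` need not be known: the span of the `n` vectors `w` contains `n` independent
vectors, so its dimension is at least `n`. -/
theorem linearIndependent_of_eq_sum {n : ℕ} {w θ : Fin n → V} (P : Matrix (Fin n) (Fin n) ℝ)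
    (h : ∀ i, θ i = ∑ j, P i j • w j) (hθ : LinearIndependent ℝ θ) : LinearIndependent ℝ w := by
  have := FiniteDimensional.span_of_finite ℝ (Set.finite_range w)
  rw [linearIndependent_iff_card_le_finrank_span]
  have h1 : Submodule.span ℝ (Set.range θ) ≤ Submodule.span ℝ (Set.range w) := by
    rw [Submodule.span_le]
    rintro _ ⟨i, rfl⟩
    rw [h i]
    exact Submodule.sum_mem _ fun j _ => Submodule.smul_mem _ _ (Submodule.subset_span ⟨j, rfl⟩)
  rw [← finrank_span_eq_card hθ]
  exact Submodule.finrank_mono h1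

theorem IsStructureMatrix.linearIndependent {w θ : Fin 5 → V} {P : Matrix (Fin 5) (Fin 5) ℝ}
    (hP : IsStructureMatrix P) (h : ∀ i, θ i = ∑ j, P i j • w j) (hw : LinearIndependent ℝ w) :
    LinearIndependent ℝ θ := by
  rw [Fintype.linearIndependent_iff] at *
  intro c hc
  refine hP.eq_zero_of_sum (hw _ ?_)
  simp only [h, Finset.smul_sum, smul_smul] at hc
  rw [Finset.sum_comm] at hc
  simpa only [Finset.sum_smul] using hc

end Independence

/-! ### Reduction of the structure matrices to `redS` -/

section General

variable {E : Type*} [NormedAddCommGroup E] [NormedSpace ℝ E] {N : Set E}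
  {w θ : Fin 5 → E → E →L[ℝ] ℝ} {ϖ Ω : Fin 4 → E → E →L[ℝ] ℝ}
  {V A C B C' t313 t314 t323 t512 t545 : E → ℝ}

/-- A coframe related to a normalized one by structure matrices is normalized only if these
matrices are the matrices `redS`. -/
theorem normalized_lift_unique (hN : IsOpen N) {P : E → Matrix (Fin 5) (Fin 5) ℝ}
    (hP : ∀ i j, ∀ e ∈ N, DifferentiableAt ℝ (fun e => P e i j) e)
    (hPs : ∀ e ∈ N, IsStructureMatrix (P e))
    (hθ : ∀ i, ∀ e ∈ N, θ i e = ∑ j, P e i j • w j e)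
    (hw : ∀ j, ∀ e ∈ N, DifferentiableAt ℝ (w j) e)
    (hli : ∀ e ∈ N, LinearIndependent ℝ (fun i => w i e))
    (h : TorsionNormalized N w ϖ V A C B C')
    (h' : TorsionNormalized N θ Ω t313 t314 t323 t512 t545) :
    ∀ e ∈ N, P e 1 1 ≠ 0 ∧ P e 3 3 ≠ 0 ∧
      P e = redS (P e 1 1) (P e 3 3) (P e 1 0) (P e 3 0) ∧
      t313 e = V e / (P e 1 1 * P e 3 3)
        - (P e 1 0 * C e / P e 1 1 + P e 3 0 * C' e / P e 3 3) / (2 * (P e 1 1 * P e 3 3)) ∧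
      t314 e = A e / P e 3 3 ^ 3 ∧ t323 e = C e / P e 1 1 ∧ t512 e = B e / P e 1 1 ^ 3 ∧
      t545 e = C' e / P e 3 3 := by
  have key := matrix_entries_of_torsionNormalized hN hP hPs hθ hw hli h h'
  have hx0 : ∀ e ∈ N, P e 1 1 ≠ 0 := fun e he => (key e he).1
  have hy0 : ∀ e ∈ N, P e 3 3 ≠ 0 := fun e he => (key e he).2.1
  -- The solution with the same first, second and fourth forms as `θ`; it can differ from `θ` only
  -- in the third and fifth.
  set w' := redForm w (fun e => P e 1 1) (fun e => P e 3 3) (fun e => P e 1 0) (fun e => P e 3 0)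
    with hw'
  have hred := h.redForm (u := fun _ => 0) hw (hP 1 1) (hP 3 3) (hP 1 0) (hP 3 0) hx0 hy0
  rw [← hw'] at hred
  have hw'd : ∀ j, ∀ e ∈ N, DifferentiableAt ℝ (w' j) e := by
    intro j e he
    exact DifferentiableAt.fun_sum fun k _ => (differentiableAt_redS (hP 1 1 e he) (hP 3 3 e he)
      (hP 1 0 e he) (hP 3 0 e he) (hx0 e he) (hy0 e he) j k).smul (hw k e he)
  have hli' : ∀ e ∈ N, LinearIndependent ℝ (fun i => w' i e) := by
    intro e he
    exact (isStructureMatrix_redS (hx0 e he) (hy0 e he) _ _).linearIndependent (fun i => rfl)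
      (hli e he)
  have hxy0 : ∀ e ∈ N, P e 1 1 * P e 3 3 ≠ 0 := fun e he => mul_ne_zero (hx0 e he) (hy0 e he)
  have dxy : ∀ e ∈ N, DifferentiableAt ℝ (fun e => (P e 1 1 * P e 3 3)⁻¹) e := fun e he =>
    ((hP 1 1 e he).fun_mul (hP 3 3 e he)).fun_inv (hxy0 e he)
  -- The functions `c₁, c₂, d₁, d₂` are the off-diagonal entries of `P` times the inverse of the
  -- matrix `redS` defining `w'`.
  let c₂ : E → ℝ := fun e => (P e 2 1 - P e 1 0 * (P e 3 3)⁻¹) * (P e 1 1)⁻¹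
  let d₂ : E → ℝ := fun e => (P e 4 3 + P e 3 0 * (P e 1 1)⁻¹) * (P e 3 3)⁻¹
  let c₁ : E → ℝ := fun e =>
    (P e 2 0 - P e 1 0 ^ 2 * 2⁻¹ * (P e 1 1 * P e 3 3)⁻¹ - c₂ e * P e 1 0) * (P e 1 1 * P e 3 3)⁻¹
  let d₁ : E → ℝ := fun e =>
    (P e 4 0 + P e 3 0 ^ 2 * 2⁻¹ * (P e 1 1 * P e 3 3)⁻¹ - d₂ e * P e 3 0) * (P e 1 1 * P e 3 3)⁻¹
  have dc₂ : ∀ e ∈ N, DifferentiableAt ℝ c₂ e := fun e he =>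
    ((hP 2 1 e he).fun_sub ((hP 1 0 e he).fun_mul ((hP 3 3 e he).fun_inv (hy0 e he)))).fun_mul
      ((hP 1 1 e he).fun_inv (hx0 e he))
  have dd₂ : ∀ e ∈ N, DifferentiableAt ℝ d₂ e := fun e he =>
    ((hP 4 3 e he).fun_add ((hP 3 0 e he).fun_mul ((hP 1 1 e he).fun_inv (hx0 e he)))).fun_mul
      ((hP 3 3 e he).fun_inv (hy0 e he))
  have dc₁ : ∀ e ∈ N, DifferentiableAt ℝ c₁ e := fun e he =>
    (((hP 2 0 e he).fun_sub ((((hP 1 0 e he).fun_pow 2).mul_const _).fun_mul (dxy e he))).fun_sub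
      ((dc₂ e he).fun_mul (hP 1 0 e he))).fun_mul (dxy e he)
  have dd₁ : ∀ e ∈ N, DifferentiableAt ℝ d₁ e := fun e he =>
    (((hP 4 0 e he).fun_add ((((hP 3 0 e he).fun_pow 2).mul_const _).fun_mul (dxy e he))).fun_sub
      ((dd₂ e he).fun_mul (hP 3 0 e he))).fun_mul (dxy e he)
  have z := fun e he => ((isStructureMatrix_iff _).1 (hPs e he)).1
  have k0 : ∀ e ∈ N, θ 0 e = w' 0 e := fun e he => by
    obtain ⟨z01, z02, z03, z04, z13, z14, z23, z24, z31, z32, z41, z42⟩ := z e he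
    rw [hθ 0 e he]
    simp [hw', redForm, redS, Fin.sum_univ_five, z01, z02, z03, z04, (key e he).2.2.2.2.1]
  have k1 : ∀ e ∈ N, θ 1 e = w' 1 e := fun e he => by
    obtain ⟨z01, z02, z03, z04, z13, z14, z23, z24, z31, z32, z41, z42⟩ := z e he
    rw [hθ 1 e he]
    simp [hw', redForm, redS, Fin.sum_univ_five, z13, z14, (key e he).2.2.1]
  have k3 : ∀ e ∈ N, θ 3 e = w' 3 e := fun e he => by
    obtain ⟨z01, z02, z03, z04, z13, z14, z23, z24, z31, z32, z41, z42⟩ := z e he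
    rw [hθ 3 e he]
    simp [hw', redForm, redS, Fin.sum_univ_five, z31, z32, (key e he).2.2.2.1]
  have p22 : ∀ e ∈ N, P e 2 2 = P e 1 1 / P e 3 3 := fun e he =>
    eq_div_of_mul_eq (hy0 e he) (key e he).2.2.2.2.2.1.symm
  have p44 : ∀ e ∈ N, P e 4 4 = P e 3 3 / P e 1 1 := fun e he =>
    eq_div_of_mul_eq (hx0 e he) ((mul_comm _ _).trans (key e he).2.2.2.2.2.2.symm)
  have k2 : ∀ e ∈ N, θ 2 e = c₁ e • w' 0 e + c₂ e • w' 1 e + w' 2 e := fun e he => by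
    obtain ⟨z01, z02, z03, z04, z13, z14, z23, z24, z31, z32, z41, z42⟩ := z e he
    have hx := hx0 e he
    have hy := hy0 e he
    rw [hθ 2 e he]
    ext v
    simp [hw', redForm, redS, Fin.sum_univ_five, z23, z24, p22 e he, c₁, c₂]
    field_simp
    ring
  have k4 : ∀ e ∈ N, θ 4 e = d₁ e • w' 0 e + d₂ e • w' 3 e + w' 4 e := fun e he => by
    obtain ⟨z01, z02, z03, z04, z13, z14, z23, z24, z31, z32, z41, z42⟩ := z e he
    have hx := hx0 e he
    have hy := hy0 e he
    rw [hθ 4 e he]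
    ext v
    simp [hw', redForm, redS, Fin.sum_univ_five, z41, z42, p44 e he, d₁, d₂]
    field_simp
    ring
  have hcor := corrections_eq_zero hN dc₁ dc₂ dd₁ dd₂ k0 k1 k2 k3 k4 hw'd hli' hred h'
  have kk : ∀ i, ∀ e ∈ N, θ i e = w' i e := by
    intro i e he
    obtain ⟨r1, r2, r3, r4⟩ := hcor e he
    have e2 := k2 e he
    have e4 := k4 e he
    simp only [r1, r2, r3, r4, zero_smul, zero_add] at e2 e4
    fin_cases i
    exacts [k0 e he, k1 e he, e2, k3 e he, e4]
  have hu := connection_unique hli' hred (h'.congr hN (fun i e he => (kk i e he).symm)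
    (fun _ _ _ => rfl) (fun _ _ => rfl) (fun _ _ => rfl) (fun _ _ => rfl) (fun _ _ => rfl)
    (fun _ _ => rfl))
  intro e he
  obtain ⟨t1, t2, t3, t4, t5, -⟩ := hu e he
  refine ⟨hx0 e he, hy0 e he, ?_, t1, t2, t3, t4, t5⟩
  obtain ⟨z01, z02, z03, z04, z13, z14, z23, z24, z31, z32, z41, z42⟩ := z e he
  obtain ⟨r1, r2, r3, r4⟩ := hcor e he
  obtain ⟨-, -, p12, p34, p00, -, -⟩ := key e he
  have hx := hx0 e he
  have hy := hy0 e he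
  have hxy := hxy0 e he
  have p21 : P e 2 1 = P e 1 0 / P e 3 3 := by
    rw [div_eq_mul_inv]
    exact sub_eq_zero.1 ((mul_eq_zero.1 r2).resolve_right (inv_ne_zero hx))
  have p43 : P e 4 3 = -(P e 3 0 / P e 1 1) := by
    rw [div_eq_mul_inv]
    exact eq_neg_of_add_eq_zero_left ((mul_eq_zero.1 r4).resolve_right (inv_ne_zero hy))
  have p20 : P e 2 0 = P e 1 0 ^ 2 / (2 * (P e 1 1 * P e 3 3)) := by
    have := (mul_eq_zero.1 r1).resolve_right (inv_ne_zero hxy)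
    rw [r2, zero_mul, sub_zero, sub_eq_zero] at this
    simp only [this, div_eq_mul_inv, mul_inv, mul_assoc]
  have p40 : P e 4 0 = -(P e 3 0 ^ 2 / (2 * (P e 1 1 * P e 3 3))) := by
    have := (mul_eq_zero.1 r3).resolve_right (inv_ne_zero hxy)
    rw [r4, zero_mul, sub_zero] at this
    simp only [eq_neg_of_add_eq_zero_left this, div_eq_mul_inv, mul_inv, mul_assoc]
  exact eq_redS (hPs e he) p00 p12 p20 p21 (p22 e he) p34 p40 p43 (p44 e he)

end General

/-! ### The inverse of `M` and lifts of `w` along maps -/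

namespace PDESystem

variable {s : PDESystem}

/-- The inverse of `normMat`. -/
def normInv (s : PDESystem) (m : Jet) : Matrix (Fin 5) (Fin 5) ℝ :=
  !![-1, 0, 0, 0, 0;
     0, 1, 0, 0, 0;
     -s.ss m, s.hh m, -1, 0, 0;
     s.Fp m * s.qq m / s.Fpp m, 0, 0, 1 - s.Fp m * s.ll m / s.Fpp m, s.Fp m / s.Fpp m;
     -(s.qq m / s.Fpp m), 0, 0, s.ll m / s.Fpp m, -(1 / s.Fpp m)]

theorem normMat_eq {m : Jet} (hm : m ∈ s.U) : s.normMat m =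
    !![-1, 0, 0, 0, 0;
       0, 1, 0, 0, 0;
       s.ss m, s.hh m, -1, 0, 0;
       0, 0, 0, 1, s.Fp m;
       s.qq m, 0, 0, s.ll m, s.ll m * s.Fp m - s.Fpp m] := by
  have h := normMat_four_four hm
  ext i j
  fin_cases i <;> fin_cases j
  all_goals first | exact h | simp [normMat, ss, hh, ll, qq]

theorem normInv_mul_normMat {m : Jet} (hm : m ∈ s.U) : s.normInv m * s.normMat m = 1 := by
  have h0 := Fpp_ne hm
  rw [normMat_eq hm, normInv]
  ext i j
  fin_cases i <;> fin_cases j <;> simp [Matrix.mul_apply, Fin.sum_univ_five] <;> field_simp <;> ring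

theorem isStructureMatrix_normMat {m : Jet} (hm : m ∈ s.U) : IsStructureMatrix (s.normMat m) := by
  have h0 := Fpp_ne hm
  rw [normMat_eq hm, isStructureMatrix_iff]
  refine ⟨by simp, ?_⟩
  simp
  intro h
  exact h0 (by linear_combination -h)

theorem isStructureMatrix_normInv {m : Jet} (hm : m ∈ s.U) : IsStructureMatrix (s.normInv m) := by
  have h0 := Fpp_ne hm
  rw [normInv, isStructureMatrix_iff]
  refine ⟨by simp, ?_⟩
  simp
  intro h
  field_simp at h
  exact h0 (by linear_combination -h)

theorem sm_normInv (i j : Fin 5) : s.Sm fun m => s.normInv m i j := by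
  have h : ∀ m ∈ s.U, s.Fpp m ≠ 0 := fun m hm => Fpp_ne hm
  fin_cases i <;> fin_cases j
  exacts [sm_const _, sm_const _, sm_const _, sm_const _, sm_const _, sm_const _, sm_const _,
    sm_const _, sm_const _, sm_const _, sm_ss.neg, sm_hh, sm_const _, sm_const _, sm_const _,
    (sm_Fp.mul sm_qq).div sm_Fpp h, sm_const _, sm_const _,
    (sm_const 1).sub ((sm_Fp.mul sm_ll).div sm_Fpp h), sm_Fp.div sm_Fpp h,
    (sm_qq.div sm_Fpp h).neg, sm_const _, sm_const _, sm_ll.div sm_Fpp h,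
    ((sm_const 1).div sm_Fpp h).neg]

theorem linearIndependent_coframe (m : Jet) : LinearIndependent ℝ (fun j => s.coframe j m) := by
  rw [Fintype.linearIndependent_iff]
  intro c hc
  have key : ∀ v : Jet, c 0 * s.coframe 0 m v + c 1 * s.coframe 1 m v + c 2 * s.coframe 2 m v
      + c 3 * s.coframe 3 m v + c 4 * s.coframe 4 m v = 0 := fun v => by
    have := DFunLike.congr_fun hc v
    simpa [Fin.sum_univ_five] using this
  simp only [coframe_zero, coframe_one, coframe_two, coframe_three, coframe_four] at key
  have e0 := key ![0, 0, 1, 0, 0]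
  have e1 := key ![0, 0, 0, 1, 0]
  have e2 := key ![0, 0, 0, 0, 1]
  have e3 := key ![1, 0, 0, 0, 0]
  have e4 := key ![0, 1, 0, 0, 0]
  simp at e0 e1 e2
  simp [e0, e1, e2] at e3 e4
  intro i
  fin_cases i <;> assumption

theorem linearIndependent_normCoframe {m : Jet} (hm : m ∈ s.U) :
    LinearIndependent ℝ (fun j => s.normCoframe j m) :=
  (isStructureMatrix_normMat hm).linearIndependent (fun _ => rfl) (linearIndependent_coframe m)

section Lift

variable {E : Type*} [NormedAddCommGroup E] [NormedSpace ℝ E] {N : Set E} {m : E → Jet}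
  {ρ φ a b u : E → ℝ}

theorem wPull_eq (k : Fin 5) (e : E) :
    s.wPull m k e = ∑ j, s.normMat (m e) k j • (s.coframe j (m e)).comp (fderiv ℝ m e) := by
  ext v
  simp [wPull, normCoframe]

theorem lift_mul_normMat {g : E → Matrix (Fin 5) (Fin 5) ℝ} {e : E}
    {P : Matrix (Fin 5) (Fin 5) ℝ} (hg : g e = P * s.normMat (m e)) (i : Fin 5) :
    s.lift m g i e = ∑ k, P i k • s.wPull m k e := by
  simp only [lift, hg, wPull_eq, Finset.smul_sum, smul_smul, Matrix.mul_apply, Finset.sum_smul]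
  exact Finset.sum_comm

theorem torsionNormalized_wPull (hN : IsOpen N) (hm : ContDiffOn ℝ ∞ m N)
    (hmU : Set.MapsTo m N s.U) : TorsionNormalized N (s.wPull m) (s.varpiPull m)
      (fun e => s.V (m e)) (fun e => s.A (m e) / 27) (fun e => s.C (m e) / 3)
      (fun e => s.B (m e) / 27) (fun e => s.Ctilde (m e) / 3) :=
  torsionNormalized_normCoframe.pullback
    (fun _ he => (hm.contDiffAt (hN.mem_nhds he)).of_le (WithTop.coe_le_coe.2 le_top)) hmU
    (fun i _ hp => differentiableAt_normCoframe hp i)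

theorem Smat_eq_redS {ρ φ : ℝ} (hρ : 0 < ρ) (a b : ℝ) :
    Smat ρ φ a b = redS (ρ * Real.exp φ) (ρ * Real.exp (-φ)) a b := by
  have h0 := hρ.ne'
  have he := Real.exp_ne_zero φ
  have e2 : Real.exp (2 * φ) = Real.exp φ ^ 2 := by rw [← Real.exp_nat_mul]; norm_num
  have e3 : Real.exp (-2 * φ) = (Real.exp φ ^ 2)⁻¹ := by rw [neg_mul, Real.exp_neg, e2]
  unfold Smat redS
  rw [e3, e2, Real.exp_neg]
  ext i j
  fin_cases i <;> fin_cases j <;> simp <;> field_simp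

theorem theta_eq_redForm {e : E} (hρ : 0 < ρ e) (i : Fin 5) :
    s.theta m ρ φ a b i e = redForm (s.wPull m) (fun e => ρ e * Real.exp (φ e))
      (fun e => ρ e * Real.exp (-φ e)) a b i e :=
  lift_mul_normMat (by rw [redMat, Smat_eq_redS hρ]) i

/-- For `x = ρ e^φ` and `y = ρ e^(-φ)` one has `dx/x + dy/y = 2 dρ/ρ` and `(dy/y - dx/x)/2 = -dφ`.
The torsions `t³₂₃` and `t⁵₄₅` of `w` are `C/3` and `C̃/3`, which accounts for the factors 3 in
`alpha` and `beta`. -/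
theorem Omega_eq_redOmega {e : E} (hρ : 0 < ρ e) (hρd : DifferentiableAt ℝ ρ e)
    (hφd : DifferentiableAt ℝ φ e) (k : Fin 4) :
    s.Omega m ρ φ a b u k e = redOmega (s.wPull m) (s.varpiPull m) (fun e => s.V (m e))
      (fun e => s.C (m e) / 3) (fun e => s.Ctilde (m e) / 3) (fun e => ρ e * Real.exp (φ e))
      (fun e => ρ e * Real.exp (-φ e)) a b u k e := by
  have h0 := hρ.ne'
  have he := Real.exp_ne_zero (φ e)
  have e2 : Real.exp (2 * φ e) = Real.exp (φ e) ^ 2 := by rw [← Real.exp_nat_mul]; norm_num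
  have e3 : Real.exp (-(2 * φ e)) = (Real.exp (φ e) ^ 2)⁻¹ := by rw [Real.exp_neg, e2]
  have dx : fderiv ℝ (fun e => ρ e * Real.exp (φ e)) e =
      (ρ e * Real.exp (φ e)) • fderiv ℝ φ e + Real.exp (φ e) • fderiv ℝ ρ e := by
    rw [fderiv_fun_mul hρd hφd.exp, fderiv_exp hφd, smul_smul]
  have dy : fderiv ℝ (fun e => ρ e * Real.exp (-φ e)) e =
      -(ρ e * Real.exp (-φ e)) • fderiv ℝ φ e + Real.exp (-φ e) • fderiv ℝ ρ e := by
    rw [fderiv_fun_mul hρd hφd.fun_neg.exp, fderiv_exp hφd.fun_neg, fderiv_fun_neg, smul_smul,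
      smul_neg, neg_smul]
  simp only [Real.exp_neg] at dy
  have t0 : s.theta m ρ φ a b 0 e = ρ e ^ 2 • s.wPull m 0 e := by
    rw [theta_eq_redForm hρ]
    simp [redForm, redS, Fin.sum_univ_five, Real.exp_neg]
    congr 1
    field_simp
  have t1 : s.theta m ρ φ a b 1 e =
      a e • s.wPull m 0 e + (ρ e * Real.exp (φ e)) • s.wPull m 1 e := by
    rw [theta_eq_redForm hρ]
    simp [redForm, redS, Fin.sum_univ_five]
  have t3 : s.theta m ρ φ a b 3 e =
      b e • s.wPull m 0 e + (ρ e * Real.exp (-φ e)) • s.wPull m 3 e := by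
    rw [theta_eq_redForm hρ]
    simp [redForm, redS, Fin.sum_univ_five]
  fin_cases k <;> ext v <;>
    simp [Omega, Omega1, Omega2, Omega3, Omega4, redOmega, dx, dy, t0, t1, t3, alpha, beta,
      Real.exp_neg, e2, e3] <;>
    field_simp <;> ring

theorem torsionNormalized_theta (hN : IsOpen N) (hm : ContDiffOn ℝ ∞ m N)
    (hmU : Set.MapsTo m N s.U) (hρ : ContDiffOn ℝ ∞ ρ N) (hφ : ContDiffOn ℝ ∞ φ N)
    (ha : ContDiffOn ℝ ∞ a N) (hb : ContDiffOn ℝ ∞ b N) (hρ0 : ∀ e ∈ N, 0 < ρ e) :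
    TorsionNormalized N (s.theta m ρ φ a b) (s.Omega m ρ φ a b u)
      (s.Q m ρ φ a b) (s.t314 m ρ φ) (s.t323 m ρ φ) (s.t512 m ρ φ) (s.t545 m ρ φ) := by
  have hd : ∀ {f : E → ℝ}, ContDiffOn ℝ ∞ f N → ∀ e ∈ N, DifferentiableAt ℝ f e := fun hf e he =>
    (hf.contDiffAt (hN.mem_nhds he)).differentiableAt (by simp)
  have hmd : ∀ e ∈ N, DifferentiableAt ℝ m e := fun e he =>
    (hm.contDiffAt (hN.mem_nhds he)).differentiableAt (by simp)
  have hw : ∀ j, ∀ e ∈ N, DifferentiableAt ℝ (s.wPull m j) e := by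
    intro j e he
    have h1 : DifferentiableAt ℝ (fderiv ℝ m) e :=
      ((hm.contDiffAt (hN.mem_nhds he)).fderiv_right (m := 1) (WithTop.coe_le_coe.2 le_top)
        ).differentiableAt (by norm_num)
    exact ((differentiableAt_normCoframe (hmU he) j).comp e (hmd e he)).clm_comp h1
  refine ((torsionNormalized_wPull hN hm hmU).redForm (u := u) hw
    (fun e he => (hd hρ e he).fun_mul (hd hφ e he).exp)
    (fun e he => (hd hρ e he).fun_mul (hd hφ e he).fun_neg.exp) (hd ha) (hd hb)
    (fun e he => (mul_pos (hρ0 e he) (Real.exp_pos _)).ne')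
    (fun e he => (mul_pos (hρ0 e he) (Real.exp_pos _)).ne')).congr hN
    (fun i e he => theta_eq_redForm (hρ0 e he) i)
    (fun k e he => Omega_eq_redOmega (hρ0 e he) (hd hρ e he) (hd hφ e he) k) ?_ ?_ ?_ ?_ ?_ <;>
    intro e he <;> have h0 := (hρ0 e he).ne' <;> have h1 := Real.exp_ne_zero (φ e)
  · simp only [Q, alpha, beta, Real.exp_neg]
    field_simp
    ring
  · rw [t314, show (3 : ℝ) * φ e = (3 : ℕ) * φ e by norm_num, Real.exp_nat_mul, Real.exp_neg]
    field_simp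
  · simp only [t323, Real.exp_neg]
    field_simp
  · rw [t512, show (-3 : ℝ) * φ e = -((3 : ℕ) * φ e) by norm_num, Real.exp_neg, Real.exp_nat_mul]
    field_simp
  · simp only [t545, Real.exp_neg]
    field_simp

end Lift
end PDESystem

/-! ### Smoothness of the connection forms -/

section Smoothness

variable {E : Type*} [NormedAddCommGroup E] [NormedSpace ℝ E] {N : Set E}
  {w : Fin 5 → E → E →L[ℝ] ℝ} {ϖ : Fin 4 → E → E →L[ℝ] ℝ} {V c k x y a b u : E → ℝ}

theorem contDiffOn_redOmega (hN : IsOpen N) (hw : ∀ j, ContDiffOn ℝ ∞ (w j) N)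
    (hϖ : ∀ j, ContDiffOn ℝ ∞ (ϖ j) N) (hV : ContDiffOn ℝ ∞ V N) (hc : ContDiffOn ℝ ∞ c N)
    (hk : ContDiffOn ℝ ∞ k N) (hx : ContDiffOn ℝ ∞ x N) (hy : ContDiffOn ℝ ∞ y N)
    (ha : ContDiffOn ℝ ∞ a N) (hb : ContDiffOn ℝ ∞ b N) (hu : ContDiffOn ℝ ∞ u N)
    (hx0 : ∀ e ∈ N, x e ≠ 0) (hy0 : ∀ e ∈ N, y e ≠ 0) (j : Fin 4) :
    ContDiffOn ℝ ∞ (redOmega w ϖ V c k x y a b u j) N := by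
  have hw0 := hw 0
  have hw1 := hw 1
  have hw2 := hw 2
  have hw3 := hw 3
  have hw4 := hw 4
  have h0 := hϖ 0
  have h1 := hϖ 1
  have h2 := hϖ 2
  have h3 := hϖ 3
  have dx : ContDiffOn ℝ ∞ (fderiv ℝ x) N := hx.fderiv_of_isOpen hN (by simp)
  have dy : ContDiffOn ℝ ∞ (fderiv ℝ y) N := hy.fderiv_of_isOpen hN (by simp)
  have da : ContDiffOn ℝ ∞ (fderiv ℝ a) N := ha.fderiv_of_isOpen hN (by simp)
  have db : ContDiffOn ℝ ∞ (fderiv ℝ b) N := hb.fderiv_of_isOpen hN (by simp)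
  have hxi : ContDiffOn ℝ ∞ (fun e => (x e)⁻¹) N := hx.inv hx0
  have hyi : ContDiffOn ℝ ∞ (fun e => (y e)⁻¹) N := hy.inv hy0
  unfold redOmega
  simp only [div_eq_mul_inv, mul_inv, ← inv_pow]
  -- With derivatives and inverses replaced by opaque smooth functions, each connection form is a
  -- polynomial combination of smooth terms and no nonvanishing condition is left to check.
  generalize fderiv ℝ x = x' at *
  generalize fderiv ℝ y = y' at *
  generalize fderiv ℝ a = a' at *
  generalize fderiv ℝ b = b' at *
  generalize w 0 = w0 at *
  generalize w 1 = w1 at *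
  generalize w 2 = w2 at *
  generalize w 3 = w3 at *
  generalize w 4 = w4 at *
  generalize ϖ 0 = p0 at *
  generalize ϖ 1 = p1 at *
  generalize ϖ 2 = p2 at *
  generalize ϖ 3 = p3 at *
  obtain ⟨xi, hxe⟩ : ∃ xi : E → ℝ, ∀ e, (x e)⁻¹ = xi e := ⟨_, fun _ => rfl⟩
  obtain ⟨yi, hye⟩ : ∃ yi : E → ℝ, ∀ e, (y e)⁻¹ = yi e := ⟨_, fun _ => rfl⟩
  simp only [hxe, hye] at hxi hyi ⊢
  fin_cases j <;> simp only [Fin.zero_eta, Fin.mk_one, Fin.reduceFinMk, Matrix.cons_val] <;> fun_prop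

end Smoothness

namespace PDESystem

variable {s : PDESystem}

section Smoothness

theorem sm_Nop {f : Jet → ℝ} (hf : s.Sm f) : s.Sm (s.Nop f) :=
  (hf.Delta.sub (sm_Fp.mul hf.D)).div sm_Fpp fun _ hm => Fpp_ne hm

theorem sm_C : s.Sm s.C :=
  (((sm_const 2).mul sm_Fppp).add (sm_Fpp.mul sm_Hrr)).div sm_Fpp fun _ hm => Fpp_ne hm

theorem sm_Ctilde : s.Sm s.Ctilde :=
  ((((sm_Fp.D.add sm_Fz).mul sm_C).sub (sm_Fp.mul sm_C.D)).add sm_C.Delta).div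
    ((sm_const 2).mul sm_Fpp) fun m hm => by simp [Fpp_ne hm]

theorem sm_V : s.Sm s.V :=
  (sm_const _).mul ((((sm_Nop sm_qq).neg).sub (sm_ss.pd 4)).add
    ((((sm_ll.mul sm_Fpz).sub sm_Fppz).sub (((sm_const 2).mul sm_qq).mul
      (sm_Fp.D.add sm_Fz))).div sm_Fpp fun _ hm => Fpp_ne hm))

theorem sm_b1 : s.Sm s.b1 :=
  (sm_const _).mul ((((sm_Nop sm_qq).neg).add (sm_ss.pd 4)).add
    ((((((sm_const 2).mul sm_qq).mul sm_Fp.D).add (sm_ll.mul sm_Fpz)).sub sm_Fppz).div sm_Fpp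
      fun _ hm => Fpp_ne hm))

theorem sm_c1 : s.Sm s.c1 :=
  ((((sm_ss.pd 3).add (sm_hh.mul (sm_ss.pd 4))).sub (sm_hh.pd 2)).sub
    (sm_ss.mul (sm_hh.pd 4))).add ((sm_qq.mul sm_Fz.D).div sm_Fpp fun _ hm => Fpp_ne hm)

theorem sm_d1 : s.Sm s.d1 :=
  (((((sm_qq.D.add (sm_ll.mul (sm_Nop sm_qq))).sub (sm_ll.pd 2)).sub
    (sm_qq.mul (sm_Nop sm_ll))).add
    (((sm_ll.mul (sm_Fppz.sub (sm_ll.mul sm_Fpz))).add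
      (sm_qq.mul (((sm_ll.mul sm_Fp.D).sub sm_Fpp.D).add (sm_ll.mul sm_Fz)))).div sm_Fpp
        fun _ hm => Fpp_ne hm))).neg

theorem sm_varpiCoeff (i : Fin 4) (j : Fin 5) : s.Sm fun m => s.varpiCoeff m i j := by
  have h : ∀ m ∈ s.U, s.Fpp m ≠ 0 := fun m hm => Fpp_ne hm
  have h2 : ∀ m ∈ s.U, 2 * s.Fpp m ≠ 0 := fun m hm => by simp [Fpp_ne hm]
  have sK2 : s.Sm fun m => 2 * s.Fpp m := (sm_const 2).mul sm_Fpp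
  have sF : s.Sm fun m => 2 * s.D s.Fp m + s.Fz m := ((sm_const 2).mul sm_Fp.D).add sm_Fz
  have a03 := (sm_ll.mul sm_Fz).div sm_Fpp h
  have a04 := sm_Fz.neg.div sm_Fpp h
  have a13 := ((sm_ll.mul sF).div sK2 h2).neg.sub sm_hh
  have a14 := sF.div sK2 h2
  have a21 := ((sm_qq.mul (sm_Fp.D.add sm_Fz)).div sm_Fpp h).sub sm_b1
  have a23 := ((sm_ll.mul sm_Fz.D).div sm_Fpp h).neg.sub sm_ss
  have a24 := sm_Fz.D.div sm_Fpp h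
  have a33 := sm_b1.sub (((sm_qq.mul sm_Fp.D).sub (sm_ll.mul sm_Fpz)).div sm_Fpp h)
  have a34 := sm_Fpz.neg.div sm_Fpp h
  fin_cases i <;> fin_cases j
  exacts [sm_const 0, sm_const 0, sm_const 0, a03, a04, sm_b1, sm_ll, sm_const 0, a13, a14,
    sm_c1, a21, sm_const 0, a23, a24, sm_d1, sm_qq.neg, sm_const 0, a33, a34]

theorem contDiffOn_coframe (j : Fin 5) : ContDiffOn ℝ ∞ (s.coframe j) s.U := by
  have c : ∀ i, ContDiffOn ℝ ∞ (fun _ : Jet => dcoord i) s.U := fun i => contDiffOn_const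
  fin_cases j
  exacts [((c 2).sub ((sm_coord 3).smul (c 0))).sub (sm_F.smul (c 1)),
    ((c 3).sub ((sm_coord 4).smul (c 0))).sub (sm_F.D.smul (c 1)),
    ((c 4).sub (sm_H.smul (c 0))).sub (sm_F.D.D.smul (c 1)), c 0, c 1]

theorem contDiffOn_normCoframe (i : Fin 5) : ContDiffOn ℝ ∞ (s.normCoframe i) s.U :=
  ContDiffOn.sum fun j _ => (sm_normMat i j).smul (contDiffOn_coframe j)

theorem contDiffOn_varpi (k : Fin 4) : ContDiffOn ℝ ∞ (s.varpi k) s.U :=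
  ContDiffOn.sum fun j _ => (sm_varpiCoeff k j).smul (contDiffOn_normCoframe j)

variable {E : Type*} [NormedAddCommGroup E] [NormedSpace ℝ E] {N : Set E} {m : E → Jet}
  {ρ φ a b u : E → ℝ}

theorem contDiffOn_pullback (hN : IsOpen N) (hm : ContDiffOn ℝ ∞ m N) (hmU : Set.MapsTo m N s.U)
    {α : Jet → Jet →L[ℝ] ℝ} (hα : ContDiffOn ℝ ∞ α s.U) :
    ContDiffOn ℝ ∞ (fun e => (α (m e)).comp (fderiv ℝ m e)) N :=
  (hα.comp hm hmU).clm_comp (hm.fderiv_of_isOpen hN (by simp))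

theorem contDiffOn_Omega (hN : IsOpen N) (hm : ContDiffOn ℝ ∞ m N) (hmU : Set.MapsTo m N s.U)
    (hρ : ContDiffOn ℝ ∞ ρ N) (hφ : ContDiffOn ℝ ∞ φ N) (ha : ContDiffOn ℝ ∞ a N)
    (hb : ContDiffOn ℝ ∞ b N) (hu : ContDiffOn ℝ ∞ u N) (hρ0 : ∀ e ∈ N, 0 < ρ e) (k : Fin 4) :
    ContDiffOn ℝ ∞ (s.Omega m ρ φ a b u k) N := by
  have hd : ∀ {f : E → ℝ}, ContDiffOn ℝ ∞ f N → ∀ e ∈ N, DifferentiableAt ℝ f e := fun hf e he =>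
    (hf.contDiffAt (hN.mem_nhds he)).differentiableAt (by simp)
  refine (contDiffOn_redOmega hN
    (fun j => contDiffOn_pullback hN hm hmU (contDiffOn_normCoframe j))
    (fun j => contDiffOn_pullback hN hm hmU (contDiffOn_varpi j))
    (ContDiffOn.comp sm_V hm hmU) ((ContDiffOn.comp sm_C hm hmU).div_const 3)
    ((ContDiffOn.comp sm_Ctilde hm hmU).div_const 3) (hρ.mul hφ.exp) (hρ.mul hφ.neg.exp) ha hb hu
    (fun e he => (mul_pos (hρ0 e he) (Real.exp_pos _)).ne')
    (fun e he => (mul_pos (hρ0 e he) (Real.exp_pos _)).ne') k).congr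
    fun e he => Omega_eq_redOmega (hρ0 e he) (hd hρ e he) (hd hφ e he) k

end Smoothness

theorem isG0_redMat {E : Type*} {m : E → Jet} {ρ φ a b : E → ℝ} {e : E} (hm : m e ∈ s.U)
    (hρ : 0 < ρ e) : IsG0 (ρ e) (φ e) (s.redMat m ρ φ a b e) := by
  have hx : ρ e * Real.exp (φ e) ≠ 0 := (mul_pos hρ (Real.exp_pos _)).ne'
  have hy : ρ e * Real.exp (-φ e) ≠ 0 := (mul_pos hρ (Real.exp_pos _)).ne'
  refine ⟨?_, hρ, ?_, ?_⟩
  · rw [redMat, Smat_eq_redS hρ]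
    exact (isStructureMatrix_redS hx hy _ _).mul (isStructureMatrix_normMat hm)
  · simp [redMat, Matrix.mul_apply, Fin.sum_univ_five, Smat, normMat]
  · simp [redMat, Matrix.mul_apply, Fin.sum_univ_five, Smat, normMat]

/-! ### Independence of the nine forms -/

section Lift

variable {E : Type*} [NormedAddCommGroup E] [NormedSpace ℝ E] {N : Set E} {m : E → Jet}
  {ρ φ a b u : E → ℝ}

/-- On vectors with `dm v = 0` the forms `θ`, `w`, `ϖ` vanish and the `Ω` reduce to combinations of
`dρ, dφ, da, db`, which take arbitrary values by surjectivity. This removes the coefficients of the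
`Ω`. Vectors with arbitrary `dm v` then reduce the claim to independence of the coframe on the jet
space. -/
theorem linearIndependent_theta_Omega {e : E} (hmU : m e ∈ s.U) (hm : DifferentiableAt ℝ m e)
    (hρ : DifferentiableAt ℝ ρ e) (hφ : DifferentiableAt ℝ φ e) (ha : DifferentiableAt ℝ a e)
    (hb : DifferentiableAt ℝ b e) (hρ0 : 0 < ρ e)
    (hsurj : Function.Surjective (fderiv ℝ (fun y => (m y, ρ y, φ y, a y, b y)) e)) :
    LinearIndependent ℝ (Sum.elim (fun i => s.theta m ρ φ a b i e)
      (fun k => s.Omega m ρ φ a b u k e)) := by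
  have hder : fderiv ℝ (fun y => (m y, ρ y, φ y, a y, b y)) e = (fderiv ℝ m e).prod
      ((fderiv ℝ ρ e).prod ((fderiv ℝ φ e).prod ((fderiv ℝ a e).prod (fderiv ℝ b e)))) :=
    (hm.hasFDerivAt.prodMk (hρ.hasFDerivAt.prodMk (hφ.hasFDerivAt.prodMk
      (ha.hasFDerivAt.prodMk hb.hasFDerivAt)))).fderiv
  have hv : ∀ (t : Jet) (p q r r' : ℝ), ∃ v : E, fderiv ℝ m e v = t ∧ fderiv ℝ ρ e v = p ∧
      fderiv ℝ φ e v = q ∧ fderiv ℝ a e v = r ∧ fderiv ℝ b e v = r' := by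
    intro t p q r r'
    obtain ⟨v, hv⟩ := hsurj (t, p, q, r, r')
    rw [hder] at hv
    simp only [ContinuousLinearMap.prod_apply, Prod.mk.injEq] at hv
    exact ⟨v, hv⟩
  have h0 := hρ0.ne'
  rw [Fintype.linearIndependent_iff]
  intro c hc
  have key : ∀ v : E, ∑ i, c (Sum.inl i) * s.theta m ρ φ a b i e v
      + ∑ k, c (Sum.inr k) * s.Omega m ρ φ a b u k e v = 0 := fun v => by
    have := DFunLike.congr_fun hc v
    simpa [Fintype.sum_sum_type] using this
  have hvert : ∀ v : E, fderiv ℝ m e v = 0 → (∀ i, s.theta m ρ φ a b i e v = 0) ∧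
      (∀ i, s.wPull m i e v = 0) ∧ (∀ k, s.varpiPull m k e v = 0) := by
    intro v hv
    refine ⟨fun i => ?_, fun i => ?_, fun k => ?_⟩
    · simp [theta, lift, hv]
    · simp [wPull, hv]
    · simp [varpiPull, hv]
  have hΩ : ∀ k, c (Sum.inr k) = 0 := by
    have e1 : ∀ p q r r' : ℝ, c (Sum.inr 0) * (2 / ρ e * p) + c (Sum.inr 1) * (-q)
        + c (Sum.inr 2) * (1 / ρ e ^ 2 * r - a e / ρ e ^ 2 * (q + 1 / ρ e * p))
        + c (Sum.inr 3) * (1 / ρ e ^ 2 * r' + b e / ρ e ^ 2 * (q - 1 / ρ e * p)) = 0 := by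
      intro p q r r'
      obtain ⟨v, hv0, hv1, hv2, hv3, hv4⟩ := hv 0 p q r r'
      obtain ⟨k1, k2, k3⟩ := hvert v hv0
      have := key v
      simp [Fin.sum_univ_four, Omega, Omega1, Omega2, Omega3, Omega4, k1, k2, k3, hv1, hv2, hv3,
        hv4] at this
      linear_combination this
    have c2 : c (Sum.inr 2) = 0 := by simpa [h0] using e1 0 0 1 0
    have c3 : c (Sum.inr 3) = 0 := by simpa [h0] using e1 0 0 0 1
    have c0 : c (Sum.inr 0) = 0 := by simpa [h0, c2, c3] using e1 1 0 0 0
    have c1 : c (Sum.inr 1) = 0 := by simpa [h0, c2, c3] using e1 0 1 0 0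
    intro k
    fin_cases k <;> assumption
  have hθ : ∀ i, c (Sum.inl i) = 0 := by
    have hli : LinearIndependent ℝ
        (fun i => ∑ j, s.redMat m ρ φ a b e i j • s.coframe j (m e)) :=
      (isG0_redMat (a := a) (b := b) (φ := φ) hmU hρ0).1.linearIndependent (fun _ => rfl)
        (linearIndependent_coframe (m e))
    refine Fintype.linearIndependent_iff.1 hli (fun i => c (Sum.inl i)) ?_
    ext t
    obtain ⟨v, hv0, -⟩ := hv t 0 0 0 0
    have := key v
    simp only [hΩ, zero_mul, Finset.sum_const_zero, add_zero] at this
    simpa [theta, lift, hv0] using this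
  rintro (i | k)
  exacts [hθ i, hΩ k]

end Lift
end PDESystem

/-! ### Uniqueness of the normalized lift -/

namespace PDESystem

variable {s : PDESystem}

section Lift

variable {E : Type*} [NormedAddCommGroup E] [NormedSpace ℝ E] {N : Set E} {m : E → Jet}
  {ρ φ a b u : E → ℝ}

/-- The dependence of the connection forms on the variable `u`. -/
theorem Omega_eq_sub {e : E} (hρ : 0 < ρ e) (hρd : DifferentiableAt ℝ ρ e)
    (hφd : DifferentiableAt ℝ φ e) :
    s.Omega m ρ φ a b u 0 e = s.Omega m ρ φ a b (fun _ => 0) 0 e - u e • s.theta m ρ φ a b 0 e ∧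
    s.Omega m ρ φ a b u 1 e = s.Omega m ρ φ a b (fun _ => 0) 1 e ∧
    s.Omega m ρ φ a b u 2 e =
      s.Omega m ρ φ a b (fun _ => 0) 2 e - (u e / 2) • s.theta m ρ φ a b 1 e ∧
    s.Omega m ρ φ a b u 3 e =
      s.Omega m ρ φ a b (fun _ => 0) 3 e - (u e / 2) • s.theta m ρ φ a b 3 e := by
  have hx : ρ e * Real.exp (φ e) ≠ 0 := (mul_pos hρ (Real.exp_pos _)).ne'
  have hy : ρ e * Real.exp (-φ e) ≠ 0 := (mul_pos hρ (Real.exp_pos _)).ne'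
  simp only [Omega_eq_redOmega hρ hρd hφd, theta_eq_redForm hρ]
  refine ⟨?_, ?_, ?_, ?_⟩ <;> ext v <;> simp [redOmega, redForm, redS, Fin.sum_univ_five]
  · ring
  · field_simp
    ring
  · field_simp
    ring

theorem linearIndependent_wPull_of_lift {e : E} (hmU : m e ∈ s.U)
    {g : E → Matrix (Fin 5) (Fin 5) ℝ} (h : LinearIndependent ℝ (fun i => s.lift m g i e)) :
    LinearIndependent ℝ (fun i => s.wPull m i e) :=
  linearIndependent_of_eq_sum (g e * s.normInv (m e)) (fun i => lift_mul_normMat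
    (by rw [Matrix.mul_assoc, normInv_mul_normMat hmU, Matrix.mul_one]) i) h

theorem differentiableAt_wPull (hN : IsOpen N) (hm : ContDiffOn ℝ ∞ m N)
    (hmU : Set.MapsTo m N s.U) (j : Fin 5) : ∀ e ∈ N, DifferentiableAt ℝ (s.wPull m j) e :=
  fun _ he => ((contDiffOn_pullback hN hm hmU (contDiffOn_normCoframe j)).contDiffAt
    (hN.mem_nhds he)).differentiableAt (by simp)

theorem contDiffOn_theta_zero (hN : IsOpen N) (hm : ContDiffOn ℝ ∞ m N)
    (hmU : Set.MapsTo m N s.U) (hρ : ContDiffOn ℝ ∞ ρ N) (hφ : ContDiffOn ℝ ∞ φ N)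
    (hρ0 : ∀ e ∈ N, 0 < ρ e) : ContDiffOn ℝ ∞ (s.theta m ρ φ a b 0) N := by
  refine (((hρ.mul hφ.exp).mul (hρ.mul hφ.neg.exp)).smul
    (contDiffOn_pullback hN hm hmU (contDiffOn_normCoframe (s := s) 0))).congr fun e he => ?_
  rw [theta_eq_redForm (hρ0 e he)]
  simp [redForm, redS, Fin.sum_univ_five, wPull]

/-- The normalized torsion equations determine the coframe, the torsions and the connection forms
up to one function. -/
theorem normalized_lift_eq {g : E → Matrix (Fin 5) (Fin 5) ℝ} {Ω : Fin 4 → E → E →L[ℝ] ℝ}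
    {t313 t314 t323 t512 t545 : E → ℝ} (hN : IsOpen N) (hm : ContDiffOn ℝ ∞ m N)
    (hmU : Set.MapsTo m N s.U) (hg : ∀ i j, ContDiffOn ℝ ∞ (fun e => g e i j) N)
    (hg0 : ∀ e ∈ N, IsG0 (ρ e) (φ e) (g e)) (hΩ : ∀ k, ContDiffOn ℝ ∞ (Ω k) N)
    (hli : ∀ e ∈ N, LinearIndependent ℝ (fun i => s.lift m g i e))
    (h : TorsionNormalized N (s.lift m g) Ω t313 t314 t323 t512 t545) :
    (∀ e ∈ N, g e = s.redMat m ρ φ (fun y => -g y 1 0) (fun y => -g y 3 0) e) ∧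
    (∀ e ∈ N, t314 e = s.t314 m ρ φ e) ∧
    (∀ e ∈ N, t512 e = s.t512 m ρ φ e) ∧
    (∀ e ∈ N, t323 e = s.t323 m ρ φ e) ∧
    (∀ e ∈ N, t545 e = s.t545 m ρ φ e) ∧
    (∀ e ∈ N, t313 e = s.Q m ρ φ (fun y => -g y 1 0) (fun y => -g y 3 0) e) ∧
    ∃ u : E → ℝ, ContDiffOn ℝ ∞ u N ∧
      ∀ k, ∀ e ∈ N,
        Ω k e = s.Omega m ρ φ (fun y => -g y 1 0) (fun y => -g y 3 0) u k e := by
  have hρ0 : ∀ e ∈ N, 0 < ρ e := fun e he => (hg0 e he).2.1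
  have hg11 : ∀ e ∈ N, g e 1 1 = ρ e * Real.exp (φ e) := fun e he => (hg0 e he).2.2.1
  have hg33 : ∀ e ∈ N, g e 3 3 = ρ e * Real.exp (-φ e) := fun e he => (hg0 e he).2.2.2
  have p11 : ∀ e ∈ N, 0 < g e 1 1 := fun e he => by
    rw [hg11 e he]; exact mul_pos (hρ0 e he) (Real.exp_pos _)
  have p33 : ∀ e ∈ N, 0 < g e 3 3 := fun e he => by
    rw [hg33 e he]; exact mul_pos (hρ0 e he) (Real.exp_pos _)
  -- Smoothness of `ρ` and `φ` is not assumed: they are recovered from the smooth matrix `g` as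
  -- `√(g₂₂ g₄₄)` and `log (g₂₂ / ρ)`.
  have hρ : ContDiffOn ℝ ∞ ρ N := by
    refine (((hg 1 1).mul (hg 3 3)).sqrt fun e he =>
      (mul_pos (p11 e he) (p33 e he)).ne').congr fun e he => ?_
    have : g e 1 1 * g e 3 3 = ρ e ^ 2 := by
      rw [hg11 e he, hg33 e he, mul_mul_mul_comm, ← Real.exp_add]
      simp [sq]
    rw [this, Real.sqrt_sq (hρ0 e he).le]
  have hφ : ContDiffOn ℝ ∞ φ N := by
    refine (((hg 1 1).div hρ fun e he => (hρ0 e he).ne').log fun e he =>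
      (div_pos (p11 e he) (hρ0 e he)).ne').congr fun e he => ?_
    change φ e = Real.log (g e 1 1 / ρ e)
    rw [hg11 e he, mul_div_cancel_left₀ _ (hρ0 e he).ne', Real.log_exp]
  have hd : ∀ {f : E → ℝ}, ContDiffOn ℝ ∞ f N → ∀ e ∈ N, DifferentiableAt ℝ f e := fun hf e he =>
    (hf.contDiffAt (hN.mem_nhds he)).differentiableAt (by simp)
  have hP : ∀ i j, ∀ e ∈ N, DifferentiableAt ℝ (fun e => (g e * s.normInv (m e)) i j) e := by
    intro i j e he
    simp only [Matrix.mul_apply]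
    exact DifferentiableAt.fun_sum fun k _ =>
      (hd (hg i k) e he).fun_mul (hd (ContDiffOn.comp (sm_normInv k j) hm hmU) e he)
  have hgP : ∀ e ∈ N, g e = g e * s.normInv (m e) * s.normMat (m e) := fun e he => by
    rw [Matrix.mul_assoc, normInv_mul_normMat (hmU he), Matrix.mul_one]
  have huniq := normalized_lift_unique hN hP
    (fun e he => (hg0 e he).1.mul (isStructureMatrix_normInv (hmU he)))
    (fun i e he => lift_mul_normMat (hgP e he) i) (differentiableAt_wPull hN hm hmU)
    (fun e he => linearIndependent_wPull_of_lift (hmU he) (hli e he))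
    (torsionNormalized_wPull hN hm hmU) h
  have hg' : ∀ e ∈ N, g e = s.redMat m ρ φ (fun y => -g y 1 0) (fun y => -g y 3 0) e := by
    intro e he
    obtain ⟨x, y, a, b, hx⟩ : ∃ x y a b, g e * s.normInv (m e) = redS x y a b :=
      ⟨_, _, _, _, (huniq e he).2.2.1⟩
    have hgP := hgP e he
    rw [hx] at hgP
    have e11 : g e 1 1 = x := by
      rw [hgP]; simp [Matrix.mul_apply, Fin.sum_univ_five, redS, normMat]
    have e33 : g e 3 3 = y := by
      rw [hgP]; simp [Matrix.mul_apply, Fin.sum_univ_five, redS, normMat]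
    -- The sign comes from the upper left entry `-1` of `normMat`.
    have e10 : -g e 1 0 = a := by
      rw [hgP]; simp [Matrix.mul_apply, Fin.sum_univ_five, redS, normMat]
    have e30 : -g e 3 0 = b := by
      rw [hgP]; simp [Matrix.mul_apply, Fin.sum_univ_five, redS, normMat]
    refine hgP.trans ?_
    simp only [redMat, Smat_eq_redS (hρ0 e he), ← hg11 e he, ← hg33 e he, e11, e33, e10, e30]
  have hT := torsionNormalized_theta (s := s) (u := fun _ => 0) hN hm hmU hρ hφ (hg 1 0).neg
    (hg 3 0).neg hρ0
  have hθ : ∀ i, ∀ e ∈ N, s.theta m ρ φ (fun y => -g y 1 0) (fun y => -g y 3 0) i e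
      = s.lift m g i e := fun i e he => by
    simp only [theta, lift, ← hg' e he]
  have hli' : ∀ e ∈ N, LinearIndependent ℝ
      (fun i => s.theta m ρ φ (fun y => -g y 1 0) (fun y => -g y 3 0) i e) := fun e he => by
    simpa only [hθ _ e he] using hli e he
  have hu := connection_unique hli' hT (h.congr hN hθ (fun _ _ _ => rfl) (fun _ _ => rfl)
    (fun _ _ => rfl) (fun _ _ => rfl) (fun _ _ => rfl) (fun _ _ => rfl))
  refine ⟨hg', fun e he => (hu e he).2.1, fun e he => (hu e he).2.2.2.1,
    fun e he => (hu e he).2.2.1, fun e he => (hu e he).2.2.2.2.1, fun e he => (hu e he).1, ?_⟩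
  -- The function `u` is chosen pointwise, with no condition outside `N`. It is smooth because near
  -- each point it is a quotient of smooth functions: `Ω₁` is compared with its value for `u = 0` on
  -- a vector `v` where `θ¹` does not vanish.
  have hu' : ∀ e, ∃ u : ℝ, e ∈ N → _ := fun e =>
    (em (e ∈ N)).elim (fun he => (hu e he).2.2.2.2.2.imp fun u h (_ : e ∈ N) => h)
      fun he => ⟨0, fun h => absurd h he⟩
  choose u hu' using hu'
  refine ⟨u, ?_, ?_⟩
  · intro e₀ he₀
    have hne : s.theta m ρ φ (fun y => -g y 1 0) (fun y => -g y 3 0) 0 e₀ ≠ 0 :=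
      (hli' e₀ he₀).ne_zero 0
    obtain ⟨v, hv⟩ : ∃ v, s.theta m ρ φ (fun y => -g y 1 0) (fun y => -g y 3 0) 0 e₀ v ≠ 0 := by
      by_contra! hv
      exact hne (ContinuousLinearMap.ext hv)
    have c1 : ContDiffAt ℝ ∞
        (fun e => s.theta m ρ φ (fun y => -g y 1 0) (fun y => -g y 3 0) 0 e v) e₀ :=
      ((contDiffOn_theta_zero hN hm hmU hρ hφ hρ0).contDiffAt (hN.mem_nhds he₀)).clm_apply
        contDiffAt_const
    have c2 : ContDiffAt ℝ ∞ (fun e => s.Omega m ρ φ (fun y => -g y 1 0) (fun y => -g y 3 0)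
        (fun _ => 0) 0 e v) e₀ :=
      ((contDiffOn_Omega hN hm hmU hρ hφ (hg 1 0).neg (hg 3 0).neg contDiffOn_const hρ0 0
        ).contDiffAt (hN.mem_nhds he₀)).clm_apply contDiffAt_const
    have c3 : ContDiffAt ℝ ∞ (fun e => Ω 0 e v) e₀ :=
      ((hΩ 0).contDiffAt (hN.mem_nhds he₀)).clm_apply contDiffAt_const
    refine ContDiffAt.contDiffWithinAt (((c2.sub c3).div c1 hv).congr_of_eventuallyEq ?_)
    filter_upwards [hN.mem_nhds he₀, c1.continuousAt.eventually_ne hv] with e he hev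
    have := congrArg (fun L => L v) (hu' e he).1
    simp only [sub_apply, smul_apply, smul_eq_mul] at this
    change u e = (s.Omega m ρ φ (fun y => -g y 1 0) (fun y => -g y 3 0) (fun _ => 0) 0 e v
      - Ω 0 e v) / s.theta m ρ φ (fun y => -g y 1 0) (fun y => -g y 3 0) 0 e v
    rw [eq_div_iff hev]
    linarith
  · intro k e he
    obtain ⟨u0, u1, u2, u3⟩ := hu' e he
    obtain ⟨w0, w1, w2, w3⟩ := Omega_eq_sub (s := s) (m := m) (a := fun y => -g y 1 0)
      (b := fun y => -g y 3 0) (u := u) (hρ0 e he) (hd hρ e he) (hd hφ e he)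
    fin_cases k
    exacts [u0.trans w0.symm, u1.trans w1.symm, u2.trans w2.symm, u3.trans w3.symm]

end Lift

/-! ### Invariance under para-CR equivalences -/

section Equivalence

/-- The frame dual to the initial coframe. -/
def dualFrame (s : PDESystem) (j : Fin 5) (m : Jet) : Jet :=
  (![Pi.single 2 1, Pi.single 3 1, Pi.single 4 1, s.dirD m, s.dirDelta m] : Fin 5 → Jet) j

theorem coframe_dualFrame (i j : Fin 5) (m : Jet) :
    s.coframe i m (s.dualFrame j m) = if i = j then 1 else 0 := by
  fin_cases i <;> fin_cases j <;>
    simp [coframe_zero, coframe_one, coframe_two, coframe_three, coframe_four, dualFrame, dirD,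
      dirDelta]

theorem differentiableAt_dualFrame {m : Jet} (hm : m ∈ s.U) (j : Fin 5) :
    DifferentiableAt ℝ (s.dualFrame j) m := by
  fin_cases j
  exacts [differentiableAt_const _, differentiableAt_const _, differentiableAt_const _,
    (hasFDerivAt_dirD hm).differentiableAt, (hasFDerivAt_dirDelta hm).differentiableAt]

/-- The pullback of the normalized coframe of `s'` is again normalized and is related to that of `s`
by the structure matrices `M' g M⁻¹`. By `normalized_lift_unique` the torsions of the two agree up
to powers of the nonvanishing diagonal entries. -/
theorem IsLocalEquiv.zero_iff {s' : PDESystem} {W : Set Jet} {Φ : Jet → Jet}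
    (h : IsLocalEquiv s s' W Φ) {m : Jet} (hm : m ∈ W) :
    (s'.A (Φ m) = 0 ↔ s.A m = 0) ∧ (s'.B (Φ m) = 0 ↔ s.B m = 0) ∧
      (s'.C (Φ m) = 0 ↔ s.C m = 0) ∧ (s'.Ctilde (Φ m) = 0 ↔ s.Ctilde m = 0) := by
  -- The matrices in `IsLocalEquiv` are only given point by point. Evaluation on the dual frame
  -- shows that they are unique, and gives an expression from which differentiability is clear.
  let g : Jet → Matrix (Fin 5) (Fin 5) ℝ := fun m =>
    Matrix.of fun i j => (s'.coframe i (Φ m)).comp (fderiv ℝ Φ m) (s.dualFrame j m)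
  have hg : ∀ m ∈ W, IsStructureMatrix (g m) ∧
      ∀ i, (s'.coframe i (Φ m)).comp (fderiv ℝ Φ m) = ∑ j, g m i j • s.coframe j m := by
    intro m hm
    obtain ⟨G, hG, hG'⟩ := h.pullback m hm
    have : g m = G := by
      ext i j
      simp only [g, Matrix.of_apply, hG']
      simp [coframe_dualFrame]
    rw [this]
    exact ⟨hG, hG'⟩
  let P : Jet → Matrix (Fin 5) (Fin 5) ℝ := fun m => s'.normMat (Φ m) * g m * s.normInv m
  have hdΦ : ∀ m ∈ W, DifferentiableAt ℝ Φ m := fun m hm =>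
    (h.smooth.contDiffAt (h.isOpen.mem_nhds hm)).differentiableAt (by simp)
  have hdg : ∀ i j, ∀ m ∈ W, DifferentiableAt ℝ (fun m => g m i j) m := by
    intro i j m hm
    exact ((((contDiffOn_pullback h.isOpen h.smooth h.mapsTo (contDiffOn_coframe i)).contDiffAt
      (h.isOpen.mem_nhds hm)).differentiableAt (by simp)).clm_apply
      (differentiableAt_dualFrame (h.subset hm) j))
  have hdP : ∀ i j, ∀ m ∈ W, DifferentiableAt ℝ (fun m => P m i j) m := by
    intro i j m hm
    simp only [P, Matrix.mul_apply]
    refine DifferentiableAt.fun_sum fun k _ => DifferentiableAt.fun_mul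
      (DifferentiableAt.fun_sum fun l _ => DifferentiableAt.fun_mul ?_ (hdg l k m hm))
      ((sm_normInv k j).differentiableAt (h.subset hm))
    exact ((sm_normMat i l).differentiableAt (h.mapsTo hm)).comp m (hdΦ m hm)
  have hθ : ∀ i, ∀ m ∈ W, s'.wPull Φ i m = ∑ j, P m i j • s.normCoframe j m := by
    intro i m hm
    have hPM : P m * s.normMat m = s'.normMat (Φ m) * g m := by
      simp only [P]
      rw [Matrix.mul_assoc, normInv_mul_normMat (h.subset hm), Matrix.mul_one]
    have e1 : s'.wPull Φ i m = ∑ j, (s'.normMat (Φ m) * g m) i j • s.coframe j m := by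
      rw [wPull_eq]
      simp only [(hg m hm).2, Finset.smul_sum, smul_smul, Matrix.mul_apply, Finset.sum_smul]
      exact Finset.sum_comm
    rw [e1, ← hPM]
    simp only [normCoframe, Finset.smul_sum, smul_smul, Matrix.mul_apply, Finset.sum_smul]
    exact Finset.sum_comm
  have hT : TorsionNormalized W s.normCoframe s.varpi s.V (fun m => s.A m / 27)
      (fun m => s.C m / 3) (fun m => s.B m / 27) (fun m => s.Ctilde m / 3) :=
    ⟨fun e he => torsionNormalized_normCoframe.eq1 e (h.subset he),
      fun e he => torsionNormalized_normCoframe.eq2 e (h.subset he),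
      fun e he => torsionNormalized_normCoframe.eq3 e (h.subset he),
      fun e he => torsionNormalized_normCoframe.eq4 e (h.subset he),
      fun e he => torsionNormalized_normCoframe.eq5 e (h.subset he)⟩
  obtain ⟨h1, h3, -, -, tA, tC, tB, tC'⟩ := normalized_lift_unique h.isOpen hdP
    (fun m hm => ((isStructureMatrix_normMat (h.mapsTo hm)).mul (hg m hm).1).mul
      (isStructureMatrix_normInv (h.subset hm))) hθ
    (fun j m hm => differentiableAt_normCoframe (h.subset hm) j)
    (fun m hm => linearIndependent_normCoframe (h.subset hm)) hT
    (torsionNormalized_wPull h.isOpen h.smooth h.mapsTo) m hm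
  have key : ∀ {x y c d : ℝ}, d ≠ 0 → c ≠ 0 → x / c = y / c / d → (x = 0 ↔ y = 0) := by
    intro x y c d hd hc hxy
    have : x = y / d := by
      field_simp at hxy ⊢
      exact hxy
    rw [this, div_eq_zero_iff, or_iff_left hd]
  exact ⟨key (pow_ne_zero 3 h3) (by norm_num) tA, key (pow_ne_zero 3 h1) (by norm_num) tB,
    key h1 (by norm_num) tC, key h3 (by norm_num) tC'⟩

end Equivalence

end PDESystem

end ParaCR

end

theorem mainTheorem4 {E : Type*} [NormedAddCommGroup E] [NormedSpace ℝ E]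
    (s : ParaCR.PDESystem) :
    -- The normalizations determine the coframe, the torsions, and the connection forms up to `u₁`.
    (∀ (N : Set E) (m : E → ParaCR.Jet) (g : E → Matrix (Fin 5) (Fin 5) ℝ) (ρ φ : E → ℝ)
        (Ω : Fin 4 → E → E →L[ℝ] ℝ) (t313 t314 t323 t512 t545 : E → ℝ),
        IsOpen N → ContDiffOn ℝ ∞ m N → Set.MapsTo m N s.U →
        (∀ i j, ContDiffOn ℝ ∞ (fun e => g e i j) N) →
        (∀ e ∈ N, ParaCR.IsG0 (ρ e) (φ e) (g e)) →
        (∀ k, ContDiffOn ℝ ∞ (Ω k) N) →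
        (∀ e ∈ N, LinearIndependent ℝ (fun i => s.lift m g i e)) →
        ParaCR.TorsionNormalized N (s.lift m g) Ω t313 t314 t323 t512 t545 →
        (∀ e ∈ N, g e =
          s.redMat m ρ φ (fun y => -g y 1 0) (fun y => -g y 3 0) e) ∧
        (∀ e ∈ N, t314 e = s.t314 m ρ φ e) ∧
        (∀ e ∈ N, t512 e = s.t512 m ρ φ e) ∧
        (∀ e ∈ N, t323 e = s.t323 m ρ φ e) ∧
        (∀ e ∈ N, t545 e = s.t545 m ρ φ e) ∧
        (∀ e ∈ N, t313 e = s.Q m ρ φ (fun y => -g y 1 0) (fun y => -g y 3 0) e) ∧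
        ∃ u : E → ℝ, ContDiffOn ℝ ∞ u N ∧
          ∀ k, ∀ e ∈ N,
            Ω k e = s.Omega m ρ φ (fun y => -g y 1 0) (fun y => -g y 3 0) u k e) ∧
    -- Conversely, these forms satisfy the normalized equations, for all `ρ, φ, f², f̄², u₁`.
    (∀ (N : Set E) (m : E → ParaCR.Jet) (ρ φ a b u : E → ℝ),
        IsOpen N → ContDiffOn ℝ ∞ m N → Set.MapsTo m N s.U →
        ContDiffOn ℝ ∞ ρ N → ContDiffOn ℝ ∞ φ N → ContDiffOn ℝ ∞ a N → ContDiffOn ℝ ∞ b N →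
        ContDiffOn ℝ ∞ u N → (∀ e ∈ N, 0 < ρ e) →
        (∀ e ∈ N, ParaCR.IsG0 (ρ e) (φ e) (s.redMat m ρ φ a b e)) ∧
        (∀ k, ContDiffOn ℝ ∞ (s.Omega m ρ φ a b u k) N) ∧
        ParaCR.TorsionNormalized N (s.theta m ρ φ a b) (s.Omega m ρ φ a b u)
          (s.Q m ρ φ a b) (s.t314 m ρ φ) (s.t323 m ρ φ) (s.t512 m ρ φ) (s.t545 m ρ φ) ∧
        ∀ e ∈ N,
          Function.Surjective (fderiv ℝ (fun y => (m y, ρ y, φ y, a y, b y)) e) →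
          LinearIndependent ℝ (Sum.elim (fun i => s.theta m ρ φ a b i e)
            (fun k => s.Omega m ρ φ a b u k e))) ∧
    -- The vanishing or not of `A`, `B`, `C`, `C̃` at a point is a para-CR invariant property.
    (∀ (s' : ParaCR.PDESystem) (W : Set ParaCR.Jet) (Φ : ParaCR.Jet → ParaCR.Jet),
        ParaCR.PDESystem.IsLocalEquiv s s' W Φ → ∀ m ∈ W,
        (s'.A (Φ m) = 0 ↔ s.A m = 0) ∧ (s'.B (Φ m) = 0 ↔ s.B m = 0) ∧
        (s'.C (Φ m) = 0 ↔ s.C m = 0) ∧ (s'.Ctilde (Φ m) = 0 ↔ s.Ctilde m = 0)) := by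
  refine ⟨?_, ?_, ?_⟩
  · intro N m g ρ φ Ω t313 t314 t323 t512 t545 hN hm hmU hg hg0 hΩ hli h
    exact ParaCR.PDESystem.normalized_lift_eq hN hm hmU hg hg0 hΩ hli h
  · intro N m ρ φ a b u hN hm hmU hρ hφ ha hb hu hρ0
    have hd : ∀ {f : E → ℝ}, ContDiffOn ℝ ∞ f N → ∀ e ∈ N, DifferentiableAt ℝ f e :=
      fun hf e he => (hf.contDiffAt (hN.mem_nhds he)).differentiableAt (by simp)
    refine ⟨fun e he => ParaCR.PDESystem.isG0_redMat (hmU he) (hρ0 e he),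
      ParaCR.PDESystem.contDiffOn_Omega hN hm hmU hρ hφ ha hb hu hρ0,
      ParaCR.PDESystem.torsionNormalized_theta hN hm hmU hρ hφ ha hb hρ0, fun e he hs => ?_⟩
    exact ParaCR.PDESystem.linearIndependent_theta_Omega (hmU he)
      ((hm.contDiffAt (hN.mem_nhds he)).differentiableAt (by simp)) (hd hρ e he) (hd hφ e he)
      (hd ha e he) (hd hb e he) (hρ0 e he) hs
  · intro s' W Φ h m hm
    exact h.zero_iff hm
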